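/- Let $X$ be a smooth manifold of dimension $n$ with a volume form $\omega$, and let $\pi:Y\to X$ be a smooth fibred manifold (for instance a smooth fibre bundle; manifolds are Hausdorff and second countable, without boundary). For a manifold $M$ over $X$ let $\bigwedge^p_q(M)$ be the $p$-forms on $M$ that vanish under the interior product with any $q+1$ vertical vectors (vectors killed by the differential of the projection to $X$); forms in $\bigwedge^p_0(M)$ are called horizontal, and a multivector is called vertical if its interior product with every horizontal form is zero. The extended polymomentum phase space is $Z=\bigwedge^n_1(Y)/\bigwedge^n_0(Y)$, a manifold over $Y$ and hence over $X$. It carries the canonical class $\Theta$ of $n$-forms modulo $\bigwedge^n_0(Z)$, which at the point $[\alpha]\in Z$ over $y\in Y$ is the class of the pullback of $\alpha$, and the polysymplectic form $\Omega=[d\Theta \bmod \bigwedge^{n+1}_1(Z)]$. For $0\le p\le n-1$, a smooth horizontal $p$-form $F$ on $Z$ is called Hamiltonian if there is a smooth vertical multivector field $X_F$ of degree $n-p$ on $Z$ with $X_F\lrcorner\,\Omega=dF$, the equation being one between classes of forms modulo horizontal forms; $X_F$ is called a Hamiltonian multivector field of $F$. The interior product is normalised by $(v_1\wedge\dots\wedge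 v_k)\lrcorner\,\alpha=v_1\lrcorner(v_2\lrcorner\cdots(v_k\lrcorner\,\alpha))$, and $[\![\ ,\ ]\!]$ denotes the Schouten–Nijenhuis bracket extending the Lie bracket of vector fields, with $[\![P,Q\wedge R]\!]=[\![P,Q]\!]\wedge R+(-1)^{(|P|-1)|Q|}Q\wedge[\![P,R]\!]$ and $[\![P,Q]\!]=-(-1)^{(|P|-1)(|Q|-1)}[\![Q,P]\!]$. The co-exterior product of horizontal forms is $F\bullet G=(A\wedge B)\lrcorner\,\omega$, where $A$, $B$ are multivectors with $A\lrcorner\,\omega=F$ and $B\lrcorner\,\omega=G$ (and $\omega$ is pulled back to $Z$). The bracket of a Hamiltonian $p$-form $F$ and a Hamiltonian $q$-form $G$ is $\{F,G\}=(-1)^{n-p}X_F\lrcorner\, dG$. Then: 1. Whether $F$ is Hamiltonian, and which fields are Hamiltonian fields of $F$, does not depend on the representative of $\Omega$; the bracket does not depend on the representatives of $X_F$ and $\Omega$, and the co-exterior product does not depend on $A$ and $B$. Moreover $\{F,G\}=(-1)^{n-p}X_F\lrcorner X_G\lrcorner\,\Omega$, and $-d\{F,G\}=[\![X_F,X_G]\!]\lrcorner\,\Omega$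 modulo horizontal forms. If $p+q+1\ge n$, then $\{F,G\}$ is a Hamiltonian $(p+q+1-n)$-form and $-[\![X_F,X_G]\!]$ is a Hamiltonian multivector field of it; if $p+q+1<n$, then $\{F,G\}=0$. 2. The Hamiltonian $p$-forms form a vector space for each $p$, and with $\{\ ,\ \}$ and $\bullet$ the Hamiltonian forms are a Poisson–Gerstenhaber algebra. That is: the bracket is bilinear; $\bullet$ is bilinear, maps Hamiltonian $p$- and $q$-forms to Hamiltonian $(p+q-n)$-forms ($F\bullet G=0$ if $p+q<n$), is associative, and satisfies $F\bullet G=(-1)^{(n-p)(n-q)}G\bullet F$; and for Hamiltonian forms $F_1,F_2,F_3$ of degrees $p,q,r$, with $g_1=n-p-1$, $g_2=n-q-1$, $g_3=n-r-1$, $$\{F_1,F_2\}=-(-1)^{g_1g_2}\{F_2,F_1\},$$ $$(-1)^{g_1g_3}\{F_1,\{F_2,F_3\}\}+(-1)^{g_1g_2}\{F_2,\{F_3,F_1\}\}+(-1)^{g_2g_3}\{F_3,\{F_1,F_2\}\}=0,$$ $$\{F_1,F_2\bullet F_3\}=\{F_1,F_2\}\bullet F_3+(-1)^{g_1(g_2+1)}F_2\bullet\{F_1,F_3\}.$$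 -/

import Mathlib

open scoped Manifold ContDiff

noncomputable section

namespace Polysymplectic

/-! ### Linear algebra at one point

Multivectors are elements of the exterior algebra of a (tangent) space `E`, exterior forms are
elements of the exterior algebra of the dual space; the product `*` is the exterior product. -/

section Linear

variable {E E' E'' : Type*} [AddCommGroup E] [Module ℝ E] [AddCommGroup E'] [Module ℝ E']
  [AddCommGroup E''] [Module ℝ E'']

/-- Multivectors over `E`. -/
abbrev Multivec (E : Type*) [AddCommGroup E] [Module ℝ E] : Type _ := ExteriorAlgebra ℝ E

/-- Exterior forms over `E`. -/
abbrev Covec (E : Type*) [AddCommGroup E] [Module ℝ E] : Type _ :=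
  ExteriorAlgebra ℝ (Module.Dual ℝ E)

/-- The interior product `X ⌟ α` of a multivector with a form, normalised by
`(v₁ ∧ ⋯ ∧ vₖ) ⌟ α = v₁ ⌟ (v₂ ⌟ ⋯ (vₖ ⌟ α))`, where a vector `v` acts as the antiderivation
with `v ⌟ ε = ε v` on covectors. -/
def contr : Multivec E →ₐ[ℝ] Module.End ℝ (Covec E) :=
  ExteriorAlgebra.lift ℝ
    ⟨(CliffordAlgebra.contractLeft (Q := (0 : QuadraticForm ℝ (Module.Dual ℝ E)))) ∘ₗ
        Module.Dual.eval ℝ E, fun v =>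
      LinearMap.ext fun x => CliffordAlgebra.contractLeft_contractLeft
        (Module.Dual.eval ℝ E v) x⟩

/-- Pullback of forms along a linear map. -/
def pull (T : E →ₗ[ℝ] E') : Covec E' →ₐ[ℝ] Covec E := ExteriorAlgebra.map T.dualMap

/-- Pushforward of multivectors along a linear map. -/
def push (T : E →ₗ[ℝ] E') : Multivec E →ₐ[ℝ] Multivec E' := ExteriorAlgebra.map T

/-- The forms which are annihilated by `k` arbitrary vectors of `V`. -/
def annBy (V : Submodule ℝ E) : ℕ → Submodule ℝ (Covec E)
  | 0 => ⊥
  | k + 1 => ⨅ v : V, (annBy V k).comap (contr (ExteriorAlgebra.ι ℝ (v : E)))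

/-- `⋀^p_q` at one point, for the space `V` of vertical vectors: the `p`-forms which are
annihilated by `q + 1` arbitrary vertical vectors. -/
def formsAt (V : Submodule ℝ E) (p q : ℕ) : Submodule ℝ (Covec E) :=
  ⋀[ℝ]^p (Module.Dual ℝ E) ⊓ annBy V (q + 1)

/-- Horizontal forms (of mixed degree): those annihilated by one arbitrary vertical vector. -/
def horizontal (V : Submodule ℝ E) : Submodule ℝ (Covec E) := annBy V 1

/-- A multivector is vertical if its interior product with every horizontal form vanishes. -/
def IsVertical (V : Submodule ℝ E) (X : Multivec E) : Prop :=
  ∀ α ∈ horizontal V, contr X α = 0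

/-- The quotient `⋀^n_1 / ⋀^n_0` at one point. -/
def polyFibre (n : ℕ) (V : Submodule ℝ E) : Type _ :=
  ↥(formsAt V n 1) ⧸ (formsAt V n 0).submoduleOf (formsAt V n 1)

instance (n : ℕ) (V : Submodule ℝ E) : AddCommGroup (polyFibre n V) :=
  inferInstanceAs (AddCommGroup (↥(formsAt V n 1) ⧸ (formsAt V n 0).submoduleOf (formsAt V n 1)))

instance (n : ℕ) (V : Submodule ℝ E) : Module ℝ (polyFibre n V) :=
  inferInstanceAs (Module ℝ (↥(formsAt V n 1) ⧸ (formsAt V n 0).submoduleOf (formsAt V n 1)))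

/-- The class in `⋀^n_1 / ⋀^n_0` of an element of `⋀^n_1`. -/
def polyFibre.mk (n : ℕ) (V : Submodule ℝ E) : formsAt V n 1 →ₗ[ℝ] polyFibre n V :=
  ((formsAt V n 0).submoduleOf (formsAt V n 1)).mkQ

theorem polyFibre.mk_surjective (n : ℕ) (V : Submodule ℝ E) :
    Function.Surjective (polyFibre.mk n V) :=
  Submodule.mkQ_surjective _

open Classical in
/-- The co-exterior product of the forms `a = A ⌟ w` and `b = B ⌟ w`, for a volume form `w`:
it is `(A ∧ B) ⌟ w`. -/
def coext (w a b : Covec E) : Covec E :=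
  if h : ∃ AB : Multivec E × Multivec E, contr AB.1 w = a ∧ contr AB.2 w = b then
    contr (h.choose.1 * h.choose.2) w
  else 0

theorem contr_ι_algebraMap (v : E) (r : ℝ) :
    contr (ExteriorAlgebra.ι ℝ v) (algebraMap ℝ (Covec E) r) = 0 := by
  rw [contr, ExteriorAlgebra.lift_ι_apply]
  exact CliffordAlgebra.contractLeft_algebraMap (d := Module.Dual.eval ℝ E v) _ r

theorem contr_ι_ι_mul (v : E) (a : Module.Dual ℝ E) (b : Covec E) :
    contr (ExteriorAlgebra.ι ℝ v) (ExteriorAlgebra.ι ℝ a * b) =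
      a v • b - ExteriorAlgebra.ι ℝ a * contr (ExteriorAlgebra.ι ℝ v) b := by
  rw [contr, ExteriorAlgebra.lift_ι_apply]
  exact CliffordAlgebra.contractLeft_ι_mul (Module.Dual.eval ℝ E v) a b

theorem contr_ι_pull (T : E →ₗ[ℝ] E') (v : E) (α : Covec E') :
    contr (ExteriorAlgebra.ι ℝ v) (pull T α) =
      pull T (contr (ExteriorAlgebra.ι ℝ (T v)) α) := by
  induction α using CliffordAlgebra.left_induction with
  | algebraMap r =>
    have h1 : pull T (algebraMap ℝ (Covec E') r) = algebraMap ℝ (Covec E) r :=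
      AlgHom.commutes _ r
    have h2 := contr_ι_algebraMap (T v) r
    have h3 := contr_ι_algebraMap v r
    refine Eq.trans (congrArg _ h1) (h3.trans ?_)
    exact ((congrArg (pull T) h2).trans (map_zero _)).symm
  | add x y hx hy => simp only [map_add, hx, hy]
  | ι_mul b a hb =>
    have h1 : pull T (ExteriorAlgebra.ι ℝ a * b) =
        ExteriorAlgebra.ι ℝ (T.dualMap a) * pull T b := by
      rw [map_mul, pull, ExteriorAlgebra.map_apply_ι]
    have h2 := contr_ι_ι_mul (T v) a b
    refine Eq.trans (congrArg _ h1) ?_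
    refine Eq.trans ?_ (congrArg (pull T) h2).symm
    rw [contr_ι_ι_mul, hb, map_sub, map_smul, map_mul, pull, ExteriorAlgebra.map_apply_ι]
    rfl

theorem pull_mem_annBy {V : Submodule ℝ E} {V' : Submodule ℝ E'} {T : E →ₗ[ℝ] E'}
    (h : V ≤ V'.comap T) (k : ℕ) :
    ∀ {α : Covec E'}, α ∈ annBy V' k → pull T α ∈ annBy V k := by
  induction k with
  | zero =>
    intro α hα
    simp only [annBy, Submodule.mem_bot] at hα ⊢
    rw [hα, map_zero]
  | succ k ih =>
    intro α hα
    simp only [annBy, Submodule.mem_iInf, Submodule.mem_comap] at hα ⊢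
    intro v
    rw [contr_ι_pull]
    exact ih (hα ⟨T v, h v.2⟩)

theorem pull_mem_formsAt {V : Submodule ℝ E} {V' : Submodule ℝ E'} {T : E →ₗ[ℝ] E'}
    (h : V ≤ V'.comap T) {p q : ℕ} {α : Covec E'} (hα : α ∈ formsAt V' p q) :
    pull T α ∈ formsAt V p q := by
  refine ⟨?_, pull_mem_annBy h _ hα.2⟩
  have h1 : (⋀[ℝ]^p (Module.Dual ℝ E')).map (pull T).toLinearMap ≤ ⋀[ℝ]^p (Module.Dual ℝ E) := by
    rw [ExteriorAlgebra.exteriorPower, ExteriorAlgebra.exteriorPower, Submodule.map_pow]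
    refine pow_le_pow_left' ?_ p
    rintro _ ⟨_, ⟨a, rfl⟩, rfl⟩
    exact ⟨T.dualMap a, (ExteriorAlgebra.map_apply_ι _ _).symm⟩
  exact h1 ⟨α, hα.1, rfl⟩

/-- The pullback of forms along a linear map which preserves verticality, on `⋀^n_1`. -/
def pullForms (n : ℕ) {V : Submodule ℝ E} {V' : Submodule ℝ E'} {T : E →ₗ[ℝ] E'}
    (h : V ≤ V'.comap T) : formsAt V' n 1 →ₗ[ℝ] formsAt V n 1 where
  toFun α := ⟨pull T α, pull_mem_formsAt h α.2⟩
  map_add' α β := Subtype.ext (map_add (pull T) (α : Covec E') β)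
  map_smul' c α := Subtype.ext (map_smul (pull T) c (α : Covec E'))

/-- The map induced on the quotients `⋀^n_1 / ⋀^n_0` by the pullback of forms along a linear
map which preserves verticality. -/
def qmapOf (n : ℕ) {V : Submodule ℝ E} {V' : Submodule ℝ E'} {T : E →ₗ[ℝ] E'}
    (h : V ≤ V'.comap T) : polyFibre n V' →ₗ[ℝ] polyFibre n V :=
  Submodule.liftQ ((formsAt V' n 0).submoduleOf (formsAt V' n 1))
    (polyFibre.mk n V ∘ₗ pullForms n h) fun _ hx =>
      (Submodule.Quotient.mk_eq_zero _).2 (pull_mem_formsAt (p := n) (q := 0) h hx)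

open Classical in
/-- The map induced on the quotients `⋀^n_1 / ⋀^n_0` by the pullback of forms along a linear
map which preserves verticality (and `0` for other linear maps). -/
def qmap (n : ℕ) (V : Submodule ℝ E) (V' : Submodule ℝ E') (T : E →ₗ[ℝ] E') :
    polyFibre n V' →ₗ[ℝ] polyFibre n V :=
  if h : V ≤ V'.comap T then qmapOf n h else 0

theorem qmap_mk {n : ℕ} {V : Submodule ℝ E} {V' : Submodule ℝ E'} {T : E →ₗ[ℝ] E'}
    (h : V ≤ V'.comap T) (α : formsAt V' n 1) :
    qmap n V V' T (polyFibre.mk n V' α) =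
      polyFibre.mk n V ⟨pull T α, pull_mem_formsAt h α.2⟩ := by
  have h1 : qmap n V V' T = qmapOf n h := dif_pos h
  rw [h1]
  rfl

theorem pull_comp_apply (T : E →ₗ[ℝ] E') (T' : E' →ₗ[ℝ] E'') (α : Covec E'') :
    pull T (pull T' α) = pull (T' ∘ₗ T) α := by
  have := ExteriorAlgebra.map_comp_map T'.dualMap T.dualMap
  exact DFunLike.congr_fun this α

theorem qmap_qmap {n : ℕ} {V : Submodule ℝ E} {V' : Submodule ℝ E'} {V'' : Submodule ℝ E''}
    {T : E →ₗ[ℝ] E'} {T' : E' →ₗ[ℝ] E''} (h : V ≤ V'.comap T) (h' : V' ≤ V''.comap T')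
    (q : polyFibre n V'') :
    qmap n V V' T (qmap n V' V'' T' q) = qmap n V V'' (T' ∘ₗ T) q := by
  obtain ⟨α, rfl⟩ := polyFibre.mk_surjective _ _ q
  rw [qmap_mk h', qmap_mk h, qmap_mk (h.trans fun x hx => h' hx)]
  congr 2
  exact pull_comp_apply _ _ _

theorem qmap_id {n : ℕ} {V : Submodule ℝ E} (q : polyFibre n V) :
    qmap n V V LinearMap.id q = q := by
  obtain ⟨α, rfl⟩ := polyFibre.mk_surjective _ _ q
  rw [qmap_mk (le_of_eq (by simp))]
  congr 1
  apply Subtype.ext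
  have : pull (LinearMap.id : E →ₗ[ℝ] E) = AlgHom.id ℝ (Covec E) := by
    rw [pull, LinearMap.dualMap_id]; exact ExteriorAlgebra.map_id
  exact DFunLike.congr_fun this (α : Covec E)

/-- Linear coordinates on the exterior algebra of a finite-dimensional space. -/
def extCoord (V : Type*) [AddCommGroup V] [Module ℝ V] [Module.Finite ℝ V] :
    ExteriorAlgebra ℝ V ≃ₗ[ℝ] (Finset (Fin (Module.finrank ℝ V)) → ℝ) :=
  (Module.finBasis ℝ V).ExteriorAlgebra.equivFun

instance (V : Type*) [AddCommGroup V] [Module ℝ V] [Module.Finite ℝ V] :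
    Module.Finite ℝ (ExteriorAlgebra ℝ V) :=
  Module.Finite.of_basis (Module.finBasis ℝ V).ExteriorAlgebra

instance [Module.Finite ℝ E] (n : ℕ) (V : Submodule ℝ E) : Module.Finite ℝ (polyFibre n V) :=
  Module.Finite.of_surjective _ (polyFibre.mk_surjective n V)

end Linear

/-! ### Exterior calculus in a vector space -/

section Local

variable {E : Type*} [NormedAddCommGroup E] [NormedSpace ℝ E] [FiniteDimensional ℝ E]
  {V : Type*} [AddCommGroup V] [Module ℝ V] [Module.Finite ℝ V]

/-- Smoothness of a map with values in an exterior algebra. -/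
def SmoothOnExt (f : E → ExteriorAlgebra ℝ V) (s : Set E) : Prop :=
  ContDiffOn ℝ ∞ (fun u => extCoord V (f u)) s

/-- The derivative at `u` in direction `v` of a map with values in an exterior algebra. -/
def dirDeriv (f : E → ExteriorAlgebra ℝ V) (u v : E) : ExteriorAlgebra ℝ V :=
  (extCoord V).symm (fderiv ℝ (fun u' => extCoord V (f u')) u v)

/-- The exterior derivative `dα = ∑ᵢ dxⁱ ∧ ∂ᵢα` in linear coordinates. -/
def extDLoc (α : E → Covec E) (u : E) : Covec E :=
  ∑ i, ExteriorAlgebra.ι ℝ ((Module.finBasis ℝ E).coord i) *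
    dirDeriv α u (Module.finBasis ℝ E i)

/-- The Schouten–Nijenhuis bracket of multivector fields in linear coordinates,
`∑ᵢ (P ⌊ dxⁱ) ∧ ∂ᵢQ - ∂ᵢP ∧ (dxⁱ ⌋ Q)`, with the contractions of `dxⁱ` from the right into `P`
and from the left into `Q`. It extends the Lie bracket of vector fields and the derivative of
functions along vector fields by `[P, Q ∧ R] = [P, Q] ∧ R + (-1)^((|P| - 1)|Q|) Q ∧ [P, R]` and
`[P, Q] = -(-1)^((|P| - 1)(|Q| - 1)) [Q, P]`. -/
def schoutenLoc (P Q : E → Multivec E) (u : E) : Multivec E :=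
  ∑ i, (CliffordAlgebra.contractRight (Q := (0 : QuadraticForm ℝ E)) (P u)
        ((Module.finBasis ℝ E).coord i) * dirDeriv Q u (Module.finBasis ℝ E i) -
      dirDeriv P u (Module.finBasis ℝ E i) *
        CliffordAlgebra.contractLeft (Q := (0 : QuadraticForm ℝ E))
          ((Module.finBasis ℝ E).coord i) (Q u))

theorem extCoord_mul (a b : ExteriorAlgebra ℝ V) :
    extCoord V (a * b) = ∑ s, ∑ t, (extCoord V a s * extCoord V b t) •
      extCoord V ((Module.finBasis ℝ V).ExteriorAlgebra s *
        (Module.finBasis ℝ V).ExteriorAlgebra t) := by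
  conv_lhs => rw [← (Module.finBasis ℝ V).ExteriorAlgebra.sum_equivFun a,
    ← (Module.finBasis ℝ V).ExteriorAlgebra.sum_equivFun b, Finset.sum_mul_sum]
  simp only [map_sum, smul_mul_smul_comm, map_smul]
  rfl

theorem SmoothOnExt.mul {f g : E → ExteriorAlgebra ℝ V} {s : Set E} (hf : SmoothOnExt f s)
    (hg : SmoothOnExt g s) : SmoothOnExt (fun u => f u * g u) s := by
  have hf' := contDiffOn_pi.1 hf
  have hg' := contDiffOn_pi.1 hg
  have h : (fun u => extCoord V (f u * g u)) = fun u => ∑ s, ∑ t,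
      (extCoord V (f u) s * extCoord V (g u) t) • extCoord V
        ((Module.finBasis ℝ V).ExteriorAlgebra s * (Module.finBasis ℝ V).ExteriorAlgebra t) :=
    funext fun u => extCoord_mul (f u) (g u)
  rw [SmoothOnExt, h]
  exact ContDiffOn.sum fun i _ => ContDiffOn.sum fun j _ =>
    ((hf' i).mul (hg' j)).smul contDiffOn_const

theorem smoothOnExt_pull {F F' : Type*} [NormedAddCommGroup F] [NormedSpace ℝ F]
    [FiniteDimensional ℝ F] [NormedAddCommGroup F'] [NormedSpace ℝ F'] [FiniteDimensional ℝ F']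
    {L : E → F →L[ℝ] F'} {s : Set E} (hL : ContDiffOn ℝ ∞ L s) (β : Covec F') :
    SmoothOnExt (fun u => pull (L u).toLinearMap β) s := by
  induction β using ExteriorAlgebra.induction with
  | algebraMap r =>
    have : ∀ u, pull (L u).toLinearMap (algebraMap ℝ (Covec F') r) =
      algebraMap ℝ (Covec F) r := fun u => AlgHom.commutes _ r
    simp only [SmoothOnExt, this]
    exact contDiffOn_const
  | ι a =>
    let Φ : (F →L[ℝ] F') →ₗ[ℝ] (Finset (Fin (Module.finrank ℝ (Module.Dual ℝ F))) → ℝ) :=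
      { toFun := fun T => extCoord (Module.Dual ℝ F)
          (ExteriorAlgebra.ι ℝ (a ∘ₗ T.toLinearMap))
        map_add' := fun T T' => by
          rw [← map_add, ← map_add, ← LinearMap.comp_add]; rfl
        map_smul' := fun c T => by
          rw [RingHom.id_apply, ← map_smul, ← map_smul, ← LinearMap.comp_smul]; rfl }
    have h1 : ContDiff ℝ ∞ Φ := (LinearMap.toContinuousLinearMap Φ).contDiff
    have h2 : (fun u => extCoord (Module.Dual ℝ F)
        (pull (L u).toLinearMap (ExteriorAlgebra.ι ℝ a))) = Φ ∘ L := by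
      funext u
      simp only [pull, ExteriorAlgebra.map_apply_ι]
      rfl
    simp only [SmoothOnExt, h2]
    exact h1.comp_contDiffOn hL
  | mul a b ha hb => simpa only [map_mul] using ha.mul hb
  | add a b ha hb =>
    simp only [SmoothOnExt, map_add] at ha hb ⊢
    exact ha.add hb

theorem contDiffOn_pull {F F' : Type*} [NormedAddCommGroup F] [NormedSpace ℝ F]
    [FiniteDimensional ℝ F] [NormedAddCommGroup F'] [NormedSpace ℝ F'] [FiniteDimensional ℝ F']
    {L : E → F →L[ℝ] F'} {s : Set E} (hL : ContDiffOn ℝ ∞ L s) (β : Covec F')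
    (ℓ : Covec F →ₗ[ℝ] ℝ) : ContDiffOn ℝ ∞ (fun u => ℓ (pull (L u).toLinearMap β)) s := by
  have h2 := (LinearMap.toContinuousLinearMap
    (ℓ ∘ₗ (extCoord (Module.Dual ℝ F)).symm.toLinearMap)).contDiff (n := ∞)
  refine (h2.comp_contDiffOn (smoothOnExt_pull hL β)).congr fun w _ => ?_
  simp

theorem contDiffOn_sum_mul {N : ℕ} {g : Fin N → E → ℝ} {s : Set E}
    (hg : ∀ i, ContDiffOn ℝ ∞ (g i) s) :
    ContDiffOn ℝ ∞ (fun w : E × (Fin N → ℝ) => ∑ i, w.2 i * g i w.1) (Prod.fst ⁻¹' s) :=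
  ContDiffOn.sum fun i _ => ContDiffOn.mul
    ((contDiff_apply ℝ ℝ i).comp contDiff_snd).contDiffOn
    ((hg i).comp contDiff_fst.contDiffOn fun _ hw => hw)

theorem coord_qmap {F : Type*} [AddCommGroup F] [Module ℝ F] (n : ℕ) {W : Submodule ℝ F} {N : ℕ}
    (φ : polyFibre n W ≃ₗ[ℝ] (Fin N → ℝ)) :
    ∃ (α : Fin N → Covec F) (ℓ : Fin N → Covec F →ₗ[ℝ] ℝ),
      ∀ T : F →ₗ[ℝ] F, W ≤ W.comap T → ∀ p j,
        φ (qmap n W W T (φ.symm p)) j = ∑ i, p i * ℓ j (pull T (α i)) := by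
  have hrep : ∀ i, ∃ α : formsAt W n 1,
      polyFibre.mk n W α = φ.symm (Pi.single i 1) :=
    fun i => polyFibre.mk_surjective _ _ _
  choose α hα using hrep
  have hext : ∀ j, ∃ ℓ : Covec F →ₗ[ℝ] ℝ,
      ∀ β : formsAt W n 1, ℓ β = φ (polyFibre.mk n W β) j := by
    intro j
    obtain ⟨ℓ, hℓ⟩ := LinearMap.exists_extend (p := formsAt W n 1)
      ((LinearMap.proj j ∘ₗ φ.toLinearMap) ∘ₗ polyFibre.mk n W)
    exact ⟨ℓ, fun β => DFunLike.congr_fun hℓ β⟩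
  choose ℓ hℓ using hext
  refine ⟨fun i => α i, ℓ, fun T hT p j => ?_⟩
  have h := LinearMap.pi_apply_eq_sum_univ (φ.toLinearMap ∘ₗ
    qmap n W W T ∘ₗ φ.symm.toLinearMap) p
  refine (congrFun h j).trans ?_
  rw [Finset.sum_apply]
  refine Finset.sum_congr rfl fun i _ => ?_
  rw [Pi.smul_apply, smul_eq_mul]
  congr 1
  have h2 : (fun k => if i = k then 1 else 0) = (Pi.single i 1 : Fin N → ℝ) := by
    funext k; simp [Pi.single_apply, eq_comm]
  rw [h2]
  change φ (qmap n _ _ T (φ.symm (Pi.single i 1))) j = _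
  rw [← hα i, qmap_mk hT]
  exact (hℓ j ⟨_, pull_mem_formsAt hT (α i).2⟩).symm

theorem contDiffOn_qmap {F : Type*} [NormedAddCommGroup F] [NormedSpace ℝ F]
    [FiniteDimensional ℝ F] (n : ℕ) {W : Submodule ℝ F} {N : ℕ}
    (φ : polyFibre n W ≃ₗ[ℝ] (Fin N → ℝ)) {L : E → F →L[ℝ] F} {s : Set E}
    (hL : ContDiffOn ℝ ∞ L s) (hW : ∀ u ∈ s, W ≤ W.comap (L u).toLinearMap) :
    ContDiffOn ℝ ∞ (fun w : E × (Fin N → ℝ) =>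
      φ (qmap n W W (L w.1).toLinearMap (φ.symm w.2))) (Prod.fst ⁻¹' s) := by
  obtain ⟨α, ℓ, h⟩ := coord_qmap n φ
  refine contDiffOn_pi.2 fun j => ?_
  exact (contDiffOn_sum_mul fun i => contDiffOn_pull hL (α i) (ℓ j)).congr
    fun w hw => h _ (hW _ hw) _ _

end Local

/-! ### Forms and multivector fields on manifolds

A (mixed degree) form on `M`, modelled on `E`, is a map `α : M → Covec E`, the value at `z` being
a form on the tangent space at `z` (which is `E` by definition); similarly for multivectors. -/

section Manifold

variable {E : Type*} [NormedAddCommGroup E] [NormedSpace ℝ E]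
  {M : Type*} [TopologicalSpace M] [ChartedSpace E M]

/-- The tangent map of `f` at `z`. -/
def tmap (E E' : Type*) [NormedAddCommGroup E] [NormedSpace ℝ E]
    [NormedAddCommGroup E'] [NormedSpace ℝ E'] {M : Type*} [TopologicalSpace M]
    [ChartedSpace E M] {M' : Type*} [TopologicalSpace M'] [ChartedSpace E' M']
    (f : M → M') (z : M) : E →ₗ[ℝ] E' :=
  (mfderiv 𝓘(ℝ, E) 𝓘(ℝ, E') f z).toLinearMap

/-- The vertical tangent vectors at `z` of a map `f`. -/
def vert (E E' : Type*) [NormedAddCommGroup E] [NormedSpace ℝ E]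
    [NormedAddCommGroup E'] [NormedSpace ℝ E'] {M : Type*} [TopologicalSpace M]
    [ChartedSpace E M] {M' : Type*} [TopologicalSpace M'] [ChartedSpace E' M']
    (f : M → M') (z : M) : Submodule ℝ E := LinearMap.ker (tmap E E' f z)

/-- The expression of a form in a chart. -/
def formLoc (α : M → Covec E) (e : OpenPartialHomeomorph M E) (u : E) : Covec E :=
  pull (tmap E E e.symm u) (α (e.symm u))

/-- The expression of a multivector field in a chart. -/
def mvLoc (X : M → Multivec E) (e : OpenPartialHomeomorph M E) (u : E) : Multivec E :=
  push (tmap E E e (e.symm u)) (X (e.symm u))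

variable [FiniteDimensional ℝ E]

/-- Smooth forms. -/
def SmoothForm (α : M → Covec E) : Prop :=
  ∀ z : M, SmoothOnExt (formLoc α (chartAt E z)) (chartAt E z).target

/-- Smooth multivector fields. -/
def SmoothMV (X : M → Multivec E) : Prop :=
  ∀ z : M, SmoothOnExt (mvLoc X (chartAt E z)) (chartAt E z).target

/-- The exterior derivative. -/
def extD (α : M → Covec E) (z : M) : Covec E :=
  pull (tmap E E (chartAt E z) z) (extDLoc (formLoc α (chartAt E z)) (chartAt E z z))

/-- The Schouten–Nijenhuis bracket. -/
def schouten (P Q : M → Multivec E) (z : M) : Multivec E :=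
  push (tmap E E (chartAt E z).symm (chartAt E z z))
    (schoutenLoc (mvLoc P (chartAt E z)) (mvLoc Q (chartAt E z)) (chartAt E z z))

/-- A volume form on a manifold of dimension `n`. -/
structure IsVolumeForm (n : ℕ) (w : M → Covec E) : Prop where
  smooth : SmoothForm w
  degree : ∀ x, w x ∈ ⋀[ℝ]^n (Module.Dual ℝ E)
  ne_zero : ∀ x, w x ≠ 0

end Manifold

/-! ### The extended polymomentum phase space -/

section PhaseSpace

variable {EX EY EF : Type*}
  [NormedAddCommGroup EX] [NormedSpace ℝ EX] [FiniteDimensional ℝ EX]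
  [NormedAddCommGroup EY] [NormedSpace ℝ EY] [FiniteDimensional ℝ EY]
  [NormedAddCommGroup EF] [NormedSpace ℝ EF] [FiniteDimensional ℝ EF]
  {X : Type*} [TopologicalSpace X] [ChartedSpace EX X]
  {Y : Type*} [TopologicalSpace Y] [ChartedSpace EY Y]
  {π : Y → X}

/-- `π : Y → X` is a fibered manifold with fibres modelled on `EF`: near every point of `Y` there
are coordinates `(x, y)` in which `π` is the projection to the coordinates `x` of `X`. -/
abbrev IsFibered (EX EY EF : Type*)
    [NormedAddCommGroup EX] [NormedSpace ℝ EX] [NormedAddCommGroup EY] [NormedSpace ℝ EY]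
    [NormedAddCommGroup EF] [NormedSpace ℝ EF]
    {X : Type*} [TopologicalSpace X] [ChartedSpace EX X]
    {Y : Type*} [TopologicalSpace Y] [ChartedSpace EY Y] (π : Y → X) : Prop :=
  Manifold.IsSubmersionOfComplement EF 𝓘(ℝ, EY) 𝓘(ℝ, EX) ∞ π

/-- The extended polymomentum phase space `Z = ⋀^n_1(Y) / ⋀^n_0(Y)`, where `n = dim X`. -/
structure PhaseSpace (hπ : IsFibered EX EY EF π) : Type _ where
  /-- the point of `Y` -/
  base : Y
  /-- the class of `n`-forms on the tangent space of `Y` -/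
  cls : polyFibre (Module.finrank ℝ EX) (vert EY EX π base)

/-- The coordinate space `(x, y)` of a fibered manifold. -/
def BaseModel (EX EF : Type*) : Type _ := EX × EF

instance : NormedAddCommGroup (BaseModel EX EF) := inferInstanceAs (NormedAddCommGroup (EX × EF))

instance : NormedSpace ℝ (BaseModel EX EF) := inferInstanceAs (NormedSpace ℝ (EX × EF))

instance : FiniteDimensional ℝ (BaseModel EX EF) :=
  inferInstanceAs (FiniteDimensional ℝ (EX × EF))

/-- The coordinate space as a product. -/
def BaseModel.equivProd (EX EF : Type*) [NormedAddCommGroup EX] [NormedSpace ℝ EX]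
    [NormedAddCommGroup EF] [NormedSpace ℝ EF] : BaseModel EX EF ≃L[ℝ] EX × EF :=
  ContinuousLinearEquiv.refl ℝ (EX × EF)

/-- The coordinates `x`. -/
def BaseModel.fst (EX EF : Type*) [NormedAddCommGroup EX] [NormedSpace ℝ EX]
    [NormedAddCommGroup EF] [NormedSpace ℝ EF] : BaseModel EX EF →L[ℝ] EX :=
  (ContinuousLinearMap.fst ℝ EX EF).comp (BaseModel.equivProd EX EF : BaseModel EX EF →L[ℝ] EX × EF)

/-- The vertical vectors of the coordinate space. -/
def modelVert (EX EF : Type*) [NormedAddCommGroup EX] [NormedSpace ℝ EX]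
    [NormedAddCommGroup EF] [NormedSpace ℝ EF] : Submodule ℝ (BaseModel EX EF) :=
  LinearMap.ker (BaseModel.fst EX EF).toLinearMap

theorem mem_modelVert {w : BaseModel EX EF} :
    w ∈ modelVert EX EF ↔ BaseModel.fst EX EF w = 0 := Iff.rfl

attribute [irreducible] modelVert

/-- The fibre `⋀^n_1 / ⋀^n_0` for the coordinate space. -/
abbrev modelFibre (EX EF : Type*) [NormedAddCommGroup EX] [NormedSpace ℝ EX]
    [NormedAddCommGroup EF] [NormedSpace ℝ EF] : Type _ :=
  polyFibre (Module.finrank ℝ EX) (modelVert EX EF)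

/-- The dimension of the fibres of the phase space over `Y`. -/
def fibreDim (EX EF : Type*) [NormedAddCommGroup EX] [NormedSpace ℝ EX]
    [NormedAddCommGroup EF] [NormedSpace ℝ EF] : ℕ := Module.finrank ℝ (modelFibre EX EF)

/-- The coordinate space of the phase space: the coordinates `(x, y)` and linear coordinates
on `⋀^n_1 / ⋀^n_0`. -/
def PhaseModel (EX EF : Type*) [NormedAddCommGroup EX] [NormedSpace ℝ EX]
    [NormedAddCommGroup EF] [NormedSpace ℝ EF] : Type _ :=
  BaseModel EX EF × (Fin (fibreDim EX EF) → ℝ)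

instance : NormedAddCommGroup (PhaseModel EX EF) :=
  inferInstanceAs (NormedAddCommGroup (BaseModel EX EF × (Fin (fibreDim EX EF) → ℝ)))

instance : NormedSpace ℝ (PhaseModel EX EF) :=
  inferInstanceAs (NormedSpace ℝ (BaseModel EX EF × (Fin (fibreDim EX EF) → ℝ)))

instance : FiniteDimensional ℝ (PhaseModel EX EF) :=
  inferInstanceAs (FiniteDimensional ℝ (BaseModel EX EF × (Fin (fibreDim EX EF) → ℝ)))

/-- The coordinate space of the phase space as a product. -/
def PhaseModel.equivProd (EX EF : Type*) [NormedAddCommGroup EX] [NormedSpace ℝ EX]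
    [NormedAddCommGroup EF] [NormedSpace ℝ EF] :
    PhaseModel EX EF ≃L[ℝ] BaseModel EX EF × (Fin (fibreDim EX EF) → ℝ) :=
  ContinuousLinearEquiv.refl ℝ (BaseModel EX EF × (Fin (fibreDim EX EF) → ℝ))

/-- Linear coordinates on the model fibre. -/
def fibreCoord (EX EF : Type*) [NormedAddCommGroup EX] [NormedSpace ℝ EX] [FiniteDimensional ℝ EX]
    [NormedAddCommGroup EF] [NormedSpace ℝ EF] [FiniteDimensional ℝ EF] :
    modelFibre EX EF ≃ₗ[ℝ] (Fin (fibreDim EX EF) → ℝ) :=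
  (Module.finBasis ℝ (modelFibre EX EF)).equivFun


attribute [irreducible] fibreCoord

/-- Fibered charts `(xᵘ, yᵃ)` of `Y`. -/
structure IsFiberedChart (EX EY EF : Type*)
    [NormedAddCommGroup EX] [NormedSpace ℝ EX] [NormedAddCommGroup EY] [NormedSpace ℝ EY]
    [NormedAddCommGroup EF] [NormedSpace ℝ EF]
    {X : Type*} [TopologicalSpace X] [ChartedSpace EX X]
    {Y : Type*} [TopologicalSpace Y] [ChartedSpace EY Y] (π : Y → X)
    (c : OpenPartialHomeomorph Y (BaseModel EX EF)) : Prop where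
  smooth : ContMDiffOn 𝓘(ℝ, EY) 𝓘(ℝ, BaseModel EX EF) ∞ c c.source
  smooth_symm : ContMDiffOn 𝓘(ℝ, BaseModel EX EF) 𝓘(ℝ, EY) ∞ c.symm c.target
  fibered : ∃ ψ ∈ IsManifold.maximalAtlas 𝓘(ℝ, EX) ∞ X,
    ∀ y ∈ c.source, π y ∈ ψ.source ∧ BaseModel.fst EX EF (c y) = ψ (π y)

theorem exists_fiberedChart (hπ : IsFibered EX EY EF π) (y : Y) :
    ∃ c : OpenPartialHomeomorph Y (BaseModel EX EF), IsFiberedChart EX EY EF π c ∧ y ∈ c.source := by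
  obtain ⟨⟨φ, ψ, hy, -, hφ, hψ, hs, L₀, hL⟩⟩ := hπ y
  let L := L₀.trans (BaseModel.equivProd EX EF).symm
  refine ⟨φ.trans L.toHomeomorph.toOpenPartialHomeomorph, ⟨?_, ?_, ψ, hψ, ?_⟩, by simpa using hy⟩
  · have h1 := contMDiffOn_of_mem_maximalAtlas hφ
    have h2 : ContMDiff 𝓘(ℝ, EY) 𝓘(ℝ, BaseModel EX EF) ∞ L := L.contDiff.contMDiff
    exact (h2.comp_contMDiffOn h1).mono (by simp)
  · have h1 := contMDiffOn_symm_of_mem_maximalAtlas hφ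
    have h2 : ContMDiff 𝓘(ℝ, BaseModel EX EF) 𝓘(ℝ, EY) ∞ L.symm := L.symm.contDiff.contMDiff
    refine h1.comp h2.contMDiffOn ?_
    intro u hu
    simpa using hu
  · intro y hy
    have hy : y ∈ φ.source := by simpa using hy
    refine ⟨hs hy, ?_⟩
    have := hL (x := φ y) (by simpa using φ.map_source hy)
    have h3 : (L₀ (φ y)).1 = ψ (π y) := by simpa [φ.left_inv hy] using this.symm
    exact h3

/-- The tangent map of a chart of `Y`. -/
abbrev chartT (EY : Type*) [NormedAddCommGroup EY] [NormedSpace ℝ EY]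
    {Y : Type*} [TopologicalSpace Y] [ChartedSpace EY Y]
    (c : OpenPartialHomeomorph Y (BaseModel EX EF)) (y : Y) :
    EY →ₗ[ℝ] BaseModel EX EF :=
  tmap EY (BaseModel EX EF) c y

/-- The tangent map of an inverse chart of `Y`. -/
abbrev chartTSymm (EY : Type*) [NormedAddCommGroup EY] [NormedSpace ℝ EY]
    {Y : Type*} [TopologicalSpace Y] [ChartedSpace EY Y]
    (c : OpenPartialHomeomorph Y (BaseModel EX EF)) (u : BaseModel EX EF) :
    BaseModel EX EF →ₗ[ℝ] EY :=
  tmap (BaseModel EX EF) EY c.symm u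

section
variable {c : OpenPartialHomeomorph Y (BaseModel EX EF)}

theorem IsFiberedChart.mdifferentiable (hc : IsFiberedChart EX EY EF π c) :
    c.MDifferentiable 𝓘(ℝ, EY) 𝓘(ℝ, BaseModel EX EF) :=
  ⟨hc.smooth.mdifferentiableOn (by simp), hc.smooth_symm.mdifferentiableOn (by simp)⟩

theorem IsFiberedChart.symm_comp (hc : IsFiberedChart EX EY EF π c) {y : Y} (hy : y ∈ c.source) :
    chartTSymm EY c (c y) ∘ₗ chartT EY c y = LinearMap.id :=
  congrArg ContinuousLinearMap.toLinearMap (hc.mdifferentiable.symm_comp_deriv hy)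

theorem IsFiberedChart.comp_symm (hc : IsFiberedChart EX EY EF π c) {u : BaseModel EX EF}
    (hu : u ∈ c.target) : chartT EY c (c.symm u) ∘ₗ chartTSymm EY c u = LinearMap.id :=
  congrArg ContinuousLinearMap.toLinearMap (hc.mdifferentiable.comp_symm_deriv hu)

theorem IsFiberedChart.chartT_mem_iff (hπ : IsFibered EX EY EF π) (hc : IsFiberedChart EX EY EF π c) {y : Y}
    (hy : y ∈ c.source) (v : EY) :
    chartT EY c y v ∈ modelVert EX EF ↔ v ∈ vert EY EX π y := by
  obtain ⟨ψ, hψ, h⟩ := hc.fibered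
  have hψd : ψ.MDifferentiable 𝓘(ℝ, EX) 𝓘(ℝ, EX) :=
    ⟨(contMDiffOn_of_mem_maximalAtlas hψ).mdifferentiableOn (by simp),
      (contMDiffOn_symm_of_mem_maximalAtlas hψ).mdifferentiableOn (by simp)⟩
  have hπd : MDifferentiableAt 𝓘(ℝ, EY) 𝓘(ℝ, EX) π y :=
    hπ.contMDiff.mdifferentiable (by simp) y
  have hcd := hc.mdifferentiable.mdifferentiableAt hy
  have e1 : mfderiv 𝓘(ℝ, EY) 𝓘(ℝ, EX) (ψ ∘ π) y =
      (mfderiv 𝓘(ℝ, EX) 𝓘(ℝ, EX) ψ (π y)).comp (mfderiv 𝓘(ℝ, EY) 𝓘(ℝ, EX) π y) :=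
    mfderiv_comp y (hψd.mdifferentiableAt (h y hy).1) hπd
  have hfst : MDifferentiableAt 𝓘(ℝ, BaseModel EX EF) 𝓘(ℝ, EX)
      (BaseModel.fst EX EF) (c y) :=
    (ContinuousLinearMap.differentiableAt _).mdifferentiableAt
  have e2 := mfderiv_comp y hfst hcd
  have e3 : mfderiv 𝓘(ℝ, EY) 𝓘(ℝ, EX) (ψ ∘ π) y = mfderiv 𝓘(ℝ, EY) 𝓘(ℝ, EX)
      (BaseModel.fst EX EF ∘ c) y := by
    apply Filter.EventuallyEq.mfderiv_eq
    filter_upwards [c.open_source.mem_nhds hy] with y' hy'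
    exact (h y' hy').2.symm
  rw [e1, e2, ContinuousLinearMap.mfderiv_eq] at e3
  have e4 : mfderiv 𝓘(ℝ, EX) 𝓘(ℝ, EX) ψ (π y) (mfderiv 𝓘(ℝ, EY) 𝓘(ℝ, EX) π y v) =
      BaseModel.fst EX EF (chartT EY c y v) := DFunLike.congr_fun e3 v
  have hinj := hψd.mfderiv_injective (h y hy).1
  constructor
  · intro hv
    have hv' : BaseModel.fst EX EF (chartT EY c y v) = 0 := mem_modelVert.1 hv
    rw [hv'] at e4
    exact hinj (e4.trans (map_zero _).symm)
  · intro hv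
    have hv' : mfderiv 𝓘(ℝ, EY) 𝓘(ℝ, EX) π y v = 0 := hv
    rw [hv'] at e4
    exact mem_modelVert.2 (e4.symm.trans (map_zero _))

theorem IsFiberedChart.vertY_le (hπ : IsFibered EX EY EF π) (hc : IsFiberedChart EX EY EF π c) {y : Y}
    (hy : y ∈ c.source) : vert EY EX π y ≤ (modelVert EX EF).comap (chartT EY c y) :=
  fun v hv => (hc.chartT_mem_iff hπ hy v).2 hv

theorem IsFiberedChart.modelVert_le (hπ : IsFibered EX EY EF π) (hc : IsFiberedChart EX EY EF π c)
    {u : BaseModel EX EF} (hu : u ∈ c.target) :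
    modelVert EX EF ≤ (vert EY EX π (c.symm u)).comap (chartTSymm EY c u) := by
  intro w hw
  refine (hc.chartT_mem_iff hπ (c.map_target hu) _).1 ?_
  have := DFunLike.congr_fun (hc.comp_symm hu) w
  rw [LinearMap.comp_apply, LinearMap.id_apply] at this
  rw [this]
  exact hw

end

/-- The chart of the phase space induced by a fibered chart of `Y`: the class of `α` at `y` is
sent to the coordinates of `y` and to the class of the coordinate expression of `α`. -/
def phaseChart (hπ : IsFibered EX EY EF π) (c : OpenPartialHomeomorph Y (BaseModel EX EF))
    (hc : IsFiberedChart EX EY EF π c) : PartialEquiv (PhaseSpace hπ) (PhaseModel EX EF) where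
  toFun z := (c z.base, fibreCoord EX EF
    (qmap (Module.finrank ℝ EX) (modelVert EX EF) (vert EY EX π z.base) (chartTSymm EY c (c z.base)) z.cls))
  invFun w := ⟨c.symm w.1, qmap (Module.finrank ℝ EX) (vert EY EX π (c.symm w.1)) (modelVert EX EF)
    (chartT EY c (c.symm w.1)) ((fibreCoord EX EF).symm w.2)⟩
  source := {z | z.base ∈ c.source}
  target := {w | w.1 ∈ c.target}
  map_source' _ hz := c.map_source hz
  map_target' _ hw := c.map_target hw
  left_inv' z hz := by
    obtain ⟨y, q⟩ := z
    have hy : y ∈ c.source := hz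
    simp only [LinearEquiv.symm_apply_apply]
    have key : ∀ y', y' = y → (⟨y', qmap (Module.finrank ℝ EX) (vert EY EX π y') (modelVert EX EF) (chartT EY c y')
        (qmap (Module.finrank ℝ EX) (modelVert EX EF) (vert EY EX π y) (chartTSymm EY c (c y)) q)⟩ : PhaseSpace hπ) =
        ⟨y, q⟩ := by
      rintro y' rfl
      have h2 := hc.modelVert_le hπ (c.map_source hy)
      rw [c.left_inv hy] at h2
      rw [qmap_qmap (hc.vertY_le hπ hy) h2, hc.symm_comp hy, qmap_id]
    exact key _ (c.left_inv hy)
  right_inv' w hw := by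
    obtain ⟨u, p⟩ := w
    have hu : u ∈ c.target := hw
    have h1 := hc.vertY_le hπ (c.map_target hu)
    have h2 := hc.modelVert_le hπ hu
    simp only [c.right_inv hu]
    rw [qmap_qmap h2 h1, hc.comp_symm hu, qmap_id, LinearEquiv.apply_symm_apply]

theorem contDiffOn_change {B G : Type*} [NormedAddCommGroup B] [NormedSpace ℝ B]
    [NormedAddCommGroup G] [NormedSpace ℝ G] {e : B → B} {s : Set B} {f : B × G → G}
    (he : ContDiffOn ℝ ∞ e s) (hf : ContDiffOn ℝ ∞ f (Prod.fst ⁻¹' s)) :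
    ContDiffOn ℝ ∞ (fun w : B × G => (e w.1, f w)) (Prod.fst ⁻¹' s) :=
  (he.comp contDiff_fst.contDiffOn fun _ hw => hw).prodMk hf

theorem chart_change_contDiffOn (hπ : IsFibered EX EY EF π)
    {c c' : OpenPartialHomeomorph Y (BaseModel EX EF)}
    (hc : IsFiberedChart EX EY EF π c) (hc' : IsFiberedChart EX EY EF π c') :
    ContDiffOn ℝ ∞ (c.symm.trans c') (c.symm.trans c').source := by
  rw [← contMDiffOn_iff_contDiffOn]
  exact hc'.smooth.comp (hc.smooth_symm.mono fun u hu => hu.1) fun u hu => hu.2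

theorem chart_change_fderiv (hπ : IsFibered EX EY EF π)
    {c c' : OpenPartialHomeomorph Y (BaseModel EX EF)}
    (hc : IsFiberedChart EX EY EF π c) (hc' : IsFiberedChart EX EY EF π c')
    {u : BaseModel EX EF} (hu : u ∈ (c.symm.trans c').source) :
    chartT EY c (c.symm u) ∘ₗ chartTSymm EY c' (c' (c.symm u)) =
      (fderiv ℝ (c'.symm.trans c) (c' (c.symm u))).toLinearMap := by
  have hu2 : c.symm u ∈ c'.source := hu.2
  have hd1 := hc'.mdifferentiable.mdifferentiableAt_symm (c'.map_source hu2)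
  have hd2 := hc.mdifferentiable.mdifferentiableAt
    (x := c'.symm (c' (c.symm u))) (by rw [c'.left_inv hu2]; exact c.map_target hu.1)
  have h := mfderiv_comp (c' (c.symm u)) hd2 hd1
  rw [mfderiv_eq_fderiv, c'.left_inv hu2] at h
  exact (congrArg ContinuousLinearMap.toLinearMap h).symm

theorem chart_change_contDiffOn_fderiv (hπ : IsFibered EX EY EF π)
    {c c' : OpenPartialHomeomorph Y (BaseModel EX EF)}
    (hc : IsFiberedChart EX EY EF π c) (hc' : IsFiberedChart EX EY EF π c') :
    ContDiffOn ℝ ∞ (fun u => fderiv ℝ (c'.symm.trans c) (c' (c.symm u)))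
      (c.symm.trans c').source :=
  ((chart_change_contDiffOn hπ hc' hc).fderiv_of_isOpen
    (c'.symm.trans c).open_source (by simp)).comp (chart_change_contDiffOn hπ hc hc')
    fun u hu => ⟨c'.map_source hu.2, by
      change c'.symm (c' (c.symm u)) ∈ c.source
      have hu2 : c.symm u ∈ c'.source := hu.2
      rw [c'.left_inv hu2]; exact c.map_target hu.1⟩

theorem chart_change_vert (hπ : IsFibered EX EY EF π)
    {c c' : OpenPartialHomeomorph Y (BaseModel EX EF)}
    (hc : IsFiberedChart EX EY EF π c) (hc' : IsFiberedChart EX EY EF π c')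
    {u : BaseModel EX EF} (hu : u ∈ (c.symm.trans c').source) :
    modelVert EX EF ≤ (modelVert EX EF).comap
      (fderiv ℝ (c'.symm.trans c) (c' (c.symm u))).toLinearMap := by
  have hu2 : c.symm u ∈ c'.source := hu.2
  have h2 := hc'.modelVert_le hπ (c'.map_source hu2)
  rw [c'.left_inv hu2] at h2
  rw [← chart_change_fderiv hπ hc hc' hu]
  exact fun w hw => hc.vertY_le hπ (c.map_target hu.1) (h2 hw)

theorem chart_change_smooth (hπ : IsFibered EX EY EF π)
    {c c' : OpenPartialHomeomorph Y (BaseModel EX EF)}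
    (hc : IsFiberedChart EX EY EF π c) (hc' : IsFiberedChart EX EY EF π c') :
    ContDiffOn ℝ ∞ (fun w : BaseModel EX EF × (Fin (fibreDim EX EF) → ℝ) =>
      (c' (c.symm w.1), fibreCoord EX EF
        (qmap (Module.finrank ℝ EX) (modelVert EX EF) (modelVert EX EF)
          (fderiv ℝ (c'.symm.trans c) (c' (c.symm w.1))).toLinearMap
          ((fibreCoord EX EF).symm w.2)))) (Prod.fst ⁻¹' (c.symm.trans c').source) := by
  have h1 := chart_change_contDiffOn_fderiv hπ hc hc'
  have h2 : ∀ u ∈ (c.symm.trans c').source, modelVert EX EF ≤ (modelVert EX EF).comap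
      (fderiv ℝ (c'.symm.trans c) (c' (c.symm u))).toLinearMap :=
    fun _ hu => chart_change_vert hπ hc hc' hu
  have h3 := chart_change_contDiffOn hπ hc hc'
  generalize (c.symm.trans c').source = s at h1 h2 h3 ⊢
  have h4 := contDiffOn_qmap (E := BaseModel EX EF) (F := BaseModel EX EF)
    (L := fun u => fderiv ℝ (c'.symm.trans c) (c' (c.symm u)))
    (W := modelVert EX EF) (Module.finrank ℝ EX) (fibreCoord EX EF) h1 h2
  exact contDiffOn_change h3 h4

theorem contDiffOn_phaseChart (hπ : IsFibered EX EY EF π)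
    {c c' : OpenPartialHomeomorph Y (BaseModel EX EF)}
    (hc : IsFiberedChart EX EY EF π c) (hc' : IsFiberedChart EX EY EF π c') :
    ContDiffOn ℝ ∞ ((phaseChart hπ c hc).symm.trans (phaseChart hπ c' hc'))
      ((phaseChart hπ c hc).symm.trans (phaseChart hπ c' hc')).source := by
  refine ContDiffOn.congr (chart_change_smooth hπ hc hc') ?_
  rintro ⟨u, p⟩ hu
  have hu1 : u ∈ (c.symm.trans c').source := hu
  have hu2 : c.symm u ∈ c'.source := hu1.2
  have h2 := hc'.modelVert_le hπ (c'.map_source hu2)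
  rw [c'.left_inv hu2] at h2
  refine Prod.ext rfl ?_
  change fibreCoord EX EF (qmap (Module.finrank ℝ EX) (modelVert EX EF)
    (vert EY EX π (c.symm u)) (chartTSymm EY c' (c' (c.symm u)))
    (qmap (Module.finrank ℝ EX) (vert EY EX π (c.symm u)) (modelVert EX EF)
      (chartT EY c (c.symm u)) ((fibreCoord EX EF).symm p))) = _
  rw [qmap_qmap h2 (hc.vertY_le hπ (c.map_target hu1.1)), chart_change_fderiv hπ hc hc' hu1]

theorem isOpen_phaseChart (hπ : IsFibered EX EY EF π)
    {c c' : OpenPartialHomeomorph Y (BaseModel EX EF)}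
    (hc : IsFiberedChart EX EY EF π c) (hc' : IsFiberedChart EX EY EF π c') :
    IsOpen ((phaseChart hπ c hc).symm.trans (phaseChart hπ c' hc')).source :=
  (c.symm.trans c').open_source.preimage continuous_fst

/-- The smooth atlas of the phase space. -/
def phaseCore (hπ : IsFibered EX EY EF π) : ChartedSpaceCore (PhaseModel EX EF) (PhaseSpace hπ) where
  atlas := {e | ∃ c, ∃ hc : IsFiberedChart EX EY EF π c, e = phaseChart hπ c hc}
  chartAt z := phaseChart hπ (exists_fiberedChart hπ z.base).choose
    (exists_fiberedChart hπ z.base).choose_spec.1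
  mem_chart_source z := (exists_fiberedChart hπ z.base).choose_spec.2
  chart_mem_atlas _ := ⟨_, _, rfl⟩
  open_source := by
    rintro _ _ ⟨c, hc, rfl⟩ ⟨c', hc', rfl⟩
    exact isOpen_phaseChart hπ hc hc'
  continuousOn_toFun := by
    rintro _ _ ⟨c, hc, rfl⟩ ⟨c', hc', rfl⟩
    exact (contDiffOn_phaseChart hπ hc hc').continuousOn

instance (hπ : IsFibered EX EY EF π) : TopologicalSpace (PhaseSpace hπ) :=
  (phaseCore hπ).toTopologicalSpace

instance (hπ : IsFibered EX EY EF π) : ChartedSpace (PhaseModel EX EF) (PhaseSpace hπ) :=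
  (phaseCore hπ).toChartedSpace

instance (hπ : IsFibered EX EY EF π) :
    IsManifold 𝓘(ℝ, PhaseModel EX EF) ∞ (PhaseSpace hπ) := by
  refine isManifold_of_contDiffOn _ _ _ ?_
  rintro e e' he he'
  obtain ⟨_, ⟨e₀, rfl⟩, _, ⟨⟨c, hc, rfl⟩, rfl⟩, rfl⟩ := he
  obtain ⟨_, ⟨e₀', rfl⟩, _, ⟨⟨c', hc', rfl⟩, rfl⟩, rfl⟩ := he'
  have h := contDiffOn_phaseChart hπ hc hc'
  simp only [modelWithCornersSelf_coe, modelWithCornersSelf_coe_symm, Function.id_comp,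
    Function.comp_id, Set.preimage_id, Set.range_id, Set.inter_univ]
  exact h

/-- The vertical vectors of the phase space, for its projection to `X`. -/
def vertZ (hπ : IsFibered EX EY EF π) (z : PhaseSpace hπ) : Submodule ℝ (PhaseModel EX EF) :=
  vert (PhaseModel EX EF) EX (fun z : PhaseSpace hπ => π z.base) z

/-- The pullback to the phase space of a form on `X`. -/
def liftX (hπ : IsFibered EX EY EF π) (w : X → Covec EX) (z : PhaseSpace hπ) :
    Covec (PhaseModel EX EF) :=
  pull (tmap (PhaseModel EX EF) EX (fun z : PhaseSpace hπ => π z.base) z) (w (π z.base))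

/-- `Θ` represents the canonical class of `n`-forms modulo horizontal forms on the phase space:
at the point `z = [α]` over `y`, it is the pullback of the form `α` on the tangent space at `y`,
up to a horizontal `n`-form. -/
structure IsCanonicalForm (hπ : IsFibered EX EY EF π)
    (Θ : PhaseSpace hπ → Covec (PhaseModel EX EF)) : Prop where
  smooth : SmoothForm Θ
  canonical : ∀ z : PhaseSpace hπ,
    ∃ α : formsAt (vert EY EX π z.base) (Module.finrank ℝ EX) 1,
      polyFibre.mk _ _ α = z.cls ∧
        Θ z - pull (tmap (PhaseModel EX EF) EY (fun z : PhaseSpace hπ => z.base) z) α ∈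
          formsAt (vertZ hπ z) (Module.finrank ℝ EX) 0

/-- `Ω` is a representative of the polysymplectic form: an `(n+1)`-form which is equal to `dΘ`
modulo `⋀^(n+1)_1`. -/
structure IsPolysymplectic (hπ : IsFibered EX EY EF π)
    (Ω : PhaseSpace hπ → Covec (PhaseModel EX EF)) : Prop where
  smooth : SmoothForm Ω
  degree : ∀ z, Ω z ∈ ⋀[ℝ]^(Module.finrank ℝ EX + 1) (Module.Dual ℝ (PhaseModel EX EF))
  eq_extD : ∃ Θ, IsCanonicalForm hπ Θ ∧
    ∀ z, Ω z - extD Θ z ∈ formsAt (vertZ hπ z) (Module.finrank ℝ EX + 1) 1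

/-- `F` is a horizontal `p`-form, `p < n`, and the vertical multivector field `P` of degree
`n - p` is a Hamiltonian multivector field of `F`, that is, `P ⌟ Ω = dF` modulo horizontal
forms (as `Ω` is given modulo `⋀^(n+1)_1`, its interior product with a vertical multivector is
given modulo horizontal forms). -/
structure IsHamiltonianField (hπ : IsFibered EX EY EF π)
    (Ω : PhaseSpace hπ → Covec (PhaseModel EX EF)) (p : ℕ)
    (F : PhaseSpace hπ → Covec (PhaseModel EX EF))
    (P : PhaseSpace hπ → Multivec (PhaseModel EX EF)) : Prop where
  lt : p < Module.finrank ℝ EX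
  smooth_form : SmoothForm F
  form_mem : ∀ z, F z ∈ formsAt (vertZ hπ z) p 0
  smooth_field : SmoothMV P
  field_mem : ∀ z, P z ∈ ⋀[ℝ]^(Module.finrank ℝ EX - p) (PhaseModel EX EF)
  vertical : ∀ z, IsVertical (vertZ hπ z) (P z)
  eq_extD : ∀ z, contr (P z) (Ω z) - extD F z ∈ horizontal (vertZ hπ z)

/-- The Hamiltonian `p`-forms. -/
def hamForms (hπ : IsFibered EX EY EF π) (Ω : PhaseSpace hπ → Covec (PhaseModel EX EF)) (p : ℕ) :
    Set (PhaseSpace hπ → Covec (PhaseModel EX EF)) :=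
  {F | ∃ P, IsHamiltonianField hπ Ω p F P}

open Classical in
/-- The Poisson bracket `{F, G} = (-1)^(n-p) P ⌟ dG` of a Hamiltonian `p`-form `F` with a
Hamiltonian form `G`, where `P` is a Hamiltonian multivector field of `F`. -/
def poissonBracket (hπ : IsFibered EX EY EF π) (Ω : PhaseSpace hπ → Covec (PhaseModel EX EF))
    (p : ℕ) (F G : PhaseSpace hπ → Covec (PhaseModel EX EF)) :
    PhaseSpace hπ → Covec (PhaseModel EX EF) :=
  if h : ∃ P, IsHamiltonianField hπ Ω p F P then
    fun z => (-1 : ℝ) ^ (Module.finrank ℝ EX - p) • contr (h.choose z) (extD G z)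
  else 0

/-- The co-exterior product `F • G` of horizontal forms on the phase space, for a volume form `w`
on `X`. -/
def coexterior (hπ : IsFibered EX EY EF π) (w : X → Covec EX)
    (F G : PhaseSpace hπ → Covec (PhaseModel EX EF)) :
    PhaseSpace hπ → Covec (PhaseModel EX EF) :=
  fun z => coext (liftX hπ w z) (F z) (G z)

end PhaseSpace

/-! ### Poisson–Gerstenhaber algebras -/

/-- The spaces `H p`, `p < n`, with the bracket `br` (`br p` for a first argument in `H p`) and
the product `mul`, form a Poisson–Gerstenhaber algebra: the bracket `H p × H q → H (p + q + 1 - n)`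
is graded antisymmetric and satisfies the graded Jacobi identity for the degrees `n - p - 1`, the
product `H p × H q → H (p + q - n)` is graded commutative for the degrees `n - p` and associative,
and the two are related by the graded Leibniz rule. Spaces of negative index are zero. -/
structure IsPoissonGerstenhaber {V : Type*} [AddCommGroup V] [Module ℝ V] (n : ℕ)
    (H : ℕ → Set V) (br : ℕ → V → V → V) (mul : V → V → V) : Prop where
  zero_mem : ∀ p < n, 0 ∈ H p
  add_mem : ∀ p, ∀ F ∈ H p, ∀ F' ∈ H p, F + F' ∈ H p
  smul_mem : ∀ p, ∀ c : ℝ, ∀ F ∈ H p, c • F ∈ H p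
  br_mem : ∀ p q, n ≤ p + q + 1 → ∀ F ∈ H p, ∀ G ∈ H q, br p F G ∈ H (p + q + 1 - n)
  br_eq_zero : ∀ p q, p + q + 1 < n → ∀ F ∈ H p, ∀ G ∈ H q, br p F G = 0
  mul_mem : ∀ p q, n ≤ p + q → ∀ F ∈ H p, ∀ G ∈ H q, mul F G ∈ H (p + q - n)
  mul_eq_zero : ∀ p q, p + q < n → ∀ F ∈ H p, ∀ G ∈ H q, mul F G = 0
  add_br : ∀ p q, ∀ F ∈ H p, ∀ F' ∈ H p, ∀ G ∈ H q, br p (F + F') G = br p F G + br p F' G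
  smul_br : ∀ p q, ∀ c : ℝ, ∀ F ∈ H p, ∀ G ∈ H q, br p (c • F) G = c • br p F G
  br_add : ∀ p q, ∀ F ∈ H p, ∀ G ∈ H q, ∀ G' ∈ H q, br p F (G + G') = br p F G + br p F G'
  br_smul : ∀ p q, ∀ c : ℝ, ∀ F ∈ H p, ∀ G ∈ H q, br p F (c • G) = c • br p F G
  add_mul : ∀ p q, ∀ F ∈ H p, ∀ F' ∈ H p, ∀ G ∈ H q, mul (F + F') G = mul F G + mul F' G
  smul_mul : ∀ p q, ∀ c : ℝ, ∀ F ∈ H p, ∀ G ∈ H q, mul (c • F) G = c • mul F G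
  mul_comm : ∀ p q, ∀ F ∈ H p, ∀ G ∈ H q,
    mul F G = (-1 : ℝ) ^ ((n - p) * (n - q)) • mul G F
  mul_assoc : ∀ p q r, ∀ F ∈ H p, ∀ G ∈ H q, ∀ K ∈ H r, mul (mul F G) K = mul F (mul G K)
  antisymm : ∀ p q, ∀ F ∈ H p, ∀ G ∈ H q,
    br p F G = -((-1 : ℝ) ^ ((n - p - 1) * (n - q - 1)) • br q G F)
  jacobi : ∀ p q r, ∀ F ∈ H p, ∀ G ∈ H q, ∀ K ∈ H r,
    (-1 : ℝ) ^ ((n - p - 1) * (n - r - 1)) • br p F (br q G K) +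
      (-1 : ℝ) ^ ((n - p - 1) * (n - q - 1)) • br q G (br r K F) +
      (-1 : ℝ) ^ ((n - q - 1) * (n - r - 1)) • br r K (br p F G) = 0
  leibniz : ∀ p q r, ∀ F ∈ H p, ∀ G ∈ H q, ∀ K ∈ H r,
    br p F (mul G K) = mul (br p F G) K +
      (-1 : ℝ) ^ ((n - p - 1) * (n - q - 1 + 1)) • mul G (br p F K)

end Polysymplectic

end

/-! # The Poisson–Gerstenhaber algebra of Hamiltonian forms

Everything rests on three facts about the interior product, the exterior derivative and vertical
multivectors.

* *Filtration.* Let `annBy V k` be the forms annihilated by `k` arbitrary vertical vectors. The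
  interior product with a vertical multivector maps `annBy V (k + 1)` to `annBy V k`
  (`IsVertical.contr_mem_annBy`), the exterior derivative maps `annBy V k` to `annBy V (k + 1)`
  (`IsAdapted.extD_mem_annBy`), and `annBy V 1` are the horizontal forms. The polysymplectic form
  is defined modulo `annBy V 2` and is closed modulo `annBy V 3`, because it is exact modulo
  `annBy V 2`.
* *Cartan's formula* (`contr_schouten`). With `a = |P|` and `b = |Q|`,
  `[P, Q] ⌟ α = P ⌟ d(Q ⌟ α) - (-1)^a d(P ⌟ Q ⌟ α) - (-1)^((a+1)b) Q ⌟ P ⌟ dα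
  + (-1)^((a+1)b+a) Q ⌟ d(P ⌟ α)`.
  It is proved in linear coordinates, where it is a pointwise identity. As homogeneous multivectors
  are separated by their interior products with forms, it also shows that the Schouten–Nijenhuis
  bracket does not depend on the coordinates.
* *Duality* (`exists_smoothMV_contr_liftX`). Every smooth horizontal form is `A ⌟ ω` for a smooth
  multivector field `A`: this is linear algebra in a fibered chart, and a partition of unity
  globalizes it. The phase space has one since it is Hausdorff and second countable.

If `P`, `Q` are Hamiltonian fields of `F`, `G`, then `P ⌟ Q ⌟ Ω = P ⌟ dG`, because `P` kills
horizontal forms; as interior products commute up to sign, `P ⌟ dG` is `Q ⌟ dF` up to sign. Hence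
the bracket does not depend on the fields and is graded antisymmetric. Cartan's formula for
`[P, Q] ⌟ Ω` has one term that is not horizontal, namely `-d{F, G}`, so `-[P, Q]` is a Hamiltonian
field of `{F, G}`. For the Jacobi identity, `P ⌟ d{G, K} = -P ⌟ [Q, R] ⌟ Ω` is `[Q, R] ⌟ dF` up to
sign, and Cartan's formula for the closed form `dF` expands it into the other two double brackets.

For the product, `F • G = A ⌟ B ⌟ ω` where `ω` is closed and horizontal, and Cartan's formula for
`[A, B] ⌟ ω` gives `d(F • G) = (-1)^a A ⌟ dG + (-1)^((a+1)b) B ⌟ dF` modulo horizontal forms. So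
`(-1)^a A ∧ Q + (-1)^((a+1)b) B ∧ P` is a Hamiltonian field of `F • G`, and contraction of the
formula with a Hamiltonian field is the Leibniz rule. The remaining rules for the product are those
of the exterior product of multivectors.

Brackets and products of negative degree vanish, but the multivector fields above exist in all
degrees. For this reason most of the algebra is done with `IsHamiltonianPair`, which leaves the
degree of the form free. -/

set_option linter.unusedSectionVars false

noncomputable section

namespace Polysymplectic

open ExteriorAlgebra (ι)
open CliffordAlgebra (involute contractLeft contractRight)
open IsManifold (maximalAtlas)

/-! ### Exterior algebras -/

section Linear

variable {V V' : Type*} [AddCommGroup V] [Module ℝ V] [AddCommGroup V'] [Module ℝ V']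
  {E E' : Type*} [AddCommGroup E] [Module ℝ E] [AddCommGroup E'] [Module ℝ E']

theorem ι_mem_one (v : V) : ι ℝ v ∈ ⋀[ℝ]^1 V := by
  rw [ExteriorAlgebra.exteriorPower, pow_one]; exact ⟨v, rfl⟩

theorem mul_mem_extPow {a b : ℕ} {x y : ExteriorAlgebra ℝ V} (hx : x ∈ ⋀[ℝ]^a V)
    (hy : y ∈ ⋀[ℝ]^b V) : x * y ∈ ⋀[ℝ]^(a + b) V := by
  rw [ExteriorAlgebra.exteriorPower, pow_add]; exact Submodule.mul_mem_mul hx hy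

theorem ι_mul_mem_extPow {a : ℕ} (v : V) {x : ExteriorAlgebra ℝ V} (hx : x ∈ ⋀[ℝ]^a V) :
    ι ℝ v * x ∈ ⋀[ℝ]^(a + 1) V := by
  rw [add_comm]; exact mul_mem_extPow (ι_mem_one v) hx

theorem algebraMap_mem_extPow_zero (r : ℝ) : algebraMap ℝ (ExteriorAlgebra ℝ V) r ∈ ⋀[ℝ]^0 V := by
  rw [ExteriorAlgebra.exteriorPower, pow_zero]; exact Submodule.algebraMap_mem r

theorem mem_extPow_zero {x : ExteriorAlgebra ℝ V} (hx : x ∈ ⋀[ℝ]^0 V) :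
    ∃ r : ℝ, algebraMap ℝ (ExteriorAlgebra ℝ V) r = x := by
  rw [ExteriorAlgebra.exteriorPower, pow_zero] at hx; exact Submodule.mem_one.1 hx

/-- Induction over homogeneous elements of an exterior algebra, multiplying by vectors on the
left. -/
theorem extPow_induction {C : ℕ → ExteriorAlgebra ℝ V → Prop}
    (scalar : ∀ r : ℝ, C 0 (algebraMap ℝ _ r))
    (add : ∀ a x y, x ∈ ⋀[ℝ]^a V → y ∈ ⋀[ℝ]^a V → C a x → C a y → C a (x + y))
    (mul : ∀ a v x, x ∈ ⋀[ℝ]^a V → C a x → C (a + 1) (ι ℝ v * x)) {a : ℕ}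
    {x : ExteriorAlgebra ℝ V} (hx : x ∈ ⋀[ℝ]^a V) : C a x := by
  refine Submodule.pow_induction_on_left' (LinearMap.range (ι ℝ : V →ₗ[ℝ] _))
    (C := fun n x _ => C n x) scalar (fun x y i hx hy => add i x y hx hy) ?_ hx
  rintro _ ⟨v, rfl⟩ i x hx h
  exact mul i v x hx h

theorem involute_of_mem {a : ℕ} {x : ExteriorAlgebra ℝ V} (hx : x ∈ ⋀[ℝ]^a V) :
    involute x = (-1 : ℝ) ^ a • x := by
  refine extPow_induction (C := fun a x => involute x = (-1 : ℝ) ^ a • x) ?_ ?_ ?_ hx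
  · intro r; simp
  · intro a x y _ _ h h'; rw [map_add, h, h', smul_add]
  · intro a v x _ h
    rw [map_mul, h, CliffordAlgebra.involute_ι, pow_succ]
    simp

theorem ι_mul_eq (v : V) (x : ExteriorAlgebra ℝ V) : ι ℝ v * x = involute x * ι ℝ v := by
  induction x using ExteriorAlgebra.induction with
  | algebraMap r => rw [AlgHom.commutes, Algebra.commutes]
  | ι w =>
    rw [CliffordAlgebra.involute_ι, neg_mul, ← add_eq_zero_iff_eq_neg]
    exact ExteriorAlgebra.ι_add_mul_swap v w
  | mul x y hx hy => rw [← mul_assoc, hx, mul_assoc, hy, map_mul, mul_assoc]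
  | add x y hx hy => rw [mul_add, hx, hy, map_add, add_mul]

theorem mul_ι_eq (v : V) (x : ExteriorAlgebra ℝ V) : x * ι ℝ v = ι ℝ v * involute x := by
  rw [ι_mul_eq, CliffordAlgebra.involute_involute]

/-- The exterior product is graded commutative. -/
theorem mul_comm_of_mem {a b : ℕ} {x y : ExteriorAlgebra ℝ V} (hx : x ∈ ⋀[ℝ]^a V)
    (hy : y ∈ ⋀[ℝ]^b V) : x * y = (-1 : ℝ) ^ (a * b) • (y * x) := by
  refine extPow_induction (C := fun a x => x * y = (-1 : ℝ) ^ (a * b) • (y * x)) ?_ ?_ ?_ hx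
  · intro r; rw [zero_mul, pow_zero, one_smul, Algebra.commutes]
  · intro a x y _ _ h h'; rw [add_mul, h, h', mul_add, smul_add]
  · intro a v x _ h
    rw [mul_assoc, h, mul_smul_comm, ← mul_assoc, ι_mul_eq, involute_of_mem hy, smul_mul_assoc,
      smul_mul_assoc, smul_smul, mul_assoc, add_mul, one_mul, pow_add]

theorem contractLeft_mem_extPow (d : Module.Dual ℝ V) {a : ℕ} {x : ExteriorAlgebra ℝ V}
    (hx : x ∈ ⋀[ℝ]^(a + 1) V) :
    contractLeft (Q := (0 : QuadraticForm ℝ V)) d x ∈ ⋀[ℝ]^a V := by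
  -- For the induction, the contraction in degree `0` has to be covered as well.
  have key : ∀ {b : ℕ} {x : ExteriorAlgebra ℝ V}, x ∈ ⋀[ℝ]^b V →
      (b = 0 → contractLeft (Q := (0 : QuadraticForm ℝ V)) d x = 0) ∧
      ∀ a, b = a + 1 → contractLeft (Q := (0 : QuadraticForm ℝ V)) d x ∈ ⋀[ℝ]^a V := by
    intro b x hx
    refine extPow_induction (C := fun b x =>
      (b = 0 → contractLeft (Q := (0 : QuadraticForm ℝ V)) d x = 0) ∧
      ∀ a, b = a + 1 → contractLeft (Q := (0 : QuadraticForm ℝ V)) d x ∈ ⋀[ℝ]^a V) ?_ ?_ ?_ hx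
    · exact fun r => ⟨fun _ => CliffordAlgebra.contractLeft_algebraMap (d := d) _ r,
        fun a h => by omega⟩
    · intro b x y _ _ h h'
      refine ⟨fun hb => by rw [map_add, h.1 hb, h'.1 hb, add_zero], fun a ha => ?_⟩
      rw [map_add]
      exact add_mem (h.2 a ha) (h'.2 a ha)
    · intro b v x hx h
      refine ⟨fun hb => by omega, fun a ha => ?_⟩
      obtain rfl : b = a := by omega
      have h1 := CliffordAlgebra.contractLeft_ι_mul (Q := (0 : QuadraticForm ℝ V)) d v x
      have h2 : contractLeft (Q := (0 : QuadraticForm ℝ V)) d (ι ℝ v * x) =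
        d v • x - ι ℝ v * contractLeft (Q := (0 : QuadraticForm ℝ V)) d x := h1
      rw [h2]
      refine sub_mem (Submodule.smul_mem _ _ hx) ?_
      cases b with
      | zero => rw [h.1 rfl, mul_zero]; exact zero_mem _
      | succ b => exact ι_mul_mem_extPow v (h.2 b rfl)
  exact (key hx).2 a rfl

theorem contractLeft_of_mem_zero (d : Module.Dual ℝ V) {x : ExteriorAlgebra ℝ V}
    (hx : x ∈ ⋀[ℝ]^0 V) : contractLeft (Q := (0 : QuadraticForm ℝ V)) d x = 0 := by
  obtain ⟨r, rfl⟩ := mem_extPow_zero hx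
  exact CliffordAlgebra.contractLeft_algebraMap (d := d) _ r

theorem contractRight_eq_neg (d : Module.Dual ℝ V) (x : ExteriorAlgebra ℝ V) :
    contractRight (Q := (0 : QuadraticForm ℝ V)) x d =
      -contractLeft (Q := (0 : QuadraticForm ℝ V)) d (involute x) := by
  induction x using CliffordAlgebra.right_induction with
  | algebraMap r => simp
  | add x y hx hy => rw [map_add, LinearMap.add_apply, hx, hy, map_add, map_add, neg_add]
  | mul_ι v x hx =>
    have h : x * CliffordAlgebra.ι (0 : QuadraticForm ℝ V) v =
      CliffordAlgebra.ι (0 : QuadraticForm ℝ V) v * involute x := mul_ι_eq v x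
    have h2 : contractLeft (Q := (0 : QuadraticForm ℝ V)) d (involute x) *
        CliffordAlgebra.ι (0 : QuadraticForm ℝ V) v = CliffordAlgebra.ι (0 : QuadraticForm ℝ V) v *
        involute (contractLeft (Q := (0 : QuadraticForm ℝ V)) d (involute x)) := mul_ι_eq v _
    rw [CliffordAlgebra.contractRight_mul_ι, hx, neg_mul, h, map_mul,
      CliffordAlgebra.involute_involute, CliffordAlgebra.involute_ι, neg_mul, map_neg, neg_neg,
      CliffordAlgebra.contractLeft_ι_mul, h2]
    have h3 : ∀ y : ExteriorAlgebra ℝ V, involute (contractLeft (Q := (0 : QuadraticForm ℝ V)) d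
        (involute y)) = -contractLeft (Q := (0 : QuadraticForm ℝ V)) d y := by
      intro y
      induction y using CliffordAlgebra.left_induction with
      | algebraMap r => simp
      | add x y hx hy => simp only [map_add, hx, hy, neg_add]
      | ι_mul x v hx =>
        rw [map_mul, CliffordAlgebra.involute_ι, neg_mul, map_neg,
          CliffordAlgebra.contractLeft_ι_mul, CliffordAlgebra.contractLeft_ι_mul, map_neg, map_sub,
          map_mul, hx, map_smul, CliffordAlgebra.involute_involute, CliffordAlgebra.involute_ι]
        simp
    rw [h3]; simp

theorem contractRight_mem_extPow (d : Module.Dual ℝ V) {a : ℕ} {x : ExteriorAlgebra ℝ V}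
    (hx : x ∈ ⋀[ℝ]^(a + 1) V) :
    contractRight (Q := (0 : QuadraticForm ℝ V)) x d ∈ ⋀[ℝ]^a V := by
  rw [contractRight_eq_neg, involute_of_mem hx, map_smul]
  exact neg_mem (Submodule.smul_mem _ _ (contractLeft_mem_extPow d hx))

/-- Euler's identity for the exterior algebra: `∑ vᵢ ∧ (dᵢ ⌋ x) = a x` in degree `a`, if
`∑ vᵢ ⊗ dᵢ` is the identity. -/
theorem sum_ι_mul_contractLeft {κ : Type*} [Fintype κ] (v : κ → V) (d : κ → Module.Dual ℝ V)
    (hd : ∀ w, ∑ i, d i w • v i = w) {a : ℕ} {x : ExteriorAlgebra ℝ V} (hx : x ∈ ⋀[ℝ]^a V) :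
    ∑ i, ι ℝ (v i) * contractLeft (Q := (0 : QuadraticForm ℝ V)) (d i) x = (a : ℝ) • x := by
  refine extPow_induction (C := fun a x =>
    ∑ i, ι ℝ (v i) * contractLeft (Q := (0 : QuadraticForm ℝ V)) (d i) x = (a : ℝ) • x)
    ?_ ?_ ?_ hx
  · intro r
    have : ∀ i, contractLeft (Q := (0 : QuadraticForm ℝ V)) (d i)
      (algebraMap ℝ (ExteriorAlgebra ℝ V) r) = 0 :=
      fun i => CliffordAlgebra.contractLeft_algebraMap (d := d i) _ r
    simp [this]
  · intro a x y _ _ h h'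
    simp only [map_add, mul_add, Finset.sum_add_distrib, h, h', smul_add]
  · intro a w x _ h
    have h1 : ∀ i, contractLeft (Q := (0 : QuadraticForm ℝ V)) (d i) (ι ℝ w * x) =
        d i w • x - ι ℝ w * contractLeft (Q := (0 : QuadraticForm ℝ V)) (d i) x :=
      fun i => CliffordAlgebra.contractLeft_ι_mul (Q := (0 : QuadraticForm ℝ V)) (d i) w x
    have h2 : ∀ i, ι ℝ (v i) * (ι ℝ w * contractLeft (Q := (0 : QuadraticForm ℝ V)) (d i) x) =
        -(ι ℝ w * (ι ℝ (v i) * contractLeft (Q := (0 : QuadraticForm ℝ V)) (d i) x)) := by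
      intro i
      rw [← mul_assoc, ← mul_assoc, ← neg_mul]
      congr 1
      exact eq_neg_of_add_eq_zero_left (ExteriorAlgebra.ι_add_mul_swap _ _)
    simp only [h1, mul_sub, h2, sub_neg_eq_add, Finset.sum_add_distrib, ← Finset.mul_sum, h]
    have h3 : ∑ i, ι ℝ (v i) * d i w • x = ι ℝ w * x := by
      conv_rhs => rw [← hd w, map_sum, Finset.sum_mul]
      refine Finset.sum_congr rfl fun i _ => ?_
      rw [map_smul, mul_smul_comm, smul_mul_assoc]
    rw [h3, mul_smul_comm, Nat.cast_add, Nat.cast_one, add_smul, one_smul, add_comm]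

theorem eq_zero_of_contractLeft [Module.Finite ℝ V] {a : ℕ} (ha : a ≠ 0) {x : ExteriorAlgebra ℝ V}
    (hx : x ∈ ⋀[ℝ]^a V)
    (h : ∀ d, contractLeft (Q := (0 : QuadraticForm ℝ V)) d x = 0) : x = 0 := by
  have h1 := sum_ι_mul_contractLeft (Module.finBasis ℝ V) (Module.finBasis ℝ V).coord
    (fun w => (Module.finBasis ℝ V).sum_repr w) hx
  simp only [h, mul_zero, Finset.sum_const_zero] at h1
  exact (smul_eq_zero.1 h1.symm).resolve_left (Nat.cast_ne_zero.2 ha)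

/-! ### The interior product -/

theorem contr_mul_apply (A B : Multivec E) (α : Covec E) :
    contr (A * B) α = contr A (contr B α) := by
  rw [map_mul]; rfl

theorem contr_algebraMap (r : ℝ) (α : Covec E) :
    contr (algebraMap ℝ (Multivec E) r) α = r • α := by
  rw [AlgHom.commutes]; rfl

theorem contr_ι_eq (v : E) (α : Covec E) : contr (ι ℝ v) α =
    contractLeft (Q := (0 : QuadraticForm ℝ (Module.Dual ℝ E))) (Module.Dual.eval ℝ E v) α := by
  rw [contr, ExteriorAlgebra.lift_ι_apply]; rfl

theorem involute_contr (A : Multivec E) (α : Covec E) :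
    involute (contr A α) = contr (involute A) (involute α) := by
  have h1 : ∀ (v : E) (β : Covec E), involute (contr (ι ℝ v) β) =
      contr (-ι ℝ v) (involute β) := by
    intro v β
    rw [map_neg, LinearMap.neg_apply]
    induction β using CliffordAlgebra.left_induction with
    | algebraMap r =>
      have h2 := contr_ι_algebraMap v r
      have h3 : involute (algebraMap ℝ (Covec E) r) = algebraMap ℝ (Covec E) r :=
        AlgHom.commutes _ r
      change involute (contr (ι ℝ v) (algebraMap ℝ (Covec E) r)) =
        -contr (ι ℝ v) (involute (algebraMap ℝ (Covec E) r))
      rw [h3, h2, map_zero, neg_zero]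
    | add x y hx hy => rw [map_add, map_add, hx, hy, map_add, map_add, neg_add]
    | ι_mul b a hb =>
      have h2 : contr (ι ℝ v) (ι ℝ a * b) = a v • b - ι ℝ a * contr (ι ℝ v) b :=
        contr_ι_ι_mul v a b
      have h3 : contr (ι ℝ v) (ι ℝ a * involute b) =
        a v • involute b - ι ℝ a * contr (ι ℝ v) (involute b) := contr_ι_ι_mul v a _
      have h4 : involute (ι ℝ a) = -ι ℝ a := CliffordAlgebra.involute_ι a
      change involute (contr (ι ℝ v) (ι ℝ a * b)) = -contr (ι ℝ v) (involute (ι ℝ a * b))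
      rw [h2, map_sub, map_smul, map_mul, map_mul, h4, hb, neg_mul, neg_mul, map_neg, h3]
      simp only [mul_neg, neg_neg]
  induction A using ExteriorAlgebra.induction generalizing α with
  | algebraMap r =>
    have h3 : involute (algebraMap ℝ (Multivec E) r) = algebraMap ℝ (Multivec E) r :=
      AlgHom.commutes _ r
    rw [h3, contr_algebraMap, contr_algebraMap, map_smul]
  | ι v =>
    have h4 : involute (ι ℝ v) = -ι ℝ v := CliffordAlgebra.involute_ι v
    rw [h4]; exact h1 v α
  | mul A B hA hB => rw [map_mul involute, contr_mul_apply, contr_mul_apply, hA, hB]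
  | add A B hA hB =>
    rw [map_add involute, map_add contr, map_add contr, LinearMap.add_apply, LinearMap.add_apply,
      map_add, hA, hB]

/-- The interior product of a multivector with the exterior product by a covector. -/
theorem contr_ι_mul (A : Multivec E) (a : Module.Dual ℝ E) (β : Covec E) :
    contr A (ι ℝ a * β) = ι ℝ a * contr (involute A) β +
      contr (contractRight (Q := (0 : QuadraticForm ℝ E)) A a) β := by
  induction A using CliffordAlgebra.right_induction generalizing β with
  | algebraMap r =>
    have h1 := contr_algebraMap (E := E) r
    have h3 : involute (algebraMap ℝ (Multivec E) r) = algebraMap ℝ (Multivec E) r :=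
      AlgHom.commutes _ r
    have h4 : contractRight (Q := (0 : QuadraticForm ℝ E)) (algebraMap ℝ (Multivec E) r) a = 0 :=
      CliffordAlgebra.contractRight_algebraMap (d := a) _ r
    refine (h1 _).trans ?_
    refine Eq.trans ?_ (congrArg₂ (fun x y => ι ℝ a * contr x β + contr y β) h3 h4).symm
    simp only [h1, map_zero, LinearMap.zero_apply, add_zero, mul_smul_comm]
  | add x y hx hy =>
    rw [map_add contr, LinearMap.add_apply, hx, hy, map_add involute, map_add contr,
      LinearMap.add_apply, mul_add, map_add CliffordAlgebra.contractRight, LinearMap.add_apply,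
      map_add contr, LinearMap.add_apply]
    abel
  | mul_ι v x hx =>
    have h1 : contractRight (Q := (0 : QuadraticForm ℝ E)) (x * ι ℝ v) a =
      a v • x - contractRight (Q := (0 : QuadraticForm ℝ E)) x a * ι ℝ v :=
      CliffordAlgebra.contractRight_mul_ι a v x
    have h4 : involute (ι ℝ v) = -ι ℝ v := CliffordAlgebra.involute_ι v
    have h2 : contr (ι ℝ v) (ι ℝ a * β) = a v • β - ι ℝ a * contr (ι ℝ v) β :=
        contr_ι_ι_mul v a β
    change contr (x * ι ℝ v) (ι ℝ a * β) = ι ℝ a * contr (involute (x * ι ℝ v)) β +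
      contr (contractRight (Q := (0 : QuadraticForm ℝ E)) (x * ι ℝ v) a) β
    rw [h1, contr_mul_apply, h2, map_sub, hx, map_mul involute, h4, map_smul, map_sub contr,
      LinearMap.sub_apply, contr_mul_apply, contr_mul_apply, map_smul, map_neg, LinearMap.neg_apply,
      map_neg, mul_neg, LinearMap.smul_apply]
    abel

theorem contr_pull (T : E →ₗ[ℝ] E') (A : Multivec E) (α : Covec E') :
    contr A (pull T α) = pull T (contr (push T A) α) := by
  induction A using ExteriorAlgebra.induction generalizing α with
  | algebraMap r =>
    have h : push T (algebraMap ℝ (Multivec E) r) = algebraMap ℝ (Multivec E') r :=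
      AlgHom.commutes _ r
    rw [h, contr_algebraMap, contr_algebraMap, map_smul]
  | ι v =>
    have h : push T (ι ℝ v) = ι ℝ (T v) := ExteriorAlgebra.map_apply_ι _ _
    rw [h, contr_ι_pull]
  | mul A B hA hB => rw [map_mul (push T), contr_mul_apply, contr_mul_apply, hB, hA]
  | add A B hA hB =>
    rw [map_add (push T), map_add contr, map_add contr, LinearMap.add_apply, LinearMap.add_apply,
      map_add, hA, hB]

theorem push_comp_apply {E'' : Type*} [AddCommGroup E''] [Module ℝ E''] (T : E →ₗ[ℝ] E')
    (T' : E' →ₗ[ℝ] E'') (A : Multivec E) : push T' (push T A) = push (T' ∘ₗ T) A :=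
  DFunLike.congr_fun (ExteriorAlgebra.map_comp_map T T') A

theorem push_id (A : Multivec E) : push LinearMap.id A = A :=
  DFunLike.congr_fun (ExteriorAlgebra.map_id (R := ℝ) (M := E)) A

theorem pull_id (α : Covec E) : pull LinearMap.id α = α := by
  rw [pull, LinearMap.dualMap_id]; exact DFunLike.congr_fun ExteriorAlgebra.map_id α

theorem push_mem_extPow (T : E →ₗ[ℝ] E') {a : ℕ} {A : Multivec E} (hA : A ∈ ⋀[ℝ]^a E) :
    push T A ∈ ⋀[ℝ]^a E' := by
  refine extPow_induction (C := fun a A => push T A ∈ ⋀[ℝ]^a E') ?_ ?_ ?_ hA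
  · intro r
    have h : push T (algebraMap ℝ (Multivec E) r) = algebraMap ℝ (Multivec E') r :=
      AlgHom.commutes _ r
    rw [h]; exact algebraMap_mem_extPow_zero r
  · intro a x y _ _ h h'; rw [map_add]; exact add_mem h h'
  · intro a v x _ h
    have h : push T (ι ℝ v) = ι ℝ (T v) := ExteriorAlgebra.map_apply_ι _ _
    rw [map_mul, h]; exact ι_mul_mem_extPow _ ‹_›

theorem pull_mem_extPow (T : E →ₗ[ℝ] E') {a : ℕ} {α : Covec E'}
    (hα : α ∈ ⋀[ℝ]^a (Module.Dual ℝ E')) : pull T α ∈ ⋀[ℝ]^a (Module.Dual ℝ E) :=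
  push_mem_extPow T.dualMap hα

theorem contr_ι_mem_extPow (v : E) {a : ℕ} {α : Covec E}
    (hα : α ∈ ⋀[ℝ]^(a + 1) (Module.Dual ℝ E)) : contr (ι ℝ v) α ∈ ⋀[ℝ]^a (Module.Dual ℝ E) := by
  rw [contr_ι_eq]; exact contractLeft_mem_extPow _ hα

theorem contr_mem_extPow {a q : ℕ} {A : Multivec E} (hA : A ∈ ⋀[ℝ]^a E) {α : Covec E}
    (hα : α ∈ ⋀[ℝ]^(a + q) (Module.Dual ℝ E)) : contr A α ∈ ⋀[ℝ]^q (Module.Dual ℝ E) := by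
  refine extPow_induction (C := fun a A => ∀ q, ∀ α ∈ ⋀[ℝ]^(a + q) (Module.Dual ℝ E),
    contr A α ∈ ⋀[ℝ]^q (Module.Dual ℝ E)) ?_ ?_ ?_ hA q α hα
  · intro r q α hα
    rw [contr_algebraMap]
    rw [zero_add] at hα
    exact Submodule.smul_mem _ _ hα
  · intro a x y _ _ h h' q α hα
    rw [map_add contr]
    exact add_mem (h q α hα) (h' q α hα)
  · intro a v x _ h q α hα
    rw [contr_mul_apply]
    refine contr_ι_mem_extPow v (h (q + 1) α ?_)
    rwa [add_assoc, add_comm 1 q] at hα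

theorem contr_eq_zero_of_lt {a p : ℕ} (hpa : p < a) {A : Multivec E} (hA : A ∈ ⋀[ℝ]^a E)
    {α : Covec E} (hα : α ∈ ⋀[ℝ]^p (Module.Dual ℝ E)) : contr A α = 0 := by
  refine extPow_induction (C := fun a A => p < a → contr A α = 0) ?_ ?_ ?_ hA hpa
  · intro r h; omega
  · intro a x y _ _ h h' hp
    rw [map_add contr, LinearMap.add_apply, h hp, h' hp, add_zero]
  · intro a v x hx h hp
    rw [contr_mul_apply]
    rcases Nat.lt_or_ge p a with h1 | h1
    · rw [h h1, map_zero]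
    · obtain rfl : p = a := by omega
      rw [contr_ι_eq]
      exact contractLeft_of_mem_zero _ (contr_mem_extPow hx (q := 0) hα)

theorem eq_zero_of_contr_ι [Module.Finite ℝ E] {a : ℕ} (ha : a ≠ 0) {α : Covec E}
    (hα : α ∈ ⋀[ℝ]^a (Module.Dual ℝ E)) (h : ∀ v : E, contr (ι ℝ v) α = 0) : α = 0 := by
  refine eq_zero_of_contractLeft ha hα fun d => ?_
  obtain ⟨v, rfl⟩ := (Module.evalEquiv ℝ E).surjective d
  rw [← h v, contr_ι_eq]
  rfl

theorem contr_comm_apply {a b : ℕ} {A B : Multivec E} (hA : A ∈ ⋀[ℝ]^a E) (hB : B ∈ ⋀[ℝ]^b E)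
    (α : Covec E) : contr A (contr B α) = (-1 : ℝ) ^ (a * b) • contr B (contr A α) := by
  rw [← contr_mul_apply, mul_comm_of_mem hA hB, map_smul, LinearMap.smul_apply, contr_mul_apply]

/-- Homogeneous multivectors are separated by their interior products with forms. -/
theorem eq_zero_of_contr [Module.Finite ℝ E] {a : ℕ} {A : Multivec E} (hA : A ∈ ⋀[ℝ]^a E)
    (h : ∀ α : Covec E, contr A α = 0) : A = 0 := by
  induction a generalizing A with
  | zero =>
    obtain ⟨r, rfl⟩ := mem_extPow_zero hA
    have h1 := h 1
    rw [contr_algebraMap, smul_eq_zero] at h1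
    rw [h1.resolve_right one_ne_zero, map_zero]
  | succ a ih =>
    refine eq_zero_of_contractLeft (Nat.succ_ne_zero a) hA fun d => ?_
    refine ih (contractLeft_mem_extPow d hA) fun α => ?_
    have h1 := contr_ι_mul A d α
    rw [h, contractRight_eq_neg, involute_of_mem hA, map_smul contr, LinearMap.smul_apply, h,
      smul_zero, mul_zero, zero_add, map_smul, map_neg, map_smul, LinearMap.neg_apply,
      LinearMap.smul_apply, zero_eq_neg, smul_eq_zero] at h1
    exact h1.resolve_left (pow_ne_zero _ (by norm_num))

/-! ### Vertical multivectors and horizontal forms -/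

variable {W : Submodule ℝ E}

theorem mem_annBy_succ {k : ℕ} {α : Covec E} :
    α ∈ annBy W (k + 1) ↔ ∀ v ∈ W, contr (ι ℝ v) α ∈ annBy W k := by
  simp only [annBy, Submodule.mem_iInf, Submodule.mem_comap, Subtype.forall]

theorem mem_horizontal {α : Covec E} : α ∈ horizontal W ↔ ∀ v ∈ W, contr (ι ℝ v) α = 0 :=
  mem_annBy_succ

/-- Interior products with arbitrary homogeneous multivectors preserve the filtration `annBy`. -/
theorem contr_mem_annBy {a : ℕ} {A : Multivec E} (hA : A ∈ ⋀[ℝ]^a E) {k : ℕ} {α : Covec E}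
    (hα : α ∈ annBy W k) : contr A α ∈ annBy W k := by
  induction k generalizing α with
  | zero => rw [(Submodule.mem_bot ℝ).1 hα, map_zero]; exact zero_mem _
  | succ k ih =>
    refine mem_annBy_succ.2 fun v hv => ?_
    rw [contr_comm_apply (ι_mem_one v) hA]
    exact Submodule.smul_mem _ _ (ih (mem_annBy_succ.1 hα v hv))

/-- Interior products with vertical multivectors lower the filtration `annBy` by one, as they
commute up to sign with interior products with vectors. -/
theorem IsVertical.contr_mem_annBy {a : ℕ} {A : Multivec E} (h : IsVertical W A)
    (hA : A ∈ ⋀[ℝ]^a E) {k : ℕ} {α : Covec E} (hα : α ∈ annBy W (k + 1)) :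
    contr A α ∈ annBy W k := by
  induction k generalizing α with
  | zero => rw [h α hα]; exact zero_mem _
  | succ k ih =>
    refine mem_annBy_succ.2 fun v hv => ?_
    rw [contr_comm_apply (ι_mem_one v) hA]
    exact Submodule.smul_mem _ _ (ih (mem_annBy_succ.1 hα v hv))

theorem ι_mul_mem_annBy (a : Module.Dual ℝ E) {k : ℕ} {α : Covec E} (hα : α ∈ annBy W k) :
    ι ℝ a * α ∈ annBy W (k + 1) := by
  induction k generalizing α with
  | zero => rw [(Submodule.mem_bot ℝ).1 hα, mul_zero]; exact zero_mem _
  | succ k ih =>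
    refine mem_annBy_succ.2 fun v hv => ?_
    rw [contr_ι_ι_mul]
    exact sub_mem (Submodule.smul_mem _ _ hα) (ih (mem_annBy_succ.1 hα v hv))

/-- The vertical multivectors, as a subspace. -/
def verticals (W : Submodule ℝ E) : Submodule ℝ (Multivec E) where
  carrier := {A | IsVertical W A}
  add_mem' hA hB α hα := by rw [map_add contr, LinearMap.add_apply, hA α hα, hB α hα, add_zero]
  zero_mem' α _ := by rw [map_zero contr]; rfl
  smul_mem' c A hA α hα := by rw [map_smul contr, LinearMap.smul_apply, hA α hα, smul_zero]

theorem mem_verticals {A : Multivec E} : A ∈ verticals W ↔ IsVertical W A := Iff.rfl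

theorem IsVertical.mul_left {A : Multivec E} (h : IsVertical W A) (B : Multivec E) :
    IsVertical W (B * A) := fun α hα => by rw [contr_mul_apply, h α hα, map_zero]

theorem IsVertical.mul_right {A : Multivec E} (h : IsVertical W A) {b : ℕ} {B : Multivec E}
    (hB : B ∈ ⋀[ℝ]^b E) : IsVertical W (A * B) := fun α hα => by
  rw [contr_mul_apply]; exact h _ (Polysymplectic.contr_mem_annBy hB hα)

theorem IsVertical.push {A : Multivec E} (h : IsVertical W A) {T : E →ₗ[ℝ] E'}
    {S : E' →ₗ[ℝ] E} (hST : S ∘ₗ T = LinearMap.id) (hTS : T ∘ₗ S = LinearMap.id)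
    {W' : Submodule ℝ E'} (hW : W ≤ W'.comap T) : IsVertical W' (push T A) := fun α hα => by
  have h1 : α = pull S (pull T α) := by rw [pull_comp_apply, hTS, pull_id]
  rw [h1, contr_pull, push_comp_apply, hST, push_id, h _ (pull_mem_annBy hW 1 hα), map_zero]

/-- A horizontal form is the pullback of its restriction to a complement of the vertical space. -/
theorem pull_pull_of_horizontal [Module.Finite ℝ E] {f : E →ₗ[ℝ] E'} {j : E' →ₗ[ℝ] E}
    (hfj : f ∘ₗ j = LinearMap.id) {p : ℕ} {α : Covec E} (hα : α ∈ ⋀[ℝ]^p (Module.Dual ℝ E))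
    (h : α ∈ horizontal (LinearMap.ker f)) : pull f (pull j α) = α := by
  -- `v` and `j (f v)` differ by a vertical vector, so have equal interior products with `α`.
  rw [pull_comp_apply]
  induction p generalizing α with
  | zero =>
    obtain ⟨r, rfl⟩ := mem_extPow_zero hα
    exact AlgHom.commutes _ r
  | succ p ih =>
    rw [← sub_eq_zero]
    refine eq_zero_of_contr_ι (Nat.succ_ne_zero p) (sub_mem (pull_mem_extPow _ hα) hα) fun v => ?_
    have h1 : v - j (f v) ∈ LinearMap.ker f := by
      have := DFunLike.congr_fun hfj (f v)
      rw [LinearMap.comp_apply, LinearMap.id_apply] at this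
      rw [LinearMap.mem_ker, map_sub, this, sub_self]
    have h2 : contr (ι ℝ v) α = contr (ι ℝ (j (f v))) α := by
      have := mem_horizontal.1 h _ h1
      rwa [map_sub, map_sub contr, LinearMap.sub_apply, sub_eq_zero] at this
    rw [map_sub, contr_ι_pull, h2, LinearMap.comp_apply,
      ih (contr_ι_mem_extPow _ hα) (Polysymplectic.contr_mem_annBy (ι_mem_one _) h), sub_self]

/-! ### Volume forms and the co-exterior product -/

theorem exists_contr_eq_one [Module.Finite ℝ E] {p : ℕ} {α : Covec E}
    (hα : α ∈ ⋀[ℝ]^p (Module.Dual ℝ E)) (h0 : α ≠ 0) :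
    ∃ A ∈ ⋀[ℝ]^p E, contr A α = 1 := by
  induction p generalizing α with
  | zero =>
    obtain ⟨r, rfl⟩ := mem_extPow_zero hα
    have hr : r ≠ 0 := by rintro rfl; exact h0 (map_zero _)
    refine ⟨algebraMap ℝ _ r⁻¹, algebraMap_mem_extPow_zero _, ?_⟩
    rw [contr_algebraMap, Algebra.algebraMap_eq_smul_one, smul_smul, inv_mul_cancel₀ hr, one_smul]
  | succ p ih =>
    have h1 : ∃ v : E, contr (ι ℝ v) α ≠ 0 := by
      by_contra! h
      exact h0 (eq_zero_of_contr_ι (Nat.succ_ne_zero p) hα h)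
    obtain ⟨v, hv⟩ := h1
    obtain ⟨A, hA', hA⟩ := ih (contr_ι_mem_extPow v hα) hv
    exact ⟨A * ι ℝ v, mul_mem_extPow hA' (ι_mem_one v), by rw [contr_mul_apply, hA]⟩

theorem extPow_eq_zero [Module.Finite ℝ V] {p : ℕ} (hp : Module.finrank ℝ V < p)
    {x : ExteriorAlgebra ℝ V} (hx : x ∈ ⋀[ℝ]^p V) : x = 0 := by
  rw [← ExteriorAlgebra.ιMulti_span_fixedDegree] at hx
  refine (Submodule.mem_bot ℝ).1 ((Submodule.span_le.2 ?_ : _ ≤ (⊥ : Submodule ℝ _)) hx)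
  rintro _ ⟨v, rfl⟩
  rw [SetLike.mem_coe, Submodule.mem_bot]
  refine AlternatingMap.map_linearDependent _ v fun hv => ?_
  have := hv.fintype_card_le_finrank
  rw [Fintype.card_fin] at this
  omega

/-- Every form is the interior product of a multivector with a given volume form: the forms of
this kind contain `1`, and are closed under exterior products with covectors, as these annihilate
the volume form. -/
theorem exists_contr_eq [Module.Finite ℝ E] {w : Covec E}
    (hw : w ∈ ⋀[ℝ]^(Module.finrank ℝ E) (Module.Dual ℝ E)) (h0 : w ≠ 0) {p : ℕ} {α : Covec E}
    (hα : α ∈ ⋀[ℝ]^p (Module.Dual ℝ E)) :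
    ∃ A ∈ ⋀[ℝ]^(Module.finrank ℝ E - p) E, contr A w = α := by
  refine extPow_induction (C := fun p α =>
    ∃ A ∈ ⋀[ℝ]^(Module.finrank ℝ E - p) E, contr A w = α) ?_ ?_ ?_ hα
  · intro r
    obtain ⟨A, hA', hA⟩ := exists_contr_eq_one hw h0
    refine ⟨r • A, Submodule.smul_mem _ _ hA', ?_⟩
    rw [map_smul, LinearMap.smul_apply, hA]
    exact (Algebra.algebraMap_eq_smul_one r).symm
  · rintro p x y _ _ ⟨A, hA, rfl⟩ ⟨B, hB, rfl⟩
    exact ⟨A + B, add_mem hA hB, by rw [map_add, LinearMap.add_apply]⟩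
  · rintro p a x _ ⟨A, hA, rfl⟩
    have h1 := contr_ι_mul (involute A) a w
    have h2 : ι ℝ a * w = 0 :=
      extPow_eq_zero (by rw [Subspace.dual_finrank_eq]; omega) (ι_mul_mem_extPow a hw)
    rw [h2, map_zero, CliffordAlgebra.involute_involute, eq_comm, add_eq_zero_iff_eq_neg] at h1
    refine ⟨-contractRight (Q := (0 : QuadraticForm ℝ E)) (involute A) a, neg_mem ?_, ?_⟩
    · rw [involute_of_mem hA, map_smul, LinearMap.smul_apply]
      refine Submodule.smul_mem _ _ ?_
      rcases h : Module.finrank ℝ E - p with _ | m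
      · rw [h] at hA
        rw [contractRight_eq_neg, involute_of_mem hA, map_smul, contractLeft_of_mem_zero a hA,
          smul_zero, neg_zero]
        exact zero_mem _
      · rw [h] at hA
        rw [show Module.finrank ℝ E - (p + 1) = m by omega]
        exact contractRight_mem_extPow a hA
    · rw [map_neg contr, LinearMap.neg_apply]
      exact h1.symm

/-- Volume forms are unique up to a factor. -/
theorem exists_smul_eq_of_top [Module.Finite ℝ E] {w w' : Covec E}
    (hw : w ∈ ⋀[ℝ]^(Module.finrank ℝ E) (Module.Dual ℝ E)) (h0 : w ≠ 0)
    (hw' : w' ∈ ⋀[ℝ]^(Module.finrank ℝ E) (Module.Dual ℝ E)) : ∃ r : ℝ, r • w = w' := by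
  obtain ⟨A, hA, rfl⟩ := exists_contr_eq hw h0 hw'
  rw [Nat.sub_self] at hA
  obtain ⟨r, rfl⟩ := mem_extPow_zero hA
  exact ⟨r, (contr_algebraMap r w).symm⟩

/-- The multivector representing a form with respect to a volume form can be chosen linearly. -/
theorem exists_linear_contr_eq [Module.Finite ℝ E] {w : Covec E}
    (hw : w ∈ ⋀[ℝ]^(Module.finrank ℝ E) (Module.Dual ℝ E)) (h0 : w ≠ 0) (p : ℕ) :
    ∃ σ : Covec E →ₗ[ℝ] Multivec E, (∀ α, σ α ∈ ⋀[ℝ]^(Module.finrank ℝ E - p) E) ∧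
      ∀ α ∈ ⋀[ℝ]^p (Module.Dual ℝ E), contr (σ α) w = α := by
  let L : ↥(⋀[ℝ]^(Module.finrank ℝ E - p) E) →ₗ[ℝ] Covec E :=
    ((contr (E := E)).toLinearMap.flip w) ∘ₗ (⋀[ℝ]^(Module.finrank ℝ E - p) E).subtype
  obtain ⟨g, hg⟩ := L.rangeRestrict.exists_rightInverse_of_surjective L.range_rangeRestrict
  obtain ⟨σ, hσ⟩ := LinearMap.exists_extend g
  refine ⟨Submodule.subtype _ ∘ₗ σ, fun α => (σ α).2, fun α hα => ?_⟩
  obtain ⟨A, hA, hA'⟩ := exists_contr_eq hw h0 hα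
  have h1 : α ∈ LinearMap.range L := ⟨⟨A, hA⟩, hA'⟩
  have h2 := congrArg Subtype.val (DFunLike.congr_fun hg ⟨α, h1⟩)
  have h3 : σ α = g ⟨α, h1⟩ := DFunLike.congr_fun hσ ⟨α, h1⟩
  change contr (σ α : Multivec E) w = α
  rw [h3]
  exact h2

/-- The multivectors `A` with `A ⌟ w = 0`, for a homogeneous form `w`, are a right ideal. -/
theorem contr_mul_eq_zero {n : ℕ} {w : Covec E} (hw : w ∈ ⋀[ℝ]^n (Module.Dual ℝ E))
    {A : Multivec E} (hA : contr A w = 0) (B : Multivec E) : contr (A * B) w = 0 := by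
  induction B using CliffordAlgebra.left_induction generalizing A with
  | algebraMap r =>
    change contr (A * algebraMap ℝ (Multivec E) r) w = 0
    rw [contr_mul_apply, contr_algebraMap, map_smul, hA, smul_zero]
  | add x y hx hy => rw [mul_add, map_add, LinearMap.add_apply, hx hA, hy hA, add_zero]
  | ι_mul x v hx =>
    change contr (A * (ι ℝ v * x)) w = 0
    rw [← mul_assoc]
    -- `A ∧ v = v ∧ A^` for the grade involution `A^`, and `A^ ⌟ w` is `A ⌟ w` up to signs.
    refine hx ?_
    have h1 := involute_contr A w
    rw [hA, map_zero, involute_of_mem hw, map_smul, eq_comm, smul_eq_zero] at h1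
    rw [mul_ι_eq, contr_mul_apply, h1.resolve_left (pow_ne_zero _ (by norm_num)), map_zero]

/-- The co-exterior product does not depend on the multivectors `A` and `B`. For `B` this follows
from `(A ∧ B) ⌟ w = A ⌟ (B ⌟ w)`, for `A` from `contr_mul_eq_zero`. -/
theorem coext_eq {n : ℕ} {w : Covec E} (hw : w ∈ ⋀[ℝ]^n (Module.Dual ℝ E)) {A B : Multivec E}
    {a b : Covec E} (hA : contr A w = a) (hB : contr B w = b) :
    coext w a b = contr (A * B) w := by
  have h : ∃ AB : Multivec E × Multivec E, contr AB.1 w = a ∧ contr AB.2 w = b :=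
    ⟨(A, B), hA, hB⟩
  rw [coext, dif_pos h]
  obtain ⟨h1, h2⟩ := h.choose_spec
  generalize h.choose = AB at h1 h2
  rw [contr_mul_apply, h2, ← hB, ← contr_mul_apply, ← sub_eq_zero,
    ← LinearMap.sub_apply, ← map_sub, ← sub_mul]
  refine contr_mul_eq_zero hw ?_ B
  rw [map_sub, LinearMap.sub_apply, h1, hA, sub_self]

end Linear

/-! ### Calculus with values in an exterior algebra -/

section Calculus

/-- The exterior algebra of a finite-dimensional space, normed by its linear coordinates. The norm
serves only to have derivatives of maps with values in the exterior algebra. -/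
scoped instance (V : Type*) [AddCommGroup V] [Module ℝ V] [Module.Finite ℝ V] :
    NormedAddCommGroup (ExteriorAlgebra ℝ V) :=
  NormedAddCommGroup.induced _ _ (extCoord V) (extCoord V).injective

scoped instance (V : Type*) [AddCommGroup V] [Module ℝ V] [Module.Finite ℝ V] :
    NormedSpace ℝ (ExteriorAlgebra ℝ V) :=
  NormedSpace.induced ℝ _ _ (extCoord V)

variable {E : Type*} [NormedAddCommGroup E] [NormedSpace ℝ E] [FiniteDimensional ℝ E]
  {E' : Type*} [NormedAddCommGroup E'] [NormedSpace ℝ E'] [FiniteDimensional ℝ E']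
  {V : Type*} [AddCommGroup V] [Module ℝ V] [Module.Finite ℝ V]

theorem smoothOnExt_iff {f : E → ExteriorAlgebra ℝ V} {s : Set E} :
    SmoothOnExt f s ↔ ContDiffOn ℝ ∞ f s :=
  (extCoord V).toContinuousLinearEquiv.comp_contDiffOn_iff

theorem dirDeriv_eq (f : E → ExteriorAlgebra ℝ V) (u v : E) :
    dirDeriv f u v = fderiv ℝ f u v := by
  have h : fderiv ℝ (fun u' => extCoord V (f u')) u = _ :=
    (extCoord V).toContinuousLinearEquiv.comp_fderiv (f := f) (x := u)
  rw [dirDeriv, h]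
  exact (extCoord V).symm_apply_apply _

/-- The exterior product as a continuous bilinear map. -/
def mulL (V : Type*) [AddCommGroup V] [Module ℝ V] [Module.Finite ℝ V] :
    ExteriorAlgebra ℝ V →L[ℝ] ExteriorAlgebra ℝ V →L[ℝ] ExteriorAlgebra ℝ V :=
  (LinearMap.mul ℝ (ExteriorAlgebra ℝ V)).toContinuousBilinearMap

/-- The interior product as a continuous bilinear map. -/
def contrL (E : Type*) [AddCommGroup E] [Module ℝ E] [Module.Finite ℝ E] :
    Multivec E →L[ℝ] Covec E →L[ℝ] Covec E :=
  (contr (E := E)).toLinearMap.toContinuousBilinearMap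

theorem two_le_infty : (2 : WithTop ℕ∞) ≤ ∞ := WithTop.coe_le_coe.2 le_top

theorem pull_ι {F F' : Type*} [AddCommGroup F] [Module ℝ F] [AddCommGroup F'] [Module ℝ F']
    (T : F →ₗ[ℝ] F') (a : Module.Dual ℝ F') : pull T (ι ℝ a) = ι ℝ (a ∘ₗ T) :=
  ExteriorAlgebra.map_apply_ι _ _

section
variable {F : Type*} [NormedAddCommGroup F] [NormedSpace ℝ F]
  {G : Type*} [NormedAddCommGroup G] [NormedSpace ℝ G] [FiniteDimensional ℝ G]

theorem fderiv_linear_comp (L : ExteriorAlgebra ℝ V →ₗ[ℝ] G) {f : F → ExteriorAlgebra ℝ V} {u : F}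
    (hf : DifferentiableAt ℝ f u) (v : F) :
    fderiv ℝ (fun u' => L (f u')) u v = L (fderiv ℝ f u v) := by
  have h := (LinearMap.toContinuousLinearMap L).hasFDerivAt.comp u hf.hasFDerivAt
  exact DFunLike.congr_fun h.fderiv v

theorem differentiableAt_linear_comp (L : ExteriorAlgebra ℝ V →ₗ[ℝ] G)
    {f : F → ExteriorAlgebra ℝ V} {u : F} (hf : DifferentiableAt ℝ f u) :
    DifferentiableAt ℝ (fun u' => L (f u')) u :=
  ((LinearMap.toContinuousLinearMap L).hasFDerivAt.comp u hf.hasFDerivAt).differentiableAt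

theorem contDiffOn_linear_comp (L : ExteriorAlgebra ℝ V →ₗ[ℝ] G)
    {f : F → ExteriorAlgebra ℝ V} {s : Set F} (hf : ContDiffOn ℝ ∞ f s) :
    ContDiffOn ℝ ∞ (fun u' => L (f u')) s :=
  (LinearMap.toContinuousLinearMap L).contDiff.comp_contDiffOn hf

theorem fderiv_mul {f g : F → ExteriorAlgebra ℝ V} {u : F} (hf : DifferentiableAt ℝ f u)
    (hg : DifferentiableAt ℝ g u) (v : F) :
    fderiv ℝ (fun u' => f u' * g u') u v = fderiv ℝ f u v * g u + f u * fderiv ℝ g u v := by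
  have h := (mulL V).hasFDerivAt_of_bilinear hf.hasFDerivAt hg.hasFDerivAt
  refine (DFunLike.congr_fun h.fderiv v).trans ?_
  exact add_comm _ _

theorem differentiableAt_mul {f g : F → ExteriorAlgebra ℝ V} {u : F}
    (hf : DifferentiableAt ℝ f u) (hg : DifferentiableAt ℝ g u) :
    DifferentiableAt ℝ (fun u' => f u' * g u') u :=
  ((mulL V).hasFDerivAt_of_bilinear hf.hasFDerivAt hg.hasFDerivAt).differentiableAt

theorem fderiv_contr {P : F → Multivec E} {α : F → Covec E} {u : F} (hP : DifferentiableAt ℝ P u)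
    (hα : DifferentiableAt ℝ α u) (v : F) :
    fderiv ℝ (fun u' => contr (P u') (α u')) u v =
      contr (fderiv ℝ P u v) (α u) + contr (P u) (fderiv ℝ α u v) := by
  have h := (contrL E).hasFDerivAt_of_bilinear hP.hasFDerivAt hα.hasFDerivAt
  refine (DFunLike.congr_fun h.fderiv v).trans ?_
  exact add_comm _ _

theorem differentiableAt_contr {P : F → Multivec E} {α : F → Covec E} {u : F}
    (hP : DifferentiableAt ℝ P u) (hα : DifferentiableAt ℝ α u) :
    DifferentiableAt ℝ (fun u' => contr (P u') (α u')) u :=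
  ((contrL E).hasFDerivAt_of_bilinear hP.hasFDerivAt hα.hasFDerivAt).differentiableAt

theorem contDiffOn_mul {f g : F → ExteriorAlgebra ℝ V} {s : Set F}
    (hf : ContDiffOn ℝ ∞ f s) (hg : ContDiffOn ℝ ∞ g s) :
    ContDiffOn ℝ ∞ (fun u' => f u' * g u') s :=
  ((mulL V).contDiff.comp_contDiffOn hf).clm_apply hg

theorem contDiffOn_contr {P : F → Multivec E} {α : F → Covec E} {s : Set F}
    (hP : ContDiffOn ℝ ∞ P s) (hα : ContDiffOn ℝ ∞ α s) :
    ContDiffOn ℝ ∞ (fun u' => contr (P u') (α u')) s :=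
  ((contrL E).contDiff.comp_contDiffOn hP).clm_apply hα

/-- The derivative of a function with values in a subspace has values in this subspace. -/
theorem fderiv_mem {S : Submodule ℝ (ExteriorAlgebra ℝ V)} {f : F → ExteriorAlgebra ℝ V} {u : F}
    (h : ∀ᶠ u' in nhds u, f u' ∈ S) (v : F) : fderiv ℝ f u v ∈ S := by
  by_cases hf : DifferentiableAt ℝ f u
  · by_contra hv
    obtain ⟨ℓ, hℓ, hS⟩ := Submodule.exists_le_ker_of_notMem hv
    have h1 := fderiv_linear_comp ℓ hf v
    have h2 : (fun u' => ℓ (f u')) =ᶠ[nhds u] fun _ => 0 := h.mono fun u' hu' => hS hu'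
    rw [h2.fderiv_eq] at h1
    exact hℓ (h1.symm.trans (by simp))
  · rw [fderiv_zero_of_not_differentiableAt hf]
    exact zero_mem _

end

/-! ### The exterior derivative in a vector space -/

/-- The alternation `∑ dxⁱ ∧ L(∂ᵢ)` of a linear map with values in forms. -/
def wedgeSum (L : E →ₗ[ℝ] Covec E) : Covec E :=
  ∑ i, ι ℝ ((Module.finBasis ℝ E).coord i) * L (Module.finBasis ℝ E i)

theorem sum_apply_smul_coord {F : Type*} [AddCommGroup F] [Module ℝ F]
    (L : E →ₗ[ℝ] F) (ξ : F →ₗ[ℝ] ℝ) :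
    ∑ i, ξ (L (Module.finBasis ℝ E i)) • (Module.finBasis ℝ E).coord i = ξ ∘ₗ L := by
  refine (Module.finBasis ℝ E).ext fun j => ?_
  simp [LinearMap.sum_apply, Finsupp.single_apply]

/-- The expansion of a covector in the dual basis, multiplied by a form. -/
theorem sum_ι_coord_mul (ξ : Module.Dual ℝ E) (β : Covec E) :
    ∑ i, ι ℝ ((Module.finBasis ℝ E).coord i) * ξ (Module.finBasis ℝ E i) • β = ι ℝ ξ * β := by
  have h := sum_apply_smul_coord (LinearMap.id : E →ₗ[ℝ] E) ξ
  rw [LinearMap.comp_id] at h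
  conv_rhs => rw [← h, map_sum, Finset.sum_mul]
  refine Finset.sum_congr rfl fun i _ => ?_
  rw [map_smul, mul_smul_comm, smul_mul_assoc]
  rfl

theorem extDLoc_eq (α : E → Covec E) (u : E) :
    extDLoc α u = wedgeSum (fderiv ℝ α u).toLinearMap := by
  simp only [extDLoc, wedgeSum, dirDeriv_eq]
  rfl

theorem extDLoc_congr {α β : E → Covec E} {u : E} (h : α =ᶠ[nhds u] β) :
    extDLoc α u = extDLoc β u := by
  rw [extDLoc_eq, extDLoc_eq, h.fderiv_eq]

theorem extDLoc_add {α β : E → Covec E} {u : E} (hα : DifferentiableAt ℝ α u)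
    (hβ : DifferentiableAt ℝ β u) :
    extDLoc (fun u => α u + β u) u = extDLoc α u + extDLoc β u := by
  simp only [extDLoc_eq, wedgeSum, fderiv_fun_add hα hβ, ← Finset.sum_add_distrib, ← mul_add]
  rfl

theorem extDLoc_const_smul (c : ℝ) {α : E → Covec E} {u : E} (hα : DifferentiableAt ℝ α u) :
    extDLoc (fun u => c • α u) u = c • extDLoc α u := by
  simp only [extDLoc_eq, wedgeSum, fderiv_fun_const_smul hα, Finset.smul_sum, ← mul_smul_comm]
  rfl

theorem contDiffOn_extDLoc {α : E → Covec E} {s : Set E} (hs : IsOpen s)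
    (hα : ContDiffOn ℝ ∞ α s) : ContDiffOn ℝ ∞ (extDLoc α) s := by
  have h1 : ContDiffOn ℝ ∞ (fderiv ℝ α) s := hα.fderiv_of_isOpen hs (by simp)
  have h2 : extDLoc α = fun u => ∑ i, ι ℝ ((Module.finBasis ℝ E).coord i) *
      fderiv ℝ α u (Module.finBasis ℝ E i) := by
    funext u; rw [extDLoc_eq]; rfl
  rw [h2]
  exact ContDiffOn.sum fun i _ => contDiffOn_mul contDiffOn_const (h1.clm_apply contDiffOn_const)

theorem extDLoc_mem_extPow {p : ℕ} {α : E → Covec E} {u : E}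
    (h : ∀ᶠ u' in nhds u, α u' ∈ ⋀[ℝ]^p (Module.Dual ℝ E)) :
    extDLoc α u ∈ ⋀[ℝ]^(p + 1) (Module.Dual ℝ E) := by
  rw [extDLoc_eq]
  exact sum_mem fun i _ => ι_mul_mem_extPow _ (fderiv_mem h _)

theorem extDLoc_mem_annBy {W : Submodule ℝ E} {k : ℕ} {α : E → Covec E} {u : E}
    (h : ∀ᶠ u' in nhds u, α u' ∈ annBy W k) : extDLoc α u ∈ annBy W (k + 1) := by
  rw [extDLoc_eq]
  exact sum_mem fun i _ => ι_mul_mem_annBy _ (fderiv_mem h _)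

/-- The double alternation of a symmetric bilinear map vanishes. -/
theorem sum_sum_symm_eq_zero (B : E → E → Covec E) (hB : ∀ v w, B v w = B w v) :
    ∑ i, ∑ j, ι ℝ ((Module.finBasis ℝ E).coord i) * (ι ℝ ((Module.finBasis ℝ E).coord j) *
      B (Module.finBasis ℝ E i) (Module.finBasis ℝ E j)) = 0 := by
  have key : ∀ x : Covec E, x = -x → x = 0 := fun x hx => by
    have h2 : (2 : ℝ) • x = 0 := by
      rw [two_smul]; nth_rewrite 1 [hx]; exact neg_add_cancel x
    exact (smul_eq_zero.1 h2).resolve_left two_ne_zero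
  refine key _ ?_
  conv_lhs => rw [Finset.sum_comm]
  simp only [← Finset.sum_neg_distrib]
  refine Finset.sum_congr rfl fun i _ => Finset.sum_congr rfl fun j _ => ?_
  rw [hB, ← mul_assoc, ← mul_assoc, ← neg_mul]
  congr 1
  exact eq_neg_of_add_eq_zero_left (ExteriorAlgebra.ι_add_mul_swap _ _)

theorem extDLoc_extDLoc {α : E → Covec E} {u : E} (hα : ContDiffAt ℝ ∞ α u) :
    extDLoc (extDLoc α) u = 0 := by
  have hd : DifferentiableAt ℝ (fderiv ℝ α) u :=
    (hα.fderiv_right (m := 1) two_le_infty).differentiableAt (by simp)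
  have hs : IsSymmSndFDerivAt ℝ α u := hα.isSymmSndFDerivAt
    (by rw [minSmoothness_of_isRCLikeNormedField]; exact two_le_infty)
  have h2 : extDLoc α = fun u => ∑ i, ι ℝ ((Module.finBasis ℝ E).coord i) *
      fderiv ℝ α u (Module.finBasis ℝ E i) := by
    funext u; rw [extDLoc_eq]; rfl
  have h3 : ∀ w v, fderiv ℝ (fun u => fderiv ℝ α u w) u v = fderiv ℝ (fderiv ℝ α) u v w := by
    intro w v
    rw [fderiv_clm_apply hd (differentiableAt_const w)]
    simp
  have h4 : ∀ w, DifferentiableAt ℝ (fun u => fderiv ℝ α u w) u :=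
    fun w => hd.clm_apply (differentiableAt_const w)
  have h5 : ∀ v, fderiv ℝ (extDLoc α) u v = ∑ i, ι ℝ ((Module.finBasis ℝ E).coord i) *
      fderiv ℝ (fderiv ℝ α) u v (Module.finBasis ℝ E i) := by
    intro v
    rw [h2, fderiv_fun_sum fun i _ =>
      differentiableAt_mul (V := Module.Dual ℝ E) (differentiableAt_const _) (h4 _), sum_apply]
    refine Finset.sum_congr rfl fun i _ => ?_
    rw [fderiv_mul (V := Module.Dual ℝ E) (differentiableAt_const _) (h4 _), h3]
    simp
  rw [extDLoc_eq, wedgeSum]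
  simp only [ContinuousLinearMap.coe_coe, h5, Finset.mul_sum]
  exact sum_sum_symm_eq_zero (fun v w => fderiv ℝ (fderiv ℝ α) u v w) fun v w => hs v w

/-! ### Pullback and pushforward along families of linear maps -/

theorem contDiffOn_map_const {F V' : Type*} [NormedAddCommGroup F] [NormedSpace ℝ F]
    [AddCommGroup V'] [Module ℝ V'] [Module.Finite ℝ V'] {T : F → V →ₗ[ℝ] V'} {s : Set F}
    (hT : ∀ v, ContDiffOn ℝ ∞ (fun u => ι ℝ (T u v)) s) (β : ExteriorAlgebra ℝ V) :
    ContDiffOn ℝ ∞ (fun u => ExteriorAlgebra.map (T u) β) s := by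
  induction β using ExteriorAlgebra.induction with
  | algebraMap r => simp only [AlgHom.commutes]; exact contDiffOn_const
  | ι v => simpa only [ExteriorAlgebra.map_apply_ι] using hT v
  | mul a b ha hb => simpa only [map_mul] using contDiffOn_mul ha hb
  | add a b ha hb => simpa only [map_add] using ha.add hb

/-- The functorial action on exterior algebras of a smooth family of linear maps is smooth. -/
theorem contDiffOn_map {F V' : Type*} [NormedAddCommGroup F] [NormedSpace ℝ F]
    [AddCommGroup V'] [Module ℝ V'] [Module.Finite ℝ V'] {T : F → V →ₗ[ℝ] V'} {s : Set F}
    (hT : ∀ v, ContDiffOn ℝ ∞ (fun u => ι ℝ (T u v)) s) {α : F → ExteriorAlgebra ℝ V}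
    (hα : ContDiffOn ℝ ∞ α s) :
    ContDiffOn ℝ ∞ (fun u => ExteriorAlgebra.map (T u) (α u)) s := by
  have h : (fun u => ExteriorAlgebra.map (T u) (α u)) = fun u =>
      ∑ i, (Module.finBasis ℝ (ExteriorAlgebra ℝ V)).coord i (α u) •
        ExteriorAlgebra.map (T u) (Module.finBasis ℝ (ExteriorAlgebra ℝ V) i) := by
    funext u
    conv_lhs => rw [← (Module.finBasis ℝ (ExteriorAlgebra ℝ V)).sum_repr (α u), map_sum]
    exact Finset.sum_congr rfl fun i _ => map_smul _ _ _
  rw [h]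
  refine ContDiffOn.sum fun i _ => ?_
  exact ContDiffOn.smul (f := fun u => (Module.finBasis ℝ (ExteriorAlgebra ℝ V)).coord i (α u))
    (contDiffOn_linear_comp _ hα) (contDiffOn_map_const hT _)

theorem contDiffOn_pull_apply {F : Type*} [NormedAddCommGroup F] [NormedSpace ℝ F]
    {T : F → E →L[ℝ] E'} {s : Set F} (hT : ContDiffOn ℝ ∞ T s) {α : F → Covec E'}
    (hα : ContDiffOn ℝ ∞ α s) : ContDiffOn ℝ ∞ (fun u => pull (T u).toLinearMap (α u)) s := by
  refine contDiffOn_map (fun a => ?_) hα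
  let Φ : (E →L[ℝ] E') →ₗ[ℝ] Covec E :=
    { toFun := fun L => ι ℝ (a ∘ₗ L.toLinearMap)
      map_add' := fun L L' => by rw [← map_add, ← LinearMap.comp_add]; rfl
      map_smul' := fun c L => by rw [RingHom.id_apply, ← map_smul, ← LinearMap.comp_smul]; rfl }
  exact (LinearMap.toContinuousLinearMap Φ).contDiff.comp_contDiffOn hT

theorem contDiffOn_push_apply {F : Type*} [NormedAddCommGroup F] [NormedSpace ℝ F]
    {T : F → E →L[ℝ] E'} {s : Set F} (hT : ContDiffOn ℝ ∞ T s) {P : F → Multivec E}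
    (hP : ContDiffOn ℝ ∞ P s) : ContDiffOn ℝ ∞ (fun u => push (T u).toLinearMap (P u)) s := by
  refine contDiffOn_map (fun v => ?_) hP
  exact (LinearMap.toContinuousLinearMap (ι ℝ : E' →ₗ[ℝ] Multivec E')).contDiff.comp_contDiffOn
    (hT.clm_apply contDiffOn_const)

/-- The pullback of a constant form is closed. For a covector `a` this is the symmetry of the second
derivative of `φ`; exterior products are treated by the product rule. -/
theorem extDLoc_pull_const {φ : E → E'} {s : Set E} (hs : IsOpen s) (hφ : ContDiffOn ℝ ∞ φ s)
    {u : E} (hu : u ∈ s) (β : Covec E') :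
    extDLoc (fun u' => pull (fderiv ℝ φ u').toLinearMap β) u = 0 := by
  have hd : ContDiffOn ℝ ∞ (fderiv ℝ φ) s := hφ.fderiv_of_isOpen hs (by simp)
  have hdiff : ∀ γ : Covec E',
      DifferentiableAt ℝ (fun u' => pull (fderiv ℝ φ u').toLinearMap γ) u := fun γ =>
    ((contDiffOn_pull_apply hd contDiffOn_const).contDiffAt (hs.mem_nhds hu)).differentiableAt
      (by simp)
  have hd' : DifferentiableAt ℝ (fderiv ℝ φ) u :=
    (hd.contDiffAt (hs.mem_nhds hu)).differentiableAt (by simp)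
  have hsymm : IsSymmSndFDerivAt ℝ φ u := (hφ.contDiffAt (hs.mem_nhds hu)).isSymmSndFDerivAt
    (by rw [minSmoothness_of_isRCLikeNormedField]; exact two_le_infty)
  induction β using CliffordAlgebra.left_induction with
  | algebraMap r =>
    have h : (fun u' => pull (fderiv ℝ φ u').toLinearMap (algebraMap ℝ (Covec E') r)) =
      fun _ => algebraMap ℝ (Covec E) r := by funext u'; exact AlgHom.commutes _ r
    refine (congrFun (congrArg extDLoc h) u).trans ?_
    rw [extDLoc_eq]
    simp [wedgeSum]
  | add x y hx hy =>
    simp only [map_add]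
    rw [extDLoc_add (hdiff x) (hdiff y), hx, hy, add_zero]
  | ι_mul x a hx =>
    have h : (fun u' => pull (fderiv ℝ φ u').toLinearMap (ι ℝ a * x)) = fun u' =>
        pull (fderiv ℝ φ u').toLinearMap (ι ℝ a) * pull (fderiv ℝ φ u').toLinearMap x := by
      funext u'; exact map_mul _ _ _
    refine (congrFun (congrArg extDLoc h) u).trans ?_
    let Φ : (E →L[ℝ] E') →ₗ[ℝ] Covec E :=
      { toFun := fun L => ι ℝ (a ∘ₗ L.toLinearMap)
        map_add' := fun L L' => by rw [← map_add, ← LinearMap.comp_add]; rfl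
        map_smul' := fun c L => by rw [RingHom.id_apply, ← map_smul, ← LinearMap.comp_smul]; rfl }
    have h1 : ∀ v, fderiv ℝ (fun u' => pull (fderiv ℝ φ u').toLinearMap (ι ℝ a)) u v =
        ι ℝ (a ∘ₗ (fderiv ℝ (fderiv ℝ φ) u v).toLinearMap) := by
      intro v
      have h2 := (LinearMap.toContinuousLinearMap Φ).hasFDerivAt.comp u hd'.hasFDerivAt
      have h3 : (fun u' => pull (fderiv ℝ φ u').toLinearMap (ι ℝ a)) =
          LinearMap.toContinuousLinearMap Φ ∘ fderiv ℝ φ := by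
        funext u'; exact ExteriorAlgebra.map_apply_ι _ _
      rw [h3]
      exact DFunLike.congr_fun h2.fderiv v
    have h4 : pull (fderiv ℝ φ u).toLinearMap (ι ℝ a) = ι ℝ (a ∘ₗ (fderiv ℝ φ u).toLinearMap) :=
      ExteriorAlgebra.map_apply_ι _ _
    rw [extDLoc_eq] at hx ⊢
    simp only [wedgeSum, ContinuousLinearMap.coe_coe] at hx ⊢
    simp only [fderiv_mul (hdiff (ι ℝ a)) (hdiff x), mul_add, Finset.sum_add_distrib, h1, h4]
    have h5 : ∑ i, ι ℝ ((Module.finBasis ℝ E).coord i) *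
        (ι ℝ (a ∘ₗ (fderiv ℝ φ u).toLinearMap) *
          fderiv ℝ (fun u' => pull (fderiv ℝ φ u').toLinearMap x) u (Module.finBasis ℝ E i)) =
        0 := by
      have h6 : ∀ ξ : Module.Dual ℝ E, ∀ y : Covec E,
          ι ℝ ξ * (ι ℝ (a ∘ₗ (fderiv ℝ φ u).toLinearMap) * y) =
          -(ι ℝ (a ∘ₗ (fderiv ℝ φ u).toLinearMap) * (ι ℝ ξ * y)) := by
        intro ξ y
        rw [← mul_assoc, ← mul_assoc, ← neg_mul]
        congr 1
        exact eq_neg_of_add_eq_zero_left (ExteriorAlgebra.ι_add_mul_swap _ _)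
      simp only [h6, Finset.sum_neg_distrib, ← Finset.mul_sum]
      exact (congrArg (fun y => -(ι ℝ (a ∘ₗ (fderiv ℝ φ u).toLinearMap) * y)) hx).trans
        (by rw [mul_zero, neg_zero])
    rw [h5, add_zero]
    have h7 := sum_sum_symm_eq_zero (E := E) (fun v w => a (fderiv ℝ (fderiv ℝ φ) u v w) •
      pull (fderiv ℝ φ u).toLinearMap x) (fun v w => by rw [hsymm v w])
    refine Eq.trans (Finset.sum_congr rfl fun i _ => ?_) h7
    rw [← Finset.mul_sum]
    congr 1
    exact (sum_ι_coord_mul (a ∘ₗ (fderiv ℝ (fderiv ℝ φ) u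
      (Module.finBasis ℝ E i)).toLinearMap) _).symm

/-- The exterior derivative commutes with pullbacks. -/
theorem extDLoc_pull {φ : E → E'} {s : Set E} (hs : IsOpen s) (hφ : ContDiffOn ℝ ∞ φ s)
    {u : E} (hu : u ∈ s) {α : E' → Covec E'} (hα : DifferentiableAt ℝ α (φ u)) :
    extDLoc (fun u' => pull (fderiv ℝ φ u').toLinearMap (α (φ u'))) u =
      pull (fderiv ℝ φ u).toLinearMap (extDLoc α (φ u)) := by
  have hd : ContDiffOn ℝ ∞ (fderiv ℝ φ) s := hφ.fderiv_of_isOpen hs (by simp)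
  have hdiff : ∀ γ : Covec E',
      DifferentiableAt ℝ (fun u' => pull (fderiv ℝ φ u').toLinearMap γ) u := fun γ =>
    ((contDiffOn_pull_apply hd contDiffOn_const).contDiffAt (hs.mem_nhds hu)).differentiableAt
      (by simp)
  have hφd : DifferentiableAt ℝ φ u :=
    (hφ.contDiffAt (hs.mem_nhds hu)).differentiableAt (by simp)
  -- Expand `α` in constant forms `b k`, whose pullbacks are closed.
  set b := Module.finBasis ℝ (Covec E') with hb
  have hc : ∀ k, DifferentiableAt ℝ (fun u' => b.coord k (α (φ u'))) u := fun k =>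
    (differentiableAt_linear_comp (b.coord k) hα).comp u hφd
  have hc' : ∀ k v, fderiv ℝ (fun u' => b.coord k (α (φ u'))) u v =
      b.coord k (fderiv ℝ α (φ u) (fderiv ℝ φ u v)) := by
    intro k v
    have h1 := fderiv_comp u (differentiableAt_linear_comp (b.coord k) hα) hφd
    refine (DFunLike.congr_fun h1 v).trans ?_
    exact fderiv_linear_comp (b.coord k) hα _
  have h : (fun u' => pull (fderiv ℝ φ u').toLinearMap (α (φ u'))) = fun u' =>
      ∑ k, b.coord k (α (φ u')) • pull (fderiv ℝ φ u').toLinearMap (b k) := by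
    funext u'
    conv_lhs => rw [← b.sum_repr (α (φ u')), map_sum]
    exact Finset.sum_congr rfl fun i _ => map_smul _ _ _
  have h1 : ∀ v, fderiv ℝ (fun u' => pull (fderiv ℝ φ u').toLinearMap (α (φ u'))) u v =
      ∑ k, (b.coord k (α (φ u)) •
          fderiv ℝ (fun u' => pull (fderiv ℝ φ u').toLinearMap (b k)) u v +
        b.coord k (fderiv ℝ α (φ u) (fderiv ℝ φ u v)) •
          pull (fderiv ℝ φ u).toLinearMap (b k)) := by
    intro v
    rw [h, fderiv_fun_sum fun k _ => (hc k).fun_smul (hdiff (b k)), sum_apply]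
    refine Finset.sum_congr rfl fun k _ => ?_
    rw [fderiv_fun_smul (hc k) (hdiff (b k)), ← hc']
    rfl
  have h2 : ∀ v, ∑ k, b.coord k (fderiv ℝ α (φ u) v) • b k = fderiv ℝ α (φ u) v := fun v =>
    b.sum_repr _
  rw [extDLoc_eq, extDLoc_eq]
  simp only [wedgeSum, ContinuousLinearMap.coe_coe, h1, Finset.mul_sum, mul_add,
    Finset.sum_add_distrib]
  have h3 : ∑ i, ∑ k, ι ℝ ((Module.finBasis ℝ E).coord i) * (b.coord k (α (φ u)) •
      fderiv ℝ (fun u' => pull (fderiv ℝ φ u').toLinearMap (b k)) u (Module.finBasis ℝ E i)) =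
      0 := by
    rw [Finset.sum_comm]
    refine Finset.sum_eq_zero fun k _ => ?_
    have h4 := extDLoc_pull_const hs hφ hu (b k)
    rw [extDLoc_eq] at h4
    simp only [mul_smul_comm, ← Finset.smul_sum]
    exact (congrArg (fun y => b.coord k (α (φ u)) • y) h4).trans (smul_zero _)
  rw [h3, zero_add, Finset.sum_comm, map_sum]
  have h5 : ∀ k, ∑ i, ι ℝ ((Module.finBasis ℝ E).coord i) *
      (b.coord k (fderiv ℝ α (φ u) (fderiv ℝ φ u (Module.finBasis ℝ E i))) •
        pull (fderiv ℝ φ u).toLinearMap (b k)) =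
      pull (fderiv ℝ φ u).toLinearMap (∑ j, ι ℝ ((Module.finBasis ℝ E').coord j) *
        (b.coord k (fderiv ℝ α (φ u) (Module.finBasis ℝ E' j)) • b k)) := by
    intro k
    have h6 := sum_ι_coord_mul ((b.coord k ∘ₗ (fderiv ℝ α (φ u)).toLinearMap) ∘ₗ
      (fderiv ℝ φ u).toLinearMap) (pull (fderiv ℝ φ u).toLinearMap (b k))
    have h7 := sum_ι_coord_mul (b.coord k ∘ₗ (fderiv ℝ α (φ u)).toLinearMap) (b k)
    refine h6.trans ?_
    refine Eq.trans ?_ (congrArg (pull (fderiv ℝ φ u).toLinearMap) h7).symm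
    rw [map_mul]
    congr 1
    exact (pull_ι _ _).symm
  rw [Finset.sum_congr rfl fun k _ => h5 k, ← map_sum, Finset.sum_comm, ← map_sum]
  congr 1
  refine Finset.sum_congr rfl fun j _ => ?_
  rw [← Finset.mul_sum, h2]

end Calculus

/-! ### The Schouten–Nijenhuis bracket in a vector space -/

section Schouten

variable {E : Type*} [NormedAddCommGroup E] [NormedSpace ℝ E] [FiniteDimensional ℝ E]

theorem contractLeft_mul_comm {a b : ℕ} {p q : Multivec E} (hp : p ∈ ⋀[ℝ]^a E)
    (hq : q ∈ ⋀[ℝ]^b E) (ξ : Module.Dual ℝ E) :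
    contractLeft (Q := (0 : QuadraticForm ℝ E)) ξ q * p =
      (-1 : ℝ) ^ (a * (b + 1)) • (p * contractLeft (Q := (0 : QuadraticForm ℝ E)) ξ q) := by
  cases b with
  | zero => rw [contractLeft_of_mem_zero ξ hq, zero_mul, mul_zero, smul_zero]
  | succ b =>
    rw [mul_comm_of_mem (contractLeft_mem_extPow ξ hq) hp, mul_comm b a]
    congr 1
    rw [show a * (b + 1 + 1) = a * b + 2 * a by ring, pow_add, pow_mul (-1 : ℝ) 2]
    norm_num

/-- The pointwise identity behind Cartan's formula for the Schouten–Nijenhuis bracket: `p'`, `q'`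
and `α'` stand for derivatives of `p`, `q` and `α` in a coordinate direction with differential
`ξ`. -/
theorem contr_schouten_term {a b : ℕ} {p p' q q' : Multivec E} (hp : p ∈ ⋀[ℝ]^a E)
    (hp' : p' ∈ ⋀[ℝ]^a E) (hq : q ∈ ⋀[ℝ]^b E) (ξ : Module.Dual ℝ E) (α α' : Covec E) :
    contr (contractRight (Q := (0 : QuadraticForm ℝ E)) p ξ * q' -
        p' * contractLeft (Q := (0 : QuadraticForm ℝ E)) ξ q) α =
      contr p (ι ℝ ξ * (contr q' α + contr q α')) -
      (-1 : ℝ) ^ a • (ι ℝ ξ * (contr p' (contr q α) + contr p (contr q' α + contr q α'))) -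
      (-1 : ℝ) ^ ((a + 1) * b) • contr q (contr p (ι ℝ ξ * α')) +
      (-1 : ℝ) ^ ((a + 1) * b + a) • contr q (ι ℝ ξ * (contr p' α + contr p α')) := by
  -- Everything is expressed by the left contractions `pl`, `ql` with `ξ`, and all terms are brought
  -- to the order `q`, `p`; then the coefficients can be compared.
  obtain ⟨pl, hpl⟩ : ∃ pl : Multivec E,
      pl = contractLeft (Q := (0 : QuadraticForm ℝ E)) ξ p := ⟨_, rfl⟩
  obtain ⟨ql, hql⟩ : ∃ ql : Multivec E,
      ql = contractLeft (Q := (0 : QuadraticForm ℝ E)) ξ q := ⟨_, rfl⟩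
  have hpr : contractRight (Q := (0 : QuadraticForm ℝ E)) p ξ = -((-1 : ℝ) ^ a • pl) := by
    rw [contractRight_eq_neg, involute_of_mem hp, map_smul, hpl]
  have hqr : contractRight (Q := (0 : QuadraticForm ℝ E)) q ξ = -((-1 : ℝ) ^ b • ql) := by
    rw [contractRight_eq_neg, involute_of_mem hq, map_smul, hql]
  have e1 : ∀ β, contr p (contr q β) = (-1 : ℝ) ^ (a * b) • contr q (contr p β) :=
    contr_comm_apply hp hq
  have e2 : ∀ β, contr p' (contr q β) = (-1 : ℝ) ^ (a * b) • contr q (contr p' β) :=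
    contr_comm_apply hp' hq
  have e3 : ∀ β, contr ql (contr p' β) =
      ((-1 : ℝ) ^ (a * b) * (-1) ^ a) • contr p' (contr ql β) := by
    intro β
    rw [show (-1 : ℝ) ^ (a * b) * (-1) ^ a = (-1) ^ (a * (b + 1)) by ring]
    rw [← contr_mul_apply, hql, contractLeft_mul_comm hp' hq, map_smul, LinearMap.smul_apply,
      contr_mul_apply]
  have e4 : ∀ β, contr pl (contr q β) =
      ((-1 : ℝ) ^ (a * b) * (-1) ^ b) • contr q (contr pl β) := by
    intro β
    rw [show (-1 : ℝ) ^ (a * b) * (-1) ^ b = (-1) ^ (b * (a + 1)) by ring]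
    rw [← contr_mul_apply, hpl, contractLeft_mul_comm hq hp, map_smul, LinearMap.smul_apply,
      contr_mul_apply]
  have f1 : ∀ β, contr p (ι ℝ ξ * β) =
      (-1 : ℝ) ^ a • (ι ℝ ξ * contr p β) - (-1 : ℝ) ^ a • contr pl β := by
    intro β
    rw [contr_ι_mul, hpr, involute_of_mem hp, map_smul contr, map_neg contr, map_smul contr,
      LinearMap.smul_apply, LinearMap.neg_apply, LinearMap.smul_apply, mul_smul_comm,
      sub_eq_add_neg]
  have f2 : ∀ β, contr q (ι ℝ ξ * β) =
      (-1 : ℝ) ^ b • (ι ℝ ξ * contr q β) - (-1 : ℝ) ^ b • contr ql β := by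
    intro β
    rw [contr_ι_mul, hqr, involute_of_mem hq, map_smul contr, map_neg contr, map_smul contr,
      LinearMap.smul_apply, LinearMap.neg_apply, LinearMap.smul_apply, mul_smul_comm,
      sub_eq_add_neg]
  have g1 : ∀ β γ : Covec E, contr p (β + γ) = contr p β + contr p γ := map_add _
  have g2 : ∀ β γ : Covec E, contr q (β + γ) = contr q β + contr q γ := map_add _
  have g5 : ∀ β γ : Covec E, contr q (β - γ) = contr q β - contr q γ := map_sub _
  have g6 : ∀ (c : ℝ) (β : Covec E), contr q (c • β) = c • contr q β := fun c => map_smul _ c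
  have g7 : contr (contractRight (Q := (0 : QuadraticForm ℝ E)) p ξ * q' - p' *
      contractLeft (Q := (0 : QuadraticForm ℝ E)) ξ q) α =
      -((-1 : ℝ) ^ a • contr pl (contr q' α)) - contr p' (contr ql α) := by
    rw [hpr, ← hql, map_sub contr, LinearMap.sub_apply, contr_mul_apply, contr_mul_apply,
      map_neg contr, map_smul contr, LinearMap.neg_apply, LinearMap.smul_apply]
  rw [g7, show (-1 : ℝ) ^ ((a + 1) * b) = (-1) ^ (a * b) * (-1) ^ b by ring,
    show (-1 : ℝ) ^ ((a + 1) * b + a) = (-1) ^ (a * b) * (-1) ^ b * (-1) ^ a by ring]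
  simp only [f1, f2, g1, g2, g5, g6, e1, e2, e3, e4, mul_add, mul_smul_comm]
  have ha : (-1 : ℝ) ^ a = 1 ∨ (-1 : ℝ) ^ a = -1 := neg_one_pow_eq_or ℝ a
  have hb : (-1 : ℝ) ^ b = 1 ∨ (-1 : ℝ) ^ b = -1 := neg_one_pow_eq_or ℝ b
  have hab : (-1 : ℝ) ^ (a * b) = 1 ∨ (-1 : ℝ) ^ (a * b) = -1 := neg_one_pow_eq_or ℝ _
  rcases ha with ha | ha <;> rcases hb with hb | hb <;> rcases hab with hab | hab <;>
    · simp only [ha, hb, hab]; module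

/-- Cartan's formula for the Schouten–Nijenhuis bracket: the interior product with `[P, Q]` is the
graded commutator of the Lie derivative along `P` and the interior product with `Q`. -/
theorem contr_schoutenLoc {a b : ℕ} {P Q : E → Multivec E} {α : E → Covec E} {u : E}
    (hP : DifferentiableAt ℝ P u) (hQ : DifferentiableAt ℝ Q u) (hα : DifferentiableAt ℝ α u)
    (hPa : ∀ᶠ u' in nhds u, P u' ∈ ⋀[ℝ]^a E) (hQb : ∀ᶠ u' in nhds u, Q u' ∈ ⋀[ℝ]^b E) :
    contr (schoutenLoc P Q u) (α u) =
      contr (P u) (extDLoc (fun u' => contr (Q u') (α u')) u) -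
      (-1 : ℝ) ^ a • extDLoc (fun u' => contr (P u') (contr (Q u') (α u'))) u -
      (-1 : ℝ) ^ ((a + 1) * b) • contr (Q u) (contr (P u) (extDLoc α u)) +
      (-1 : ℝ) ^ ((a + 1) * b + a) •
        contr (Q u) (extDLoc (fun u' => contr (P u') (α u')) u) := by
  have h1 : extDLoc (fun u' => contr (Q u') (α u')) u =
      ∑ i, ι ℝ ((Module.finBasis ℝ E).coord i) *
        (contr (fderiv ℝ Q u (Module.finBasis ℝ E i)) (α u) +
          contr (Q u) (fderiv ℝ α u (Module.finBasis ℝ E i))) := by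
    simp only [extDLoc, dirDeriv_eq, fderiv_contr hQ hα]
  have h2 : extDLoc (fun u' => contr (P u') (α u')) u =
      ∑ i, ι ℝ ((Module.finBasis ℝ E).coord i) *
        (contr (fderiv ℝ P u (Module.finBasis ℝ E i)) (α u) +
          contr (P u) (fderiv ℝ α u (Module.finBasis ℝ E i))) := by
    simp only [extDLoc, dirDeriv_eq, fderiv_contr hP hα]
  have h3 : extDLoc (fun u' => contr (P u') (contr (Q u') (α u'))) u =
      ∑ i, ι ℝ ((Module.finBasis ℝ E).coord i) *
        (contr (fderiv ℝ P u (Module.finBasis ℝ E i)) (contr (Q u) (α u)) +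
          contr (P u) (contr (fderiv ℝ Q u (Module.finBasis ℝ E i)) (α u) +
          contr (Q u) (fderiv ℝ α u (Module.finBasis ℝ E i)))) := by
    simp only [extDLoc, dirDeriv_eq, fderiv_contr hP (differentiableAt_contr hQ hα),
      fderiv_contr hQ hα]
  have h4 : extDLoc α u = ∑ i, ι ℝ ((Module.finBasis ℝ E).coord i) *
      fderiv ℝ α u (Module.finBasis ℝ E i) := by simp only [extDLoc, dirDeriv_eq]
  rw [h1, h2, h3, h4, schoutenLoc]
  simp only [map_sum, LinearMap.sum_apply, Finset.smul_sum, ← Finset.sum_sub_distrib,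
    ← Finset.sum_add_distrib, dirDeriv_eq]
  exact Finset.sum_congr rfl fun i _ => contr_schouten_term hPa.self_of_nhds (fderiv_mem hPa _)
    hQb.self_of_nhds _ _ _

theorem schoutenLoc_mem_extPow {a b c : ℕ} (hc : c + 1 = a + b) {P Q : E → Multivec E} {u : E}
    (hPa : ∀ᶠ u' in nhds u, P u' ∈ ⋀[ℝ]^a E) (hQb : ∀ᶠ u' in nhds u, Q u' ∈ ⋀[ℝ]^b E) :
    schoutenLoc P Q u ∈ ⋀[ℝ]^c E := by
  refine sum_mem fun i _ => sub_mem ?_ ?_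
  · rw [dirDeriv_eq]
    cases a with
    | zero =>
      rw [contractRight_eq_neg, involute_of_mem hPa.self_of_nhds, map_smul,
        contractLeft_of_mem_zero _ hPa.self_of_nhds, smul_zero, neg_zero, zero_mul]
      exact zero_mem _
    | succ a =>
      obtain rfl : c = a + b := by omega
      exact mul_mem_extPow (contractRight_mem_extPow _ hPa.self_of_nhds) (fderiv_mem hQb _)
  · rw [dirDeriv_eq]
    cases b with
    | zero =>
      rw [contractLeft_of_mem_zero _ hQb.self_of_nhds, mul_zero]
      exact zero_mem _
    | succ b =>
      obtain rfl : c = a + b := by omega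
      exact mul_mem_extPow (fderiv_mem hPa _) (contractLeft_mem_extPow _ hQb.self_of_nhds)

/-- Derivatives of vertical fields are vertical if the vertical space is constant. -/
theorem isVertical_schoutenLoc {W : Submodule ℝ E} {b : ℕ} {P Q : E → Multivec E} {u : E}
    (hQb : ∀ᶠ u' in nhds u, Q u' ∈ ⋀[ℝ]^b E)
    (hP : ∀ᶠ u' in nhds u, IsVertical W (P u')) (hQ : ∀ᶠ u' in nhds u, IsVertical W (Q u')) :
    IsVertical W (schoutenLoc P Q u) := by
  refine (verticals W).sum_mem fun i _ => sub_mem ?_ ?_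
  · rw [dirDeriv_eq]
    exact (mem_verticals.1 (fderiv_mem (S := verticals W) hQ _)).mul_left _
  · rw [dirDeriv_eq]
    have h := mem_verticals.1 (fderiv_mem (S := verticals W) hP (Module.finBasis ℝ E i))
    cases b with
    | zero =>
      rw [contractLeft_of_mem_zero _ hQb.self_of_nhds, mul_zero]
      exact zero_mem _
    | succ b => exact h.mul_right (contractLeft_mem_extPow _ hQb.self_of_nhds)

theorem contDiffOn_schoutenLoc {P Q : E → Multivec E} {s : Set E} (hs : IsOpen s)
    (hP : ContDiffOn ℝ ∞ P s) (hQ : ContDiffOn ℝ ∞ Q s) :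
    ContDiffOn ℝ ∞ (schoutenLoc P Q) s := by
  have hP' : ContDiffOn ℝ ∞ (fderiv ℝ P) s := hP.fderiv_of_isOpen hs (by simp)
  have hQ' : ContDiffOn ℝ ∞ (fderiv ℝ Q) s := hQ.fderiv_of_isOpen hs (by simp)
  unfold schoutenLoc
  simp only [dirDeriv_eq]
  refine ContDiffOn.sum fun i _ => ContDiffOn.sub
    (contDiffOn_mul ?_ (hQ'.clm_apply contDiffOn_const))
    (contDiffOn_mul (hP'.clm_apply contDiffOn_const) ?_)
  · exact contDiffOn_linear_comp ((contractRight (Q := (0 : QuadraticForm ℝ E))).flip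
      ((Module.finBasis ℝ E).coord i)) hP
  · exact contDiffOn_linear_comp (contractLeft (Q := (0 : QuadraticForm ℝ E))
      ((Module.finBasis ℝ E).coord i)) hQ

theorem extDLoc_of_eq_pull {E' : Type*} [NormedAddCommGroup E'] [NormedSpace ℝ E']
    [FiniteDimensional ℝ E'] {φ : E → E'} {s : Set E} (hs : IsOpen s) (hφ : ContDiffOn ℝ ∞ φ s)
    {u : E} (hu : u ∈ s) {α : E' → Covec E'} (hα : DifferentiableAt ℝ α (φ u)) {β : E → Covec E}
    (hβ : ∀ u' ∈ s, β u' = pull (fderiv ℝ φ u').toLinearMap (α (φ u'))) :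
    extDLoc β u = pull (fderiv ℝ φ u).toLinearMap (extDLoc α (φ u)) := by
  rw [← extDLoc_pull hs hφ hu hα]
  exact extDLoc_congr (Filter.mem_of_superset (hs.mem_nhds hu) hβ)

/-- The Schouten–Nijenhuis bracket is natural: it is preserved by local diffeomorphisms. By
Cartan's formula this is inherited from the exterior derivative. -/
theorem push_schoutenLoc {φ : E → E} {s : Set E} (hs : IsOpen s) (hφ : ContDiffOn ℝ ∞ φ s)
    {a b : ℕ} (hab : a + b ≠ 0) {P Q P' Q' : E → Multivec E} {u : E} (hu : u ∈ s)
    (hP' : ContDiffOn ℝ ∞ P' s) (hQ' : ContDiffOn ℝ ∞ Q' s)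
    (hP : DifferentiableAt ℝ P (φ u)) (hQ : DifferentiableAt ℝ Q (φ u))
    (hPa : ∀ᶠ y in nhds (φ u), P y ∈ ⋀[ℝ]^a E) (hQb : ∀ᶠ y in nhds (φ u), Q y ∈ ⋀[ℝ]^b E)
    (hPa' : ∀ u' ∈ s, P' u' ∈ ⋀[ℝ]^a E) (hQb' : ∀ u' ∈ s, Q' u' ∈ ⋀[ℝ]^b E)
    (hPP' : ∀ u' ∈ s, push (fderiv ℝ φ u').toLinearMap (P' u') = P (φ u'))
    (hQQ' : ∀ u' ∈ s, push (fderiv ℝ φ u').toLinearMap (Q' u') = Q (φ u'))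
    {S : E →ₗ[ℝ] E} (hS : (fderiv ℝ φ u).toLinearMap ∘ₗ S = LinearMap.id) :
    push (fderiv ℝ φ u).toLinearMap (schoutenLoc P' Q' u) = schoutenLoc P Q (φ u) := by
  obtain ⟨c, hc⟩ : ∃ c, c + 1 = a + b := ⟨a + b - 1, by omega⟩
  have hn : s ∈ nhds u := hs.mem_nhds hu
  have hPe : ∀ᶠ u' in nhds u, P' u' ∈ ⋀[ℝ]^a E := Filter.mem_of_superset hn hPa'
  have hQe : ∀ᶠ u' in nhds u, Q' u' ∈ ⋀[ℝ]^b E := Filter.mem_of_superset hn hQb'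
  have hPd := (hP'.contDiffAt hn).differentiableAt (by simp)
  have hQd := (hQ'.contDiffAt hn).differentiableAt (by simp)
  rw [← sub_eq_zero]
  refine eq_zero_of_contr (a := c) (sub_mem (push_mem_extPow _ (schoutenLoc_mem_extPow hc hPe hQe))
    (schoutenLoc_mem_extPow hc hPa hQb)) fun β => ?_
  rw [map_sub contr, LinearMap.sub_apply, sub_eq_zero]
  have hinj : Function.Injective (pull (fderiv ℝ φ u).toLinearMap : Covec E → Covec E) := by
    refine Function.LeftInverse.injective (g := pull S) fun x => ?_
    rw [pull_comp_apply, hS, pull_id]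
  apply hinj
  rw [← contr_pull]
  have hd : ContDiffOn ℝ ∞ (fderiv ℝ φ) s := hφ.fderiv_of_isOpen hs (by simp)
  have hβ : DifferentiableAt ℝ (fun u' => pull (fderiv ℝ φ u').toLinearMap β) u :=
    ((contDiffOn_pull_apply hd contDiffOn_const).contDiffAt hn).differentiableAt (by simp)
  have key := contr_schoutenLoc (α := fun u' => pull (fderiv ℝ φ u').toLinearMap β)
    hPd hQd hβ hPe hQe
  have key' := contr_schoutenLoc (α := fun _ => β) hP hQ (differentiableAt_const β) hPa hQb
  have c1 : DifferentiableAt ℝ (fun y => contr (Q y) β) (φ u) :=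
    differentiableAt_contr hQ (differentiableAt_const β)
  have c2 : DifferentiableAt ℝ (fun y => contr (P y) β) (φ u) :=
    differentiableAt_contr hP (differentiableAt_const β)
  have c3 : DifferentiableAt ℝ (fun y => contr (P y) (contr (Q y) β)) (φ u) :=
    differentiableAt_contr hP c1
  have e1 := extDLoc_of_eq_pull hs hφ hu c1
    (β := fun u' => contr (Q' u') (pull (fderiv ℝ φ u').toLinearMap β))
    fun u' hu' => by rw [contr_pull, hQQ' u' hu']
  have e2 := extDLoc_of_eq_pull hs hφ hu c2
    (β := fun u' => contr (P' u') (pull (fderiv ℝ φ u').toLinearMap β))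
    fun u' hu' => by rw [contr_pull, hPP' u' hu']
  have e3 := extDLoc_of_eq_pull hs hφ hu c3
    (β := fun u' => contr (P' u') (contr (Q' u') (pull (fderiv ℝ φ u').toLinearMap β)))
    fun u' hu' => by rw [contr_pull, contr_pull, hPP' u' hu', hQQ' u' hu']
  have e4 := extDLoc_of_eq_pull hs hφ hu (α := fun _ => β) (differentiableAt_const β)
    (β := fun u' => pull (fderiv ℝ φ u').toLinearMap β) fun u' hu' => rfl
  refine key.trans ?_
  rw [key', e1, e2, e3, e4]
  simp only [contr_pull, hPP' u hu, hQQ' u hu, map_add, map_sub, map_smul]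

end Schouten

/-! ### Forms and multivector fields in charts -/

section Charts

variable {E : Type*} [NormedAddCommGroup E] [NormedSpace ℝ E]
  {M : Type*} [TopologicalSpace M] [ChartedSpace E M] [IsManifold 𝓘(ℝ, E) ∞ M]
  {e e' : OpenPartialHomeomorph M E}

theorem mdifferentiable_of_mem_maximalAtlas (he : e ∈ maximalAtlas 𝓘(ℝ, E) ∞ M) :
    e.MDifferentiable 𝓘(ℝ, E) 𝓘(ℝ, E) :=
  ⟨(contMDiffOn_of_mem_maximalAtlas he).mdifferentiableOn (by simp),
    (contMDiffOn_symm_of_mem_maximalAtlas he).mdifferentiableOn (by simp)⟩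

theorem tmap_symm_comp_tmap (he : e ∈ maximalAtlas 𝓘(ℝ, E) ∞ M) {z : M} (hz : z ∈ e.source) :
    tmap E E e.symm (e z) ∘ₗ tmap E E e z = LinearMap.id :=
  congrArg ContinuousLinearMap.toLinearMap
    ((mdifferentiable_of_mem_maximalAtlas he).symm_comp_deriv hz)

theorem tmap_comp_tmap_symm (he : e ∈ maximalAtlas 𝓘(ℝ, E) ∞ M) {u : E} (hu : u ∈ e.target) :
    tmap E E e (e.symm u) ∘ₗ tmap E E e.symm u = LinearMap.id :=
  congrArg ContinuousLinearMap.toLinearMap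
    ((mdifferentiable_of_mem_maximalAtlas he).comp_symm_deriv hu)

theorem contDiffOn_chart_change (he : e ∈ maximalAtlas 𝓘(ℝ, E) ∞ M)
    (he' : e' ∈ maximalAtlas 𝓘(ℝ, E) ∞ M) :
    ContDiffOn ℝ ∞ (e.symm.trans e') (e.symm.trans e').source := by
  rw [← contMDiffOn_iff_contDiffOn]
  exact (contMDiffOn_of_mem_maximalAtlas he').comp
    ((contMDiffOn_symm_of_mem_maximalAtlas he).mono fun u hu => hu.1) fun u hu => hu.2

theorem tmap_comp_tmap_symm_eq_fderiv (he : e ∈ maximalAtlas 𝓘(ℝ, E) ∞ M)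
    (he' : e' ∈ maximalAtlas 𝓘(ℝ, E) ∞ M) {u : E} (hu : u ∈ (e.symm.trans e').source) :
    tmap E E e' (e.symm u) ∘ₗ tmap E E e.symm u =
      (fderiv ℝ (e.symm.trans e') u).toLinearMap := by
  have h := mfderiv_comp u
    ((mdifferentiable_of_mem_maximalAtlas he').mdifferentiableAt (x := e.symm u) hu.2)
    ((mdifferentiable_of_mem_maximalAtlas he).mdifferentiableAt_symm hu.1)
  rw [mfderiv_eq_fderiv] at h
  exact (congrArg ContinuousLinearMap.toLinearMap h).symm

theorem formLoc_change (he : e ∈ maximalAtlas 𝓘(ℝ, E) ∞ M)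
    (he' : e' ∈ maximalAtlas 𝓘(ℝ, E) ∞ M) (α : M → Covec E) {u : E}
    (hu : u ∈ (e.symm.trans e').source) :
    formLoc α e u = pull (fderiv ℝ (e.symm.trans e') u).toLinearMap
      (formLoc α e' (e.symm.trans e' u)) := by
  have hu2 : e.symm u ∈ e'.source := hu.2
  change _ = pull _ (pull (tmap E E e'.symm (e' (e.symm u))) (α (e'.symm (e' (e.symm u)))))
  rw [← tmap_comp_tmap_symm_eq_fderiv he he' hu, e'.left_inv hu2, pull_comp_apply,
    ← LinearMap.comp_assoc, tmap_symm_comp_tmap he' hu2, LinearMap.id_comp]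
  rfl

theorem mvLoc_change (he : e ∈ maximalAtlas 𝓘(ℝ, E) ∞ M)
    (he' : e' ∈ maximalAtlas 𝓘(ℝ, E) ∞ M) (P : M → Multivec E) {u : E}
    (hu : u ∈ (e.symm.trans e').source) :
    push (fderiv ℝ (e.symm.trans e') u).toLinearMap (mvLoc P e u) =
      mvLoc P e' (e.symm.trans e' u) := by
  have hu2 : e.symm u ∈ e'.source := hu.2
  have h1 := tmap_symm_comp_tmap he (e.map_target hu.1)
  rw [e.right_inv hu.1] at h1
  change _ = push (tmap E E e' (e'.symm (e' (e.symm u)))) (P (e'.symm (e' (e.symm u))))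
  rw [← tmap_comp_tmap_symm_eq_fderiv he he' hu, e'.left_inv hu2, mvLoc, push_comp_apply,
    LinearMap.comp_assoc, h1, LinearMap.comp_id]

theorem pull_formLoc (he : e ∈ maximalAtlas 𝓘(ℝ, E) ∞ M) (α : M → Covec E) {z : M}
    (hz : z ∈ e.source) : pull (tmap E E e z) (formLoc α e (e z)) = α z := by
  rw [formLoc, e.left_inv hz, pull_comp_apply, tmap_symm_comp_tmap he hz, pull_id]

theorem formLoc_contr (he : e ∈ maximalAtlas 𝓘(ℝ, E) ∞ M) (P : M → Multivec E) (α : M → Covec E)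
    {u : E} (hu : u ∈ e.target) :
    formLoc (fun z => contr (P z) (α z)) e u = contr (mvLoc P e u) (formLoc α e u) := by
  have h1 := tmap_symm_comp_tmap he (e.map_target hu)
  rw [e.right_inv hu] at h1
  rw [formLoc, formLoc, contr_pull, mvLoc, push_comp_apply, h1, push_id]

end Charts

/-! ### Exterior calculus on manifolds -/

section Manifold

variable {E : Type*} [NormedAddCommGroup E] [NormedSpace ℝ E] [FiniteDimensional ℝ E]
  {M : Type*} [TopologicalSpace M] [ChartedSpace E M]
  {e : OpenPartialHomeomorph M E}

theorem smoothForm_iff {α : M → Covec E} : SmoothForm α ↔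
    ∀ z : M, ContDiffOn ℝ ∞ (formLoc α (chartAt E z)) (chartAt E z).target :=
  forall_congr' fun _ => smoothOnExt_iff

theorem smoothMV_iff {P : M → Multivec E} : SmoothMV P ↔
    ∀ z : M, ContDiffOn ℝ ∞ (mvLoc P (chartAt E z)) (chartAt E z).target :=
  forall_congr' fun _ => smoothOnExt_iff

theorem SmoothForm.add {α β : M → Covec E} (hα : SmoothForm α) (hβ : SmoothForm β) :
    SmoothForm fun z => α z + β z := by
  rw [smoothForm_iff] at *
  refine fun z => ((hα z).add (hβ z)).congr fun u _ => ?_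
  exact map_add (pull (tmap E E (chartAt E z).symm u)) _ _

theorem SmoothForm.const_smul (c : ℝ) {α : M → Covec E} (hα : SmoothForm α) :
    SmoothForm fun z => c • α z := by
  rw [smoothForm_iff] at *
  refine fun z => ((hα z).const_smul c).congr fun u _ => ?_
  exact map_smul (pull (tmap E E (chartAt E z).symm u)) _ _

theorem SmoothForm.sub {α β : M → Covec E} (hα : SmoothForm α) (hβ : SmoothForm β) :
    SmoothForm fun z => α z - β z := by
  rw [smoothForm_iff] at *
  refine fun z => ((hα z).sub (hβ z)).congr fun u _ => ?_
  exact map_sub (pull (tmap E E (chartAt E z).symm u)) _ _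

theorem smoothForm_zero : SmoothForm fun _ : M => (0 : Covec E) := by
  rw [smoothForm_iff]
  refine fun z => (contDiffOn_const (c := (0 : Covec E))).congr fun u _ => ?_
  exact map_zero (pull (tmap E E (chartAt E z).symm u))

theorem SmoothMV.add {P Q : M → Multivec E} (hP : SmoothMV P) (hQ : SmoothMV Q) :
    SmoothMV fun z => P z + Q z := by
  rw [smoothMV_iff] at *
  refine fun z => ((hP z).add (hQ z)).congr fun u _ => ?_
  exact map_add (push (tmap E E (chartAt E z) ((chartAt E z).symm u))) _ _

theorem SmoothMV.const_smul (c : ℝ) {P : M → Multivec E} (hP : SmoothMV P) :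
    SmoothMV fun z => c • P z := by
  rw [smoothMV_iff] at *
  refine fun z => ((hP z).const_smul c).congr fun u _ => ?_
  exact map_smul (push (tmap E E (chartAt E z) ((chartAt E z).symm u))) _ _

theorem SmoothMV.mul {P Q : M → Multivec E} (hP : SmoothMV P) (hQ : SmoothMV Q) :
    SmoothMV fun z => P z * Q z := by
  rw [smoothMV_iff] at *
  refine fun z => (contDiffOn_mul (hP z) (hQ z)).congr fun u _ => ?_
  exact map_mul (push (tmap E E (chartAt E z) ((chartAt E z).symm u))) _ _

theorem smoothMV_zero : SmoothMV fun _ : M => (0 : Multivec E) := by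
  rw [smoothMV_iff]
  refine fun z => (contDiffOn_const (c := (0 : Multivec E))).congr fun u _ => ?_
  exact map_zero (push (tmap E E (chartAt E z) ((chartAt E z).symm u)))

variable [IsManifold 𝓘(ℝ, E) ∞ M]

theorem chartAt_mem (z : M) : chartAt E z ∈ maximalAtlas 𝓘(ℝ, E) ∞ M :=
  IsManifold.chart_mem_maximalAtlas z

theorem SmoothForm.contDiffOn {α : M → Covec E} (hα : SmoothForm α)
    (he : e ∈ maximalAtlas 𝓘(ℝ, E) ∞ M) : ContDiffOn ℝ ∞ (formLoc α e) e.target := by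
  intro u hu
  refine ContDiffAt.contDiffWithinAt ?_
  set e' := chartAt E (e.symm u)
  have he' : e' ∈ maximalAtlas 𝓘(ℝ, E) ∞ M := chartAt_mem _
  have hus : u ∈ (e.symm.trans e').source := ⟨hu, mem_chart_source E (e.symm u)⟩
  have ho := (e.symm.trans e').open_source
  have hc := contDiffOn_chart_change he he'
  have h1 : ContDiffOn ℝ ∞ (formLoc α e') e'.target := smoothForm_iff.1 hα _
  have h2 : ContDiffOn ℝ ∞ (fun u => pull (fderiv ℝ (e.symm.trans e') u).toLinearMap
      (formLoc α e' (e.symm.trans e' u))) (e.symm.trans e').source :=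
    contDiffOn_pull_apply (hc.fderiv_of_isOpen ho (by simp))
      (h1.comp hc fun v hv => e'.map_source hv.2)
  exact (h2.congr fun v hv => formLoc_change he he' α hv).contDiffAt (ho.mem_nhds hus)

theorem SmoothMV.contDiffOn {P : M → Multivec E} (hP : SmoothMV P)
    (he : e ∈ maximalAtlas 𝓘(ℝ, E) ∞ M) : ContDiffOn ℝ ∞ (mvLoc P e) e.target := by
  intro u hu
  refine ContDiffAt.contDiffWithinAt ?_
  set e' := chartAt E (e.symm u)
  have he' : e' ∈ maximalAtlas 𝓘(ℝ, E) ∞ M := chartAt_mem _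
  have hus : u ∈ (e.symm.trans e').source := ⟨hu, mem_chart_source E (e.symm u)⟩
  have ho := (e.symm.trans e').open_source
  have hc := contDiffOn_chart_change he he'
  have hc' := contDiffOn_chart_change he' he
  have h1 : ContDiffOn ℝ ∞ (mvLoc P e') e'.target := smoothMV_iff.1 hP _
  have hm : ∀ v ∈ (e.symm.trans e').source,
      e.symm.trans e' v ∈ (e'.symm.trans e).source := fun v hv => by
    refine ⟨e'.map_source hv.2, ?_⟩
    change e'.symm (e' (e.symm v)) ∈ e.source
    have hv2 : e.symm v ∈ e'.source := hv.2
    rw [e'.left_inv hv2]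
    exact e.map_target hv.1
  have h2 : ContDiffOn ℝ ∞ (fun v => push
      (fderiv ℝ (e'.symm.trans e) (e.symm.trans e' v)).toLinearMap
      (mvLoc P e' (e.symm.trans e' v))) (e.symm.trans e').source :=
    contDiffOn_push_apply ((hc'.fderiv_of_isOpen (e'.symm.trans e).open_source (by simp)).comp hc
      hm) (h1.comp hc fun v hv => e'.map_source hv.2)
  refine (h2.congr fun v hv => ?_).contDiffAt (ho.mem_nhds hus)
  rw [mvLoc_change he' he P (hm v hv)]
  change _ = mvLoc P e (e (e'.symm (e' (e.symm v))))
  have hv2 : e.symm v ∈ e'.source := hv.2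
  rw [e'.left_inv hv2, e.right_inv hv.1]

/-- The exterior derivative can be computed in every chart. -/
theorem formLoc_extD {α : M → Covec E} (hα : SmoothForm α) (he : e ∈ maximalAtlas 𝓘(ℝ, E) ∞ M)
    {u : E} (hu : u ∈ e.target) : formLoc (extD α) e u = extDLoc (formLoc α e) u := by
  set e' := chartAt E (e.symm u) with hedef
  have he' : e' ∈ maximalAtlas 𝓘(ℝ, E) ∞ M := chartAt_mem _
  have hus : u ∈ (e.symm.trans e').source := ⟨hu, mem_chart_source E (e.symm u)⟩
  have hd : DifferentiableAt ℝ (formLoc α e') (e.symm.trans e' u) :=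
    ((hα.contDiffOn he').contDiffAt
      (e'.open_target.mem_nhds (e'.map_source hus.2))).differentiableAt (by simp)
  rw [extDLoc_of_eq_pull (e.symm.trans e').open_source (contDiffOn_chart_change he he') hus hd
    fun v hv => formLoc_change he he' α hv, ← tmap_comp_tmap_symm_eq_fderiv he he' hus,
    ← pull_comp_apply]
  rfl

theorem SmoothForm.extD {α : M → Covec E} (hα : SmoothForm α) : SmoothForm (extD α) := by
  rw [smoothForm_iff]
  exact fun z => (contDiffOn_extDLoc (chartAt E z).open_target
    (hα.contDiffOn (chartAt_mem z))).congr fun u hu => formLoc_extD hα (chartAt_mem z) hu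

theorem SmoothForm.contr {P : M → Multivec E} {α : M → Covec E} (hP : SmoothMV P)
    (hα : SmoothForm α) : SmoothForm fun z => contr (P z) (α z) := by
  rw [smoothForm_iff]
  exact fun z => (contDiffOn_contr (hP.contDiffOn (chartAt_mem z))
    (hα.contDiffOn (chartAt_mem z))).congr fun u hu => formLoc_contr (chartAt_mem z) P α hu

theorem SmoothForm.differentiableAt {α : M → Covec E} (hα : SmoothForm α) (z : M) :
    DifferentiableAt ℝ (formLoc α (chartAt E z)) (chartAt E z z) :=
  ((hα.contDiffOn (chartAt_mem z)).contDiffAt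
    ((chartAt E z).open_target.mem_nhds (mem_chart_target E z))).differentiableAt (by simp)

theorem SmoothMV.differentiableAt {P : M → Multivec E} (hP : SmoothMV P) (z : M) :
    DifferentiableAt ℝ (mvLoc P (chartAt E z)) (chartAt E z z) :=
  ((hP.contDiffOn (chartAt_mem z)).contDiffAt
    ((chartAt E z).open_target.mem_nhds (mem_chart_target E z))).differentiableAt (by simp)

omit [IsManifold 𝓘(ℝ, E) ∞ M] in
theorem eventually_mem_target (z : M) :
    ∀ᶠ u in nhds (chartAt E z z), u ∈ (chartAt E z).target :=
  (chartAt E z).open_target.mem_nhds (mem_chart_target E z)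

theorem extD_add {α β : M → Covec E} (hα : SmoothForm α) (hβ : SmoothForm β) (z : M) :
    extD (fun z => α z + β z) z = extD α z + extD β z := by
  have h : formLoc (fun z => α z + β z) (chartAt E z) =
      fun u => formLoc α (chartAt E z) u + formLoc β (chartAt E z) u :=
    funext fun u => map_add (pull (tmap E E (chartAt E z).symm u)) _ _
  rw [extD, h, extDLoc_add (hα.differentiableAt z) (hβ.differentiableAt z), map_add]
  rfl

theorem extD_const_smul (c : ℝ) {α : M → Covec E} (hα : SmoothForm α) (z : M) :
    extD (fun z => c • α z) z = c • extD α z := by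
  have h : formLoc (fun z => c • α z) (chartAt E z) =
      fun u => c • formLoc α (chartAt E z) u :=
    funext fun u => map_smul (pull (tmap E E (chartAt E z).symm u)) _ _
  rw [extD, h, extDLoc_const_smul c (hα.differentiableAt z), map_smul]
  rfl

theorem extD_sub {α β : M → Covec E} (hα : SmoothForm α) (hβ : SmoothForm β) (z : M) :
    extD (fun z => α z - β z) z = extD α z - extD β z := by
  have h := extD_add hα (hβ.const_smul (-1)) z
  rw [extD_const_smul (-1) hβ] at h
  simpa only [neg_smul, one_smul, ← sub_eq_add_neg] using h

theorem extD_zero (z : M) : extD (fun _ : M => (0 : Covec E)) z = 0 := by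
  have h := extD_const_smul 0 (smoothForm_zero (M := M) (E := E)) z
  simpa only [zero_smul] using h

theorem extD_extD {α : M → Covec E} (hα : SmoothForm α) (z : M) : extD (extD α) z = 0 := by
  rw [extD, extDLoc_congr ((eventually_mem_target z).mono fun u hu =>
    formLoc_extD hα (chartAt_mem z) hu), extDLoc_extDLoc ((hα.contDiffOn
      (chartAt_mem z)).contDiffAt (eventually_mem_target z)), map_zero]

theorem formLoc_mem_extPow {p : ℕ} {α : M → Covec E}
    (h : ∀ z, α z ∈ ⋀[ℝ]^p (Module.Dual ℝ E)) (e : OpenPartialHomeomorph M E) (u : E) :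
    formLoc α e u ∈ ⋀[ℝ]^p (Module.Dual ℝ E) := pull_mem_extPow _ (h _)

theorem mvLoc_mem_extPow {p : ℕ} {P : M → Multivec E}
    (h : ∀ z, P z ∈ ⋀[ℝ]^p E) (e : OpenPartialHomeomorph M E) (u : E) :
    mvLoc P e u ∈ ⋀[ℝ]^p E := push_mem_extPow _ (h _)

theorem extD_mem_extPow {p : ℕ} {α : M → Covec E} (h : ∀ z, α z ∈ ⋀[ℝ]^p (Module.Dual ℝ E))
    (z : M) : extD α z ∈ ⋀[ℝ]^(p + 1) (Module.Dual ℝ E) :=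
  pull_mem_extPow _ (extDLoc_mem_extPow (Filter.Eventually.of_forall (formLoc_mem_extPow h _)))

/-- The Schouten–Nijenhuis bracket can be computed in every chart. -/
theorem mvLoc_schouten {a b : ℕ} (hab : a + b ≠ 0) {P Q : M → Multivec E} (hP : SmoothMV P)
    (hQ : SmoothMV Q) (hPa : ∀ z, P z ∈ ⋀[ℝ]^a E) (hQb : ∀ z, Q z ∈ ⋀[ℝ]^b E)
    (he : e ∈ maximalAtlas 𝓘(ℝ, E) ∞ M) {u : E} (hu : u ∈ e.target) :
    mvLoc (schouten P Q) e u = schoutenLoc (mvLoc P e) (mvLoc Q e) u := by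
  set z := e.symm u with hz
  set e' := chartAt E z with hedef
  have he' : e' ∈ maximalAtlas 𝓘(ℝ, E) ∞ M := chartAt_mem _
  have hze : z ∈ e.source := e.map_target hu
  have hze' : z ∈ e'.source := mem_chart_source E z
  have hv : e' z ∈ (e'.symm.trans e).source := ⟨e'.map_source hze', by
    change e'.symm (e' z) ∈ e.source
    rwa [e'.left_inv hze']⟩
  have hvu : e'.symm.trans e (e' z) = u := by
    change e (e'.symm (e' z)) = u
    rw [e'.left_inv hze', hz, e.right_inv hu]
  have hsub : (e'.symm.trans e).source ⊆ e'.target := fun v hv => hv.1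
  have hPd : DifferentiableAt ℝ (mvLoc P e) u := ((hP.contDiffOn he).contDiffAt
    (e.open_target.mem_nhds hu)).differentiableAt (by simp)
  have hQd : DifferentiableAt ℝ (mvLoc Q e) u := ((hQ.contDiffOn he).contDiffAt
    (e.open_target.mem_nhds hu)).differentiableAt (by simp)
  have hS : (fderiv ℝ (e'.symm.trans e) (e' z)).toLinearMap ∘ₗ
      (tmap E E e' z ∘ₗ tmap E E e.symm u) = LinearMap.id := by
    rw [← tmap_comp_tmap_symm_eq_fderiv he' he hv, e'.left_inv hze', LinearMap.comp_assoc,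
      ← LinearMap.comp_assoc (tmap E E e.symm u), tmap_symm_comp_tmap he' hze',
      LinearMap.id_comp, hz, tmap_comp_tmap_symm he hu]
  have key := push_schoutenLoc (e'.symm.trans e).open_source (contDiffOn_chart_change he' he) hab
    hv ((hP.contDiffOn he').mono hsub) ((hQ.contDiffOn he').mono hsub)
    (P := mvLoc P e) (Q := mvLoc Q e) (by rwa [hvu]) (by rwa [hvu])
    (Filter.Eventually.of_forall (mvLoc_mem_extPow hPa _))
    (Filter.Eventually.of_forall (mvLoc_mem_extPow hQb _))
    (fun v _ => mvLoc_mem_extPow hPa _ v) (fun v _ => mvLoc_mem_extPow hQb _ v)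
    (fun v hv => mvLoc_change he' he P hv) (fun v hv => mvLoc_change he' he Q hv) hS
  rw [hvu, ← tmap_comp_tmap_symm_eq_fderiv he' he hv, e'.left_inv hze', ← push_comp_apply] at key
  exact key

theorem SmoothMV.schouten {a b : ℕ} (hab : a + b ≠ 0) {P Q : M → Multivec E} (hP : SmoothMV P)
    (hQ : SmoothMV Q) (hPa : ∀ z, P z ∈ ⋀[ℝ]^a E) (hQb : ∀ z, Q z ∈ ⋀[ℝ]^b E) :
    SmoothMV (schouten P Q) := by
  rw [smoothMV_iff]
  exact fun z => (contDiffOn_schoutenLoc (chartAt E z).open_target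
    (hP.contDiffOn (chartAt_mem z)) (hQ.contDiffOn (chartAt_mem z))).congr
      fun u hu => mvLoc_schouten hab hP hQ hPa hQb (chartAt_mem z) hu

theorem schouten_mem_extPow {a b c : ℕ} (hc : c + 1 = a + b) {P Q : M → Multivec E}
    (hPa : ∀ z, P z ∈ ⋀[ℝ]^a E) (hQb : ∀ z, Q z ∈ ⋀[ℝ]^b E) (z : M) :
    schouten P Q z ∈ ⋀[ℝ]^c E :=
  push_mem_extPow _ (schoutenLoc_mem_extPow hc
    (Filter.Eventually.of_forall (mvLoc_mem_extPow hPa _))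
    (Filter.Eventually.of_forall (mvLoc_mem_extPow hQb _)))

/-- Cartan's formula for the Schouten–Nijenhuis bracket on a manifold. -/
theorem contr_schouten {a b : ℕ} {P Q : M → Multivec E} {α : M → Covec E} (hP : SmoothMV P)
    (hQ : SmoothMV Q) (hα : SmoothForm α) (hPa : ∀ z, P z ∈ ⋀[ℝ]^a E)
    (hQb : ∀ z, Q z ∈ ⋀[ℝ]^b E) (z : M) :
    contr (schouten P Q z) (α z) =
      contr (P z) (extD (fun z => contr (Q z) (α z)) z) -
      (-1 : ℝ) ^ a • extD (fun z => contr (P z) (contr (Q z) (α z))) z -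
      (-1 : ℝ) ^ ((a + 1) * b) • contr (Q z) (contr (P z) (extD α z)) +
      (-1 : ℝ) ^ ((a + 1) * b + a) • contr (Q z) (extD (fun z => contr (P z) (α z)) z) := by
  have he : chartAt E z ∈ maximalAtlas 𝓘(ℝ, E) ∞ M := chartAt_mem z
  have hz := mem_chart_source E z
  have hu := mem_chart_target E z
  have hTS : tmap E E (chartAt E z) z ∘ₗ tmap E E (chartAt E z).symm (chartAt E z z) =
      LinearMap.id := by
    have := tmap_comp_tmap_symm he hu
    rwa [(chartAt E z).left_inv hz] at this
  have hmv : ∀ R : M → Multivec E, push (tmap E E (chartAt E z) z) (R z) =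
      mvLoc R (chartAt E z) (chartAt E z z) := fun R => by
    rw [mvLoc, (chartAt E z).left_inv hz]
  have e1 : ∀ (R : M → Multivec E) (β : M → Covec E),
      extD (fun z => contr (R z) (β z)) z = pull (tmap E E (chartAt E z) z)
        (extDLoc (fun u => contr (mvLoc R (chartAt E z) u) (formLoc β (chartAt E z) u))
          (chartAt E z z)) := fun R β => by
    rw [extD]
    congr 1
    exact extDLoc_congr ((eventually_mem_target z).mono fun u hu => formLoc_contr he R β hu)
  have e2 : extD (fun z => contr (P z) (contr (Q z) (α z))) z = pull (tmap E E (chartAt E z) z)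
        (extDLoc (fun u => contr (mvLoc P (chartAt E z) u) (contr (mvLoc Q (chartAt E z) u)
          (formLoc α (chartAt E z) u))) (chartAt E z z)) := by
    rw [e1 P fun z => contr (Q z) (α z)]
    congr 1
    refine extDLoc_congr ((eventually_mem_target z).mono fun u hu => ?_)
    exact congrArg _ (formLoc_contr he Q α hu)
  have key := contr_schoutenLoc (hP.differentiableAt z) (hQ.differentiableAt z)
    (hα.differentiableAt z) (Filter.Eventually.of_forall (mvLoc_mem_extPow hPa _))
    (Filter.Eventually.of_forall (mvLoc_mem_extPow hQb _))
  have h0 : contr (schouten P Q z) (α z) = pull (tmap E E (chartAt E z) z)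
      (contr (schoutenLoc (mvLoc P (chartAt E z)) (mvLoc Q (chartAt E z)) (chartAt E z z))
        (formLoc α (chartAt E z) (chartAt E z z))) := by
    conv_lhs => rw [← pull_formLoc he α hz, contr_pull, schouten, push_comp_apply, hTS, push_id]
  rw [h0, key, e1 Q α, e1 P α, e2, extD, contr_pull, contr_pull, contr_pull, contr_pull, hmv, hmv]
  simp only [map_add, map_sub, map_smul]

/-! ### Adapted charts -/

/-- The distribution `V` is constant in the preferred charts: in the chart at `z₀` it is a fixed
subspace `W` of the model space. -/
def IsAdapted (V : M → Submodule ℝ E) : Prop :=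
  ∀ z₀ : M, ∃ W : Submodule ℝ E, ∀ z ∈ (chartAt E z₀).source,
    V z = W.comap (tmap E E (chartAt E z₀) z)

variable {V : M → Submodule ℝ E}

omit [FiniteDimensional ℝ E] in
theorem formLoc_mem_annBy {W : Submodule ℝ E} (he : e ∈ maximalAtlas 𝓘(ℝ, E) ∞ M)
    (hW : ∀ z ∈ e.source, V z = W.comap (tmap E E e z)) {k : ℕ} {α : M → Covec E} {u : E}
    (hu : u ∈ e.target) (h : α (e.symm u) ∈ annBy (V (e.symm u)) k) :
    formLoc α e u ∈ annBy W k := by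
  refine pull_mem_annBy ?_ k h
  rw [hW _ (e.map_target hu), ← Submodule.comap_comp, tmap_comp_tmap_symm he hu]
  exact le_of_eq (Submodule.comap_id _).symm

/-- The exterior derivative raises the filtration `annBy` by one: in an adapted chart, `annBy` is
a constant subspace, and every differential `dxⁱ` raises the filtration by one. -/
theorem IsAdapted.extD_mem_annBy (hV : IsAdapted V) {k : ℕ} {α : M → Covec E}
    (h : ∀ z, α z ∈ annBy (V z) k) (z : M) : extD α z ∈ annBy (V z) (k + 1) := by
  obtain ⟨W, hW⟩ := hV z
  exact pull_mem_annBy (le_of_eq (hW z (mem_chart_source E z))) _ (extDLoc_mem_annBy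
    ((eventually_mem_target z).mono fun u hu => formLoc_mem_annBy (chartAt_mem z) hW hu (h _)))

theorem IsAdapted.isVertical_schouten (hV : IsAdapted V) {b : ℕ} {P Q : M → Multivec E}
    (hQb : ∀ z, Q z ∈ ⋀[ℝ]^b E) (hP : ∀ z, IsVertical (V z) (P z))
    (hQ : ∀ z, IsVertical (V z) (Q z)) (z : M) : IsVertical (V z) (schouten P Q z) := by
  obtain ⟨W, hW⟩ := hV z
  have he : chartAt E z ∈ maximalAtlas 𝓘(ℝ, E) ∞ M := chartAt_mem z
  have hz := mem_chart_source E z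
  have hu := mem_chart_target E z
  have hvert : ∀ R : M → Multivec E, (∀ z, IsVertical (V z) (R z)) →
      ∀ u ∈ (chartAt E z).target, IsVertical W (mvLoc R (chartAt E z) u) := fun R hR u hu => by
    have h1 := tmap_symm_comp_tmap he ((chartAt E z).map_target hu)
    rw [(chartAt E z).right_inv hu] at h1
    exact (hR _).push h1 (tmap_comp_tmap_symm he hu)
      (le_of_eq (hW _ ((chartAt E z).map_target hu)))
  have hTS : tmap E E (chartAt E z) z ∘ₗ tmap E E (chartAt E z).symm (chartAt E z z) =
      LinearMap.id := by
    have := tmap_comp_tmap_symm he hu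
    rwa [(chartAt E z).left_inv hz] at this
  refine (isVertical_schoutenLoc (W := W) (Filter.Eventually.of_forall (mvLoc_mem_extPow hQb _))
    ((eventually_mem_target z).mono (hvert P hP))
    ((eventually_mem_target z).mono (hvert Q hQ))).push hTS (tmap_symm_comp_tmap he hz) ?_
  rw [hW z hz, ← Submodule.comap_comp, hTS]
  exact le_of_eq (Submodule.comap_id _).symm

end Manifold

/-! ### Partitions of unity -/

section Globalization

variable {E : Type*} [NormedAddCommGroup E] [NormedSpace ℝ E] [FiniteDimensional ℝ E]
  {M : Type*} [TopologicalSpace M] [ChartedSpace E M] [IsManifold 𝓘(ℝ, E) ∞ M]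

/-- A multivector field that is smooth in the chart `e'` is smooth in the chart `e`. -/
theorem contMDiffAt_push_tmap {e e' : OpenPartialHomeomorph M E}
    (he : e ∈ maximalAtlas 𝓘(ℝ, E) ∞ M) (he' : e' ∈ maximalAtlas 𝓘(ℝ, E) ∞ M)
    {A : E → Multivec E} (hA : ContDiffOn ℝ ∞ A e'.target) {z : M} (hz : z ∈ e.source)
    (hz' : z ∈ e'.source) :
    ContMDiffAt 𝓘(ℝ, E) 𝓘(ℝ, Multivec E) ∞
      (fun y => push (tmap E E e y) (push (tmap E E e'.symm (e' y)) (A (e' y)))) z := by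
  have hc := contDiffOn_chart_change he' he
  have ho := (e'.symm.trans e).open_source
  have hmem : ∀ y ∈ e.source, y ∈ e'.source → e' y ∈ (e'.symm.trans e).source :=
    fun y hy hy' => ⟨e'.map_source hy', by
      change e'.symm (e' y) ∈ e.source
      rwa [e'.left_inv hy']⟩
  have h1 : ContDiffOn ℝ ∞ (fun u => push (fderiv ℝ (e'.symm.trans e) u).toLinearMap (A u))
      (e'.symm.trans e).source :=
    contDiffOn_push_apply (hc.fderiv_of_isOpen ho (by simp)) (hA.mono fun u hu => hu.1)
  have h2 := (h1.contDiffAt (ho.mem_nhds (hmem z hz hz'))).contMDiffAt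
  have h3 : ContMDiffAt 𝓘(ℝ, E) 𝓘(ℝ, E) ∞ e' z :=
    (contMDiffOn_of_mem_maximalAtlas he').contMDiffAt (e'.open_source.mem_nhds hz')
  refine (h2.comp z h3).congr_of_eventuallyEq ?_
  filter_upwards [e.open_source.mem_nhds hz, e'.open_source.mem_nhds hz'] with y hy hy'
  have h4 := tmap_comp_tmap_symm_eq_fderiv he' he (hmem y hy hy')
  rw [e'.left_inv hy'] at h4
  rw [push_comp_apply, h4]
  rfl

/-- Multivector fields with prescribed interior products with a form can be glued by a partition of
unity, as they are a convex set at every point. -/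
theorem exists_smoothMV_of_local [T2Space M] [SigmaCompactSpace M] {k : ℕ} {η F : M → Covec E}
    (h : ∀ z : M, ∃ A : E → Multivec E, ContDiffOn ℝ ∞ A (chartAt E z).target ∧
      ∀ u ∈ (chartAt E z).target, A u ∈ ⋀[ℝ]^k E ∧
        contr (A u) (formLoc η (chartAt E z) u) = formLoc F (chartAt E z) u) :
    ∃ A : M → Multivec E, SmoothMV A ∧ (∀ z, A z ∈ ⋀[ℝ]^k E) ∧
      ∀ z, contr (A z) (η z) = F z := by
  choose A hA hA' using h
  obtain ⟨f, hf⟩ := SmoothPartitionOfUnity.exists_isSubordinate_chartAt_source 𝓘(ℝ, E) M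
  let B : M → M → Multivec E := fun i z =>
    push (tmap E E (chartAt E i).symm (chartAt E i z)) (A i (chartAt E i z))
  have hB : ∀ i, ∀ z ∈ (chartAt E i).source,
      B i z ∈ {X : Multivec E | X ∈ ⋀[ℝ]^k E ∧ contr X (η z) = F z} := by
    intro i z hz
    have hu := (chartAt E i).map_source hz
    obtain ⟨h1, h2⟩ := hA' i _ hu
    refine ⟨push_mem_extPow _ h1, ?_⟩
    have hTS := tmap_comp_tmap_symm (chartAt_mem (E := E) i) hu
    rw [(chartAt E i).left_inv hz] at hTS
    rw [← pull_formLoc (chartAt_mem i) η hz, contr_pull, push_comp_apply, hTS, push_id, h2,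
      pull_formLoc (chartAt_mem i) F hz]
  have hconv : ∀ z, Convex ℝ {X : Multivec E | X ∈ ⋀[ℝ]^k E ∧ contr X (η z) = F z} := by
    rintro z X ⟨hX, hX'⟩ Y ⟨hY, hY'⟩ a b _ _ hab
    refine ⟨add_mem (Submodule.smul_mem _ _ hX) (Submodule.smul_mem _ _ hY), ?_⟩
    rw [map_add, map_smul, map_smul, LinearMap.add_apply, LinearMap.smul_apply,
      LinearMap.smul_apply, hX', hY', ← add_smul, hab, one_smul]
  have hval : ∀ z, ∑ᶠ i, f i z • B i z ∈
      {X : Multivec E | X ∈ ⋀[ℝ]^k E ∧ contr X (η z) = F z} := fun z =>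
    f.finsum_smul_mem_convex (Set.mem_univ z) (fun i hi =>
      hB i z (hf i (subset_tsupport _ hi))) (hconv z)
  refine ⟨fun z => ∑ᶠ i, f i z • B i z, ?_, fun z => (hval z).1, fun z => (hval z).2⟩
  rw [smoothMV_iff]
  intro z₁ u hu
  refine ContDiffAt.contDiffWithinAt ?_
  set e := chartAt E z₁ with he
  have h1 : ContMDiffAt 𝓘(ℝ, E) 𝓘(ℝ, Multivec E) ∞
      (fun z => ∑ᶠ i, f i z • push (tmap E E e z) (B i z)) (e.symm u) :=
    f.contMDiffAt_finsum fun i hi => contMDiffAt_push_tmap (chartAt_mem z₁) (chartAt_mem i) (hA i)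
      (e.map_target hu) (hf i hi)
  have h2 : ContMDiffAt 𝓘(ℝ, E) 𝓘(ℝ, E) ∞ e.symm u :=
    (contMDiffOn_symm_of_mem_maximalAtlas (chartAt_mem z₁)).contMDiffAt (e.open_target.mem_nhds hu)
  refine ((h1.comp u h2).contDiffAt).congr_of_eventuallyEq (Filter.Eventually.of_forall fun v => ?_)
  have hfin : (Function.support fun i => f i (e.symm v) • B i (e.symm v)).Finite :=
    (f.locallyFinite.point_finite (e.symm v)).subset fun i hi h0 => hi (by
      have h0' : f i (e.symm v) = 0 := h0
      simp only [h0', zero_smul])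
  refine ((push (tmap E E e (e.symm v))).toLinearMap.toAddMonoidHom.map_finsum hfin).trans ?_
  exact finsum_congr fun i => map_smul (push (tmap E E e (e.symm v))) _ _

end Globalization

/-! ### Geometry of the phase space -/

section PhaseSpaceGeometry

variable {EX EY EF : Type*}
  [NormedAddCommGroup EX] [NormedSpace ℝ EX] [FiniteDimensional ℝ EX]
  [NormedAddCommGroup EY] [NormedSpace ℝ EY] [FiniteDimensional ℝ EY]
  [NormedAddCommGroup EF] [NormedSpace ℝ EF] [FiniteDimensional ℝ EF]

/-- The projection of the coordinate space of the phase space to the coordinates `(x, y)`. -/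
def baseProj (EX EF : Type*) [NormedAddCommGroup EX] [NormedSpace ℝ EX]
    [NormedAddCommGroup EF] [NormedSpace ℝ EF] : PhaseModel EX EF →L[ℝ] BaseModel EX EF :=
  (ContinuousLinearMap.fst ℝ (BaseModel EX EF) (Fin (fibreDim EX EF) → ℝ)).comp
    (PhaseModel.equivProd EX EF : PhaseModel EX EF →L[ℝ] _)

/-- The projection of the coordinate space of the phase space to the coordinates `x`. -/
def xProj (EX EF : Type*) [NormedAddCommGroup EX] [NormedSpace ℝ EX]
    [NormedAddCommGroup EF] [NormedSpace ℝ EF] : PhaseModel EX EF →L[ℝ] EX :=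
  (BaseModel.fst EX EF).comp (baseProj EX EF)

/-- The inclusion `x ↦ (x, 0)` of the coordinates `x` in the coordinate space of the phase
space. -/
def xIncl (EX EF : Type*) [NormedAddCommGroup EX] [NormedSpace ℝ EX]
    [NormedAddCommGroup EF] [NormedSpace ℝ EF] : EX →L[ℝ] PhaseModel EX EF :=
  ((PhaseModel.equivProd EX EF).symm : _ →L[ℝ] PhaseModel EX EF).comp
    ((ContinuousLinearMap.inl ℝ (BaseModel EX EF) (Fin (fibreDim EX EF) → ℝ)).comp
      (((BaseModel.equivProd EX EF).symm : _ →L[ℝ] BaseModel EX EF).comp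
        (ContinuousLinearMap.inl ℝ EX EF)))

omit [FiniteDimensional ℝ EX] [FiniteDimensional ℝ EF] in
theorem xProj_comp_xIncl :
    (xProj EX EF).toLinearMap ∘ₗ (xIncl EX EF).toLinearMap = LinearMap.id := rfl

variable {X : Type*} [TopologicalSpace X] [ChartedSpace EX X]
  {Y : Type*} [TopologicalSpace Y] [ChartedSpace EY Y]
  {π : Y → X} {hπ : IsFibered EX EY EF π}

/-- The fibered chart of `Y` that induces the preferred chart of the phase space at `z₀`. -/
def fiberedChartAt (z₀ : PhaseSpace hπ) : OpenPartialHomeomorph Y (BaseModel EX EF) :=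
  (exists_fiberedChart hπ z₀.base).choose

theorem isFiberedChart_fiberedChartAt (z₀ : PhaseSpace hπ) :
    IsFiberedChart EX EY EF π (fiberedChartAt z₀) :=
  (exists_fiberedChart hπ z₀.base).choose_spec.1

theorem mem_chartAt_source_iff {z₀ z : PhaseSpace hπ} :
    z ∈ (chartAt (PhaseModel EX EF) z₀).source ↔ z.base ∈ (fiberedChartAt z₀).source := Iff.rfl

theorem contMDiff_base : ContMDiff 𝓘(ℝ, PhaseModel EX EF) 𝓘(ℝ, EY) ∞
    (fun z : PhaseSpace hπ => z.base) := by
  intro z₀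
  have hc := isFiberedChart_fiberedChartAt z₀
  have h1 : ContMDiffOn 𝓘(ℝ, PhaseModel EX EF) 𝓘(ℝ, PhaseModel EX EF) ∞
      (chartAt (PhaseModel EX EF) z₀) (chartAt (PhaseModel EX EF) z₀).source :=
    contMDiffOn_of_mem_maximalAtlas (chartAt_mem z₀)
  have h2 : ContMDiff 𝓘(ℝ, PhaseModel EX EF) 𝓘(ℝ, BaseModel EX EF) ∞ (baseProj EX EF) :=
    (baseProj EX EF).contDiff.contMDiff
  have h3 := hc.smooth_symm.comp (h2.comp_contMDiffOn h1) fun z hz =>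
    (fiberedChartAt z₀).map_source (mem_chartAt_source_iff.1 hz)
  refine (h3.contMDiffAt ((chartAt (PhaseModel EX EF) z₀).open_source.mem_nhds
    (mem_chart_source _ z₀))).congr_of_eventuallyEq ?_
  filter_upwards [(chartAt (PhaseModel EX EF) z₀).open_source.mem_nhds
    (mem_chart_source _ z₀)] with z hz
  exact ((fiberedChartAt z₀).left_inv (mem_chartAt_source_iff.1 hz)).symm

variable [IsManifold 𝓘(ℝ, EX) ∞ X] [IsManifold 𝓘(ℝ, EY) ∞ Y]

theorem contMDiff_proj : ContMDiff 𝓘(ℝ, PhaseModel EX EF) 𝓘(ℝ, EX) ∞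
    (fun z : PhaseSpace hπ => π z.base) :=
  hπ.contMDiff.comp contMDiff_base

/-- In the preferred charts of the phase space, the projection to `X` is the linear projection
`xProj`, for a suitable chart of `X`. -/
theorem exists_xChart (z₀ : PhaseSpace hπ) : ∃ ψ ∈ maximalAtlas 𝓘(ℝ, EX) ∞ X,
    ∀ z ∈ (chartAt (PhaseModel EX EF) z₀).source, π z.base ∈ ψ.source ∧
      xProj EX EF (chartAt (PhaseModel EX EF) z₀ z) = ψ (π z.base) := by
  obtain ⟨ψ, hψ, h⟩ := (isFiberedChart_fiberedChartAt z₀).fibered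
  exact ⟨ψ, hψ, fun z hz => h z.base hz⟩

section

variable {z₀ : PhaseSpace hπ} {ψ : OpenPartialHomeomorph X EX}

theorem tmap_comp_tmap_proj (hψ : ψ ∈ maximalAtlas 𝓘(ℝ, EX) ∞ X)
    (h : ∀ z ∈ (chartAt (PhaseModel EX EF) z₀).source, π z.base ∈ ψ.source ∧
      xProj EX EF (chartAt (PhaseModel EX EF) z₀ z) = ψ (π z.base))
    {z : PhaseSpace hπ} (hz : z ∈ (chartAt (PhaseModel EX EF) z₀).source) :
    tmap EX EX ψ (π z.base) ∘ₗ
        tmap (PhaseModel EX EF) EX (fun z : PhaseSpace hπ => π z.base) z =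
      (xProj EX EF).toLinearMap ∘ₗ
        tmap (PhaseModel EX EF) (PhaseModel EX EF) (chartAt (PhaseModel EX EF) z₀) z := by
  have hψd := (mdifferentiable_of_mem_maximalAtlas hψ).mdifferentiableAt (h z hz).1
  have hed := (mdifferentiable_of_mem_maximalAtlas (chartAt_mem z₀)).mdifferentiableAt hz
  have hpd : MDifferentiableAt 𝓘(ℝ, PhaseModel EX EF) 𝓘(ℝ, EX)
      (fun z : PhaseSpace hπ => π z.base) z := contMDiff_proj.mdifferentiable (by simp) z
  have hfst : MDifferentiableAt 𝓘(ℝ, PhaseModel EX EF) 𝓘(ℝ, EX)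
      (xProj EX EF) (chartAt (PhaseModel EX EF) z₀ z) :=
    (ContinuousLinearMap.differentiableAt _).mdifferentiableAt
  have e1 := mfderiv_comp z hψd hpd
  have e2 := mfderiv_comp z hfst hed
  have e3 : mfderiv 𝓘(ℝ, PhaseModel EX EF) 𝓘(ℝ, EX) (ψ ∘ fun z : PhaseSpace hπ => π z.base) z =
      mfderiv 𝓘(ℝ, PhaseModel EX EF) 𝓘(ℝ, EX)
        (xProj EX EF ∘ chartAt (PhaseModel EX EF) z₀) z := by
    apply Filter.EventuallyEq.mfderiv_eq
    filter_upwards [(chartAt (PhaseModel EX EF) z₀).open_source.mem_nhds hz] with y hy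
    exact (h y hy).2.symm
  rw [e1, e2, ContinuousLinearMap.mfderiv_eq] at e3
  exact congrArg ContinuousLinearMap.toLinearMap e3

theorem tmap_proj_comp_tmap_symm (hψ : ψ ∈ maximalAtlas 𝓘(ℝ, EX) ∞ X)
    (h : ∀ z ∈ (chartAt (PhaseModel EX EF) z₀).source, π z.base ∈ ψ.source ∧
      xProj EX EF (chartAt (PhaseModel EX EF) z₀ z) = ψ (π z.base))
    {u : PhaseModel EX EF} (hu : u ∈ (chartAt (PhaseModel EX EF) z₀).target) :
    tmap (PhaseModel EX EF) EX (fun z : PhaseSpace hπ => π z.base)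
        ((chartAt (PhaseModel EX EF) z₀).symm u) ∘ₗ
        tmap (PhaseModel EX EF) (PhaseModel EX EF) (chartAt (PhaseModel EX EF) z₀).symm u =
      tmap EX EX ψ.symm (xProj EX EF u) ∘ₗ (xProj EX EF).toLinearMap := by
  have hz := (chartAt (PhaseModel EX EF) z₀).map_target hu
  have h1 := tmap_comp_tmap_proj hψ h hz
  have h2 := tmap_symm_comp_tmap hψ (h _ hz).1
  have h3 := tmap_comp_tmap_symm (chartAt_mem z₀) hu
  have h4 := (h _ hz).2
  rw [(chartAt (PhaseModel EX EF) z₀).right_inv hu] at h4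
  rw [← h4] at h2
  refine LinearMap.ext fun v => ?_
  have a1 := DFunLike.congr_fun h1 (tmap (PhaseModel EX EF) (PhaseModel EX EF)
    (chartAt (PhaseModel EX EF) z₀).symm u v)
  have a2 := fun y => DFunLike.congr_fun h2 y
  have a3 := DFunLike.congr_fun h3 v
  simp only [LinearMap.comp_apply, LinearMap.id_apply] at a1 a2 a3 ⊢
  rw [a3] at a1
  rw [← a1, a2]

/-- In the preferred charts of the phase space, the vertical space is the kernel of `xProj`. -/
theorem vertZ_eq_comap (hψ : ψ ∈ maximalAtlas 𝓘(ℝ, EX) ∞ X)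
    (h : ∀ z ∈ (chartAt (PhaseModel EX EF) z₀).source, π z.base ∈ ψ.source ∧
      xProj EX EF (chartAt (PhaseModel EX EF) z₀ z) = ψ (π z.base))
    {z : PhaseSpace hπ} (hz : z ∈ (chartAt (PhaseModel EX EF) z₀).source) :
    vertZ hπ z = (LinearMap.ker (xProj EX EF).toLinearMap).comap
      (tmap (PhaseModel EX EF) (PhaseModel EX EF) (chartAt (PhaseModel EX EF) z₀) z) := by
  have h1 := tmap_comp_tmap_proj hψ h hz
  have h2 := tmap_symm_comp_tmap hψ (h _ hz).1
  rw [← LinearMap.ker_comp, ← h1, LinearMap.ker_comp_of_ker_eq_bot]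
  · rfl
  · exact LinearMap.ker_eq_bot_of_inverse h2

theorem formLoc_liftX (hψ : ψ ∈ maximalAtlas 𝓘(ℝ, EX) ∞ X)
    (h : ∀ z ∈ (chartAt (PhaseModel EX EF) z₀).source, π z.base ∈ ψ.source ∧
      xProj EX EF (chartAt (PhaseModel EX EF) z₀ z) = ψ (π z.base)) (w : X → Covec EX)
    {u : PhaseModel EX EF} (hu : u ∈ (chartAt (PhaseModel EX EF) z₀).target) :
    formLoc (liftX hπ w) (chartAt (PhaseModel EX EF) z₀) u =
      pull (xProj EX EF).toLinearMap (formLoc w ψ (xProj EX EF u)) := by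
  have hz := (chartAt (PhaseModel EX EF) z₀).map_target hu
  have h4 := (h _ hz).2
  rw [(chartAt (PhaseModel EX EF) z₀).right_inv hu] at h4
  rw [formLoc, liftX, pull_comp_apply, tmap_proj_comp_tmap_symm hψ h hu, formLoc, pull_comp_apply,
    h4, ψ.left_inv (h _ hz).1]

theorem xProj_mem_target (h : ∀ z ∈ (chartAt (PhaseModel EX EF) z₀).source, π z.base ∈ ψ.source ∧
      xProj EX EF (chartAt (PhaseModel EX EF) z₀ z) = ψ (π z.base))
    {u : PhaseModel EX EF} (hu : u ∈ (chartAt (PhaseModel EX EF) z₀).target) :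
    xProj EX EF u ∈ ψ.target := by
  have hz := (chartAt (PhaseModel EX EF) z₀).map_target hu
  have h4 := (h _ hz).2
  rw [(chartAt (PhaseModel EX EF) z₀).right_inv hu] at h4
  rw [h4]
  exact ψ.map_source (h _ hz).1

end

theorem isAdapted_vertZ : IsAdapted (vertZ hπ) := fun z₀ => by
  obtain ⟨ψ, hψ, h⟩ := exists_xChart z₀
  exact ⟨_, fun z hz => vertZ_eq_comap hψ h hz⟩

theorem liftX_mem_horizontal (w : X → Covec EX) (z : PhaseSpace hπ) :
    liftX hπ w z ∈ horizontal (vertZ hπ z) := by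
  rw [mem_horizontal]
  intro v hv
  have hv' : tmap (PhaseModel EX EF) EX (fun z : PhaseSpace hπ => π z.base) z v = 0 := hv
  rw [liftX, contr_ι_pull, hv']
  simp

theorem liftX_mem_extPow {p : ℕ} {w : X → Covec EX} (hw : ∀ x, w x ∈ ⋀[ℝ]^p (Module.Dual ℝ EX))
    (z : PhaseSpace hπ) : liftX hπ w z ∈ ⋀[ℝ]^p (Module.Dual ℝ (PhaseModel EX EF)) :=
  pull_mem_extPow _ (hw _)

theorem smoothForm_liftX {w : X → Covec EX} (hw : SmoothForm w) : SmoothForm (liftX hπ w) := by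
  rw [smoothForm_iff]
  intro z₀
  obtain ⟨ψ, hψ, h⟩ := exists_xChart z₀
  have h1 : ContDiffOn ℝ ∞ (fun u => formLoc w ψ (xProj EX EF u))
      (chartAt (PhaseModel EX EF) z₀).target :=
    (hw.contDiffOn hψ).comp (xProj EX EF).contDiff.contDiffOn fun u hu => xProj_mem_target h hu
  refine (contDiffOn_linear_comp (pull (xProj EX EF).toLinearMap).toLinearMap h1).congr ?_
  exact fun u hu => formLoc_liftX hψ h w hu

/-- The pullback of a form of top degree is closed. -/
theorem extD_liftX {w : X → Covec EX} (hw : SmoothForm w)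
    (hwn : ∀ x, w x ∈ ⋀[ℝ]^(Module.finrank ℝ EX) (Module.Dual ℝ EX)) (z : PhaseSpace hπ) :
    extD (liftX hπ w) z = 0 := by
  obtain ⟨ψ, hψ, h⟩ := exists_xChart z
  have hu := (chartAt (PhaseModel EX EF) z).map_source (mem_chart_source _ z)
  have hd := ((hw.contDiffOn hψ).contDiffAt (ψ.open_target.mem_nhds (xProj_mem_target h hu)))
  rw [extD, extDLoc_of_eq_pull (chartAt (PhaseModel EX EF) z).open_target
    (xProj EX EF).contDiff.contDiffOn hu (hd.differentiableAt (by simp))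
    fun u hu => by rw [ContinuousLinearMap.fderiv]; exact formLoc_liftX hψ h w hu]
  have h0 : extDLoc (formLoc w ψ) (xProj EX EF (chartAt (PhaseModel EX EF) z z)) = 0 := by
    refine extPow_eq_zero (p := Module.finrank ℝ EX + 1) ?_
      (extDLoc_mem_extPow (Filter.Eventually.of_forall fun x => formLoc_mem_extPow hwn ψ x))
    rw [Subspace.dual_finrank_eq]
    omega
  rw [h0, map_zero, map_zero]

instance [T2Space Y] : T2Space (PhaseSpace hπ) := ⟨fun z z' hne => by
  -- Points over the same point of `Y` lie in a common chart.
  by_cases hb : z.base = z'.base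
  · let e := chartAt (PhaseModel EX EF) z
    have hz : z ∈ e.source := mem_chart_source _ z
    have hz' : z' ∈ e.source := by
      have h := mem_chartAt_source_iff.1 hz
      rw [hb] at h
      exact mem_chartAt_source_iff.2 h
    obtain ⟨U, V, hU, hV, hzU, hzV, hUV⟩ := t2_separation (e.injOn.ne hz hz' hne)
    exact ⟨_, _, e.isOpen_inter_preimage hU, e.isOpen_inter_preimage hV, ⟨hz, hzU⟩, ⟨hz', hzV⟩,
      (hUV.preimage e).mono Set.inter_subset_right Set.inter_subset_right⟩
  · exact separated_by_continuous contMDiff_base.continuous hb⟩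

instance [SecondCountableTopology Y] : SecondCountableTopology (PhaseSpace hπ) := by
  obtain ⟨s, hs, hc⟩ := TopologicalSpace.countable_cover_nhds
    (f := fun y : Y => (fiberedChartAt (⟨y, 0⟩ : PhaseSpace hπ)).source)
    fun y => (fiberedChartAt (⟨y, 0⟩ : PhaseSpace hπ)).open_source.mem_nhds
      (mem_chart_source (PhaseModel EX EF) (⟨y, 0⟩ : PhaseSpace hπ))
  refine ChartedSpace.secondCountable_of_countable_cover (PhaseModel EX EF)
    (s := (fun y => (⟨y, 0⟩ : PhaseSpace hπ)) '' s) ?_ (hs.image _)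
  refine Set.eq_univ_of_forall fun z => ?_
  have hz : z.base ∈ ⋃ y ∈ s, (fiberedChartAt (⟨y, 0⟩ : PhaseSpace hπ)).source := by
    rw [hc]; trivial
  simp only [Set.mem_iUnion] at hz ⊢
  obtain ⟨y, hy, hz⟩ := hz
  exact ⟨_, ⟨y, hy, rfl⟩, hz⟩

instance [T2Space Y] [SecondCountableTopology Y] : SigmaCompactSpace (PhaseSpace hπ) :=
  haveI := Manifold.locallyCompact_of_finiteDimensional (M := PhaseSpace hπ)
    𝓘(ℝ, PhaseModel EX EF)
  sigmaCompactSpace_of_locallyCompact_secondCountable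

/-- Every smooth horizontal form is the interior product of a smooth multivector field with the
volume form. In a chart, the form is restricted to the section `xIncl`, represented there by the
linear map `σ` with respect to the volume form `w₀` at one point, rescaled by the quotient of the
volume form by `w₀`, and pushed forward. -/
theorem exists_smoothMV_contr_liftX [T2Space Y] [SecondCountableTopology Y] {w : X → Covec EX}
    (hw : IsVolumeForm (Module.finrank ℝ EX) w) {p : ℕ}
    {F : PhaseSpace hπ → Covec (PhaseModel EX EF)} (hF : SmoothForm F)
    (hFp : ∀ z, F z ∈ formsAt (vertZ hπ z) p 0) :
    ∃ A : PhaseSpace hπ → Multivec (PhaseModel EX EF), SmoothMV A ∧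
      (∀ z, A z ∈ ⋀[ℝ]^(Module.finrank ℝ EX - p) (PhaseModel EX EF)) ∧
      ∀ z, contr (A z) (liftX hπ w z) = F z := by
  refine exists_smoothMV_of_local fun z₀ => ?_
  obtain ⟨ψ, hψ, h⟩ := exists_xChart z₀
  set e := chartAt (PhaseModel EX EF) z₀ with he
  have hne : ∀ x ∈ ψ.target, formLoc w ψ x ≠ 0 := fun x hx h0 => by
    have h1 := pull_formLoc hψ w (ψ.map_target hx)
    rw [ψ.right_inv hx, h0, map_zero] at h1
    exact hw.ne_zero _ h1.symm
  have hdeg : ∀ x, formLoc w ψ x ∈ ⋀[ℝ]^(Module.finrank ℝ EX) (Module.Dual ℝ EX) :=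
    formLoc_mem_extPow hw.degree ψ
  have hx₀ := xProj_mem_target h (e.map_source (mem_chart_source _ z₀))
  set w₀ := formLoc w ψ (xProj EX EF (e z₀)) with hw₀
  obtain ⟨B, -, hB⟩ := exists_contr_eq_one (hdeg (xProj EX EF (e z₀))) (hne _ hx₀)
  obtain ⟨σ, hσ, hσw⟩ := exists_linear_contr_eq (hdeg (xProj EX EF (e z₀))) (hne _ hx₀) p
  let ℓ : Covec EX →ₗ[ℝ] ℝ := ExteriorAlgebra.algebraMapInv.toLinearMap ∘ₗ contr B
  have hℓ : ℓ w₀ = 1 := by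
    change ExteriorAlgebra.algebraMapInv (contr B w₀) = 1
    rw [hB, map_one]
  have hsm : ∀ x, ℓ (formLoc w ψ x) • w₀ = formLoc w ψ x := fun x => by
    obtain ⟨r, hr⟩ := exists_smul_eq_of_top (hdeg (xProj EX EF (e z₀))) (hne _ hx₀) (hdeg x)
    rw [← hr, map_smul, hℓ, smul_eq_mul, mul_one]
  have hℓne : ∀ x ∈ ψ.target, ℓ (formLoc w ψ x) ≠ 0 := fun x hx h0 => hne x hx (by
    rw [← hsm x, h0, zero_smul])
  refine ⟨fun u => (ℓ (formLoc w ψ (xProj EX EF u)))⁻¹ •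
    push (xIncl EX EF).toLinearMap (σ (pull (xIncl EX EF).toLinearMap (formLoc F e u))),
    ?_, fun u hu => ⟨?_, ?_⟩⟩
  · have hs : ContDiffOn ℝ ∞ (fun u => ℓ (formLoc w ψ (xProj EX EF u))) e.target :=
      (contDiffOn_linear_comp ℓ (hw.smooth.contDiffOn hψ)).comp
        (xProj EX EF).contDiff.contDiffOn fun u hu => xProj_mem_target h hu
    refine (hs.inv fun u hu => hℓne _ (xProj_mem_target h hu)).smul ?_
    exact contDiffOn_linear_comp ((push (xIncl EX EF).toLinearMap).toLinearMap ∘ₗ σ ∘ₗ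
        (pull (xIncl EX EF).toLinearMap).toLinearMap) (hF.contDiffOn (chartAt_mem z₀))
  · exact Submodule.smul_mem _ _ (push_mem_extPow _ (hσ _))
  · have h1 : formLoc F e u ∈ ⋀[ℝ]^p (Module.Dual ℝ (PhaseModel EX EF)) :=
      formLoc_mem_extPow (fun z => (hFp z).1) e u
    have h2 : formLoc F e u ∈ horizontal (LinearMap.ker (xProj EX EF).toLinearMap) :=
      formLoc_mem_annBy (chartAt_mem z₀) (fun z hz => vertZ_eq_comap hψ h hz) hu (hFp _).2
    rw [formLoc_liftX hψ h w hu, ← hsm (xProj EX EF u)]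
    simp only [map_smul, LinearMap.smul_apply]
    rw [smul_smul, mul_inv_cancel₀ (hℓne _ (xProj_mem_target h hu)), one_smul, contr_pull,
      push_comp_apply, xProj_comp_xIncl, push_id, hσw _ (pull_mem_extPow _ h1),
      pull_pull_of_horizontal xProj_comp_xIncl h1 h2]

theorem vertZ_le_comap (z : PhaseSpace hπ) : vertZ hπ z ≤ (vert EY EX π z.base).comap
    (tmap (PhaseModel EX EF) EY (fun z : PhaseSpace hπ => z.base) z) := by
  intro v hv
  have h1 : MDifferentiableAt 𝓘(ℝ, EY) 𝓘(ℝ, EX) π z.base :=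
    hπ.contMDiff.mdifferentiable (by simp) _
  have h2 : MDifferentiableAt 𝓘(ℝ, PhaseModel EX EF) 𝓘(ℝ, EY) (fun z : PhaseSpace hπ => z.base) z :=
    contMDiff_base.mdifferentiable (by simp) z
  have h3 := DFunLike.congr_fun (mfderiv_comp z h1 h2) v
  exact h3.symm.trans hv

/-- The canonical form is well defined modulo horizontal forms. -/
theorem IsCanonicalForm.sub_mem {Θ Θ' : PhaseSpace hπ → Covec (PhaseModel EX EF)}
    (hΘ : IsCanonicalForm hπ Θ) (hΘ' : IsCanonicalForm hπ Θ') (z : PhaseSpace hπ) :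
    Θ z - Θ' z ∈ horizontal (vertZ hπ z) := by
  obtain ⟨α, hα, h⟩ := hΘ.canonical z
  obtain ⟨α', hα', h'⟩ := hΘ'.canonical z
  have h1 : (α : Covec EY) - α' ∈ annBy (vert EY EX π z.base) 1 :=
    ((Submodule.Quotient.eq _).1 (hα.trans hα'.symm)).2
  have h2 := pull_mem_annBy (vertZ_le_comap z) 1 h1
  rw [map_sub] at h2
  have h3 := Submodule.add_mem _ (Submodule.sub_mem _ h.2 h'.2) h2
  have key : ∀ a b c d : Covec (PhaseModel EX EF), a - b = a - c - (b - d) + (c - d) :=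
    fun a b c d => by abel
  rwa [← key] at h3

/-- The polysymplectic form is well defined modulo forms annihilated by two vertical vectors. -/
theorem IsPolysymplectic.sub_mem {Ω Ω' : PhaseSpace hπ → Covec (PhaseModel EX EF)}
    (hΩ : IsPolysymplectic hπ Ω) (hΩ' : IsPolysymplectic hπ Ω') (z : PhaseSpace hπ) :
    Ω z - Ω' z ∈ annBy (vertZ hπ z) 2 := by
  obtain ⟨Θ, hΘ, h⟩ := hΩ.eq_extD
  obtain ⟨Θ', hΘ', h'⟩ := hΩ'.eq_extD
  have h1 := isAdapted_vertZ.extD_mem_annBy (fun z => hΘ.sub_mem hΘ' z) z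
  rw [extD_sub hΘ.smooth hΘ'.smooth] at h1
  have h3 := Submodule.add_mem _ (Submodule.sub_mem _ (h z).2 (h' z).2) h1
  convert h3 using 1
  abel

/-- The polysymplectic form is closed modulo forms annihilated by three vertical vectors. -/
theorem IsPolysymplectic.extD_mem {Ω : PhaseSpace hπ → Covec (PhaseModel EX EF)}
    (hΩ : IsPolysymplectic hπ Ω) (z : PhaseSpace hπ) : extD Ω z ∈ annBy (vertZ hπ z) 3 := by
  obtain ⟨Θ, hΘ, h⟩ := hΩ.eq_extD
  have h1 := isAdapted_vertZ.extD_mem_annBy (fun z => (h z).2) z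
  rwa [extD_sub hΩ.smooth hΘ.smooth.extD, extD_extD hΘ.smooth, sub_zero] at h1

end PhaseSpaceGeometry

/-! ### Hamiltonian forms and their fields -/

section HamiltonianPairs

variable {E : Type*} [NormedAddCommGroup E] [NormedSpace ℝ E] [FiniteDimensional ℝ E]
  {M : Type*} [TopologicalSpace M] [ChartedSpace E M] [IsManifold 𝓘(ℝ, E) ∞ M]

/-- `F` is a horizontal form and `P` is a vertical multivector field of degree `a` with
`P ⌟ Ω = dF` modulo horizontal forms. The degree of `F` is left free, so that the notion also
covers brackets and products that vanish for degree reasons. -/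
structure IsHamiltonianPair (V : M → Submodule ℝ E) (Ω : M → Covec E) (a : ℕ)
    (F : M → Covec E) (P : M → Multivec E) : Prop where
  smooth_form : SmoothForm F
  form_mem : ∀ z, F z ∈ horizontal (V z)
  smooth_field : SmoothMV P
  field_mem : ∀ z, P z ∈ ⋀[ℝ]^a E
  vertical : ∀ z, IsVertical (V z) (P z)
  eq_extD : ∀ z, contr (P z) (Ω z) - extD F z ∈ horizontal (V z)

namespace IsHamiltonianPair

variable {V : M → Submodule ℝ E} {Ω : M → Covec E} {a b c : ℕ} {F G K : M → Covec E}
  {P Q R : M → Multivec E}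

/-- The contraction `P ⌟ Q ⌟ Ω` is `P ⌟ dG` exactly, since `P` kills the horizontal difference. -/
theorem contr_contr (hP : IsHamiltonianPair V Ω a F P) (hQ : IsHamiltonianPair V Ω b G Q) (z : M) :
    contr (P z) (contr (Q z) (Ω z)) = contr (P z) (extD G z) := by
  rw [← sub_eq_zero, ← map_sub]
  exact hP.vertical z _ (hQ.eq_extD z)

/-- The graded symmetry behind the antisymmetry of the bracket, and behind its independence of the
Hamiltonian field `P` of `F`. -/
theorem contr_extD_comm (hP : IsHamiltonianPair V Ω a F P) (hQ : IsHamiltonianPair V Ω b G Q)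
    (z : M) : contr (P z) (extD G z) = (-1 : ℝ) ^ (a * b) • contr (Q z) (extD F z) := by
  rw [← hP.contr_contr hQ, contr_comm_apply (hP.field_mem z) (hQ.field_mem z), hQ.contr_contr hP]

theorem extD_mem (hV : IsAdapted V) (hP : IsHamiltonianPair V Ω a F P) (z : M) :
    extD F z ∈ annBy (V z) 2 :=
  hV.extD_mem_annBy hP.form_mem z

theorem contr_extD_mem (hV : IsAdapted V) (hP : IsHamiltonianPair V Ω a F P)
    (hQ : IsHamiltonianPair V Ω b G Q) (z : M) : contr (P z) (extD G z) ∈ horizontal (V z) :=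
  (hP.vertical z).contr_mem_annBy (hP.field_mem z) (hQ.extD_mem hV z)

theorem smooth_contr_extD (hP : IsHamiltonianPair V Ω a F P) (hQ : IsHamiltonianPair V Ω b G Q) :
    SmoothForm fun z => contr (P z) (extD G z) :=
  SmoothForm.contr hP.smooth_field hQ.smooth_form.extD

theorem extD_contr_mem (hV : IsAdapted V) (hΩ : SmoothForm Ω) (hP : IsHamiltonianPair V Ω a F P)
    (z : M) : extD (fun z => contr (P z) (Ω z)) z ∈ annBy (V z) 2 := by
  have h := hV.extD_mem_annBy hP.eq_extD z
  rwa [extD_sub (SmoothForm.contr hP.smooth_field hΩ) hP.smooth_form.extD,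
    extD_extD hP.smooth_form, sub_zero] at h

/-- The Schouten–Nijenhuis bracket of Hamiltonian fields is, up to sign, a Hamiltonian field of
the bracket of the forms. In the Cartan formula for `[P, Q] ⌟ Ω`, the forms `dΩ`, `d(P ⌟ Ω)` and
`d(Q ⌟ Ω)` become horizontal after the remaining contractions with vertical fields. -/
theorem contr_schouten_add_mem (hV : IsAdapted V) (hΩ : SmoothForm Ω)
    (hdΩ : ∀ z, extD Ω z ∈ annBy (V z) 3) (hP : IsHamiltonianPair V Ω a F P)
    (hQ : IsHamiltonianPair V Ω b G Q) (z : M) :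
    contr (schouten P Q z) (Ω z) + (-1 : ℝ) ^ a • extD (fun z => contr (P z) (extD G z)) z ∈
      horizontal (V z) := by
  have h1 : contr (P z) (extD (fun z => contr (Q z) (Ω z)) z) ∈ annBy (V z) 1 :=
    (hP.vertical z).contr_mem_annBy (hP.field_mem z) (hQ.extD_contr_mem hV hΩ z)
  have h2 : contr (Q z) (extD (fun z => contr (P z) (Ω z)) z) ∈ annBy (V z) 1 :=
    (hQ.vertical z).contr_mem_annBy (hQ.field_mem z) (hP.extD_contr_mem hV hΩ z)
  have h3 : contr (Q z) (contr (P z) (extD Ω z)) ∈ annBy (V z) 1 :=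
    (hQ.vertical z).contr_mem_annBy (hQ.field_mem z)
      ((hP.vertical z).contr_mem_annBy (hP.field_mem z) (hdΩ z))
  rw [contr_schouten hP.smooth_field hQ.smooth_field hΩ hP.field_mem hQ.field_mem]
  simp only [hP.contr_contr hQ]
  have h := Submodule.add_mem _ (Submodule.sub_mem _ h1
    (Submodule.smul_mem _ ((-1 : ℝ) ^ ((a + 1) * b)) h3))
    (Submodule.smul_mem _ ((-1 : ℝ) ^ ((a + 1) * b + a)) h2)
  have key : ∀ x y u v : Covec E, x - y - u + v + y = x - u + v := fun x y u v => by abel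
  rw [horizontal, key]
  exact h

theorem bracket (hV : IsAdapted V) (hΩ : SmoothForm Ω) (hdΩ : ∀ z, extD Ω z ∈ annBy (V z) 3)
    (hP : IsHamiltonianPair V Ω a F P) (hQ : IsHamiltonianPair V Ω b G Q) (hc : c + 1 = a + b) :
    IsHamiltonianPair V Ω c (fun z => (-1 : ℝ) ^ a • contr (P z) (extD G z))
      (fun z => -schouten P Q z) where
  smooth_form := (hP.smooth_contr_extD hQ).const_smul _
  form_mem z := Submodule.smul_mem _ _ (hP.contr_extD_mem hV hQ z)
  smooth_field := by
    have h := (SmoothMV.schouten (by omega) hP.smooth_field hQ.smooth_field hP.field_mem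
      hQ.field_mem).const_smul (-1)
    simpa only [neg_one_smul] using h
  field_mem z := Submodule.neg_mem _ (schouten_mem_extPow hc hP.field_mem hQ.field_mem z)
  vertical z := (verticals (V z)).neg_mem
    (hV.isVertical_schouten hQ.field_mem hP.vertical hQ.vertical z)
  eq_extD z := by
    have h := Submodule.neg_mem _ (hP.contr_schouten_add_mem hV hΩ hdΩ hQ z)
    rw [extD_const_smul _ (hP.smooth_contr_extD hQ), map_neg, LinearMap.neg_apply, sub_eq_add_neg,
      ← neg_add]
    exact h

theorem add {F' : M → Covec E} {P' : M → Multivec E} (hP : IsHamiltonianPair V Ω a F P)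
    (hP' : IsHamiltonianPair V Ω a F' P') :
    IsHamiltonianPair V Ω a (fun z => F z + F' z) (fun z => P z + P' z) where
  smooth_form := hP.smooth_form.add hP'.smooth_form
  form_mem z := Submodule.add_mem _ (hP.form_mem z) (hP'.form_mem z)
  smooth_field := hP.smooth_field.add hP'.smooth_field
  field_mem z := Submodule.add_mem _ (hP.field_mem z) (hP'.field_mem z)
  vertical z := (verticals (V z)).add_mem (hP.vertical z) (hP'.vertical z)
  eq_extD z := by
    have h := Submodule.add_mem _ (hP.eq_extD z) (hP'.eq_extD z)
    rw [extD_add hP.smooth_form hP'.smooth_form, map_add, LinearMap.add_apply, add_sub_add_comm]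
    exact h

theorem const_smul (t : ℝ) (hP : IsHamiltonianPair V Ω a F P) :
    IsHamiltonianPair V Ω a (fun z => t • F z) (fun z => t • P z) where
  smooth_form := hP.smooth_form.const_smul t
  form_mem z := Submodule.smul_mem _ _ (hP.form_mem z)
  smooth_field := hP.smooth_field.const_smul t
  field_mem z := Submodule.smul_mem _ _ (hP.field_mem z)
  vertical z := (verticals (V z)).smul_mem t (hP.vertical z)
  eq_extD z := by
    have h := Submodule.smul_mem _ t (hP.eq_extD z)
    rw [extD_const_smul _ hP.smooth_form, map_smul, LinearMap.smul_apply, ← smul_sub]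
    exact h

/-- The graded Jacobi identity for forms of degrees `a + 1`, `b + 1`, `c + 1` (counted by their
fields). The form `P ⌟ d{G, K}` is `[Q, R] ⌟ dF` up to sign; the Cartan formula for the latter gives
the other two terms, since `dF` is closed and `Q ⌟ R ⌟ dF = 0`. -/
theorem jacobi (hV : IsAdapted V) (hΩ : SmoothForm Ω) (hdΩ : ∀ z, extD Ω z ∈ annBy (V z) 3)
    (hP : IsHamiltonianPair V Ω (a + 1) F P) (hQ : IsHamiltonianPair V Ω (b + 1) G Q)
    (hR : IsHamiltonianPair V Ω (c + 1) K R) (z : M) :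
    (-1 : ℝ) ^ (a * c) • (-1 : ℝ) ^ (a + 1) •
        contr (P z) (extD (fun z => (-1 : ℝ) ^ (b + 1) • contr (Q z) (extD K z)) z) +
      (-1 : ℝ) ^ (a * b) • (-1 : ℝ) ^ (b + 1) •
        contr (Q z) (extD (fun z => (-1 : ℝ) ^ (c + 1) • contr (R z) (extD F z)) z) +
      (-1 : ℝ) ^ (b * c) • (-1 : ℝ) ^ (c + 1) •
        contr (R z) (extD (fun z => (-1 : ℝ) ^ (a + 1) • contr (P z) (extD G z)) z) = 0 := by
  have hB := hQ.bracket hV hΩ hdΩ hR (c := b + c + 1) (by omega)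
  have h1 := hP.contr_extD_comm hB z
  have h0 : (fun z => contr (Q z) (contr (R z) (extD F z))) = fun _ => 0 :=
    funext fun z => hQ.vertical z _ (hR.contr_extD_mem hV hP z)
  have h2 := contr_schouten hQ.smooth_field hR.smooth_field hP.smooth_form.extD hQ.field_mem
    hR.field_mem z
  rw [h0, extD_zero, extD_extD hP.smooth_form, map_zero, map_zero, smul_zero, smul_zero,
    sub_zero, sub_zero] at h2
  have h3 : (fun z => contr (Q z) (extD F z)) =
      fun z => (-1 : ℝ) ^ ((b + 1) * (a + 1)) • contr (P z) (extD G z) :=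
    funext fun z => hQ.contr_extD_comm hP z
  rw [h3, extD_const_smul _ (hP.smooth_contr_extD hQ)] at h2
  rw [h1, extD_const_smul _ (hR.smooth_contr_extD hP), extD_const_smul _ (hP.smooth_contr_extD hQ),
    map_neg, LinearMap.neg_apply, h2]
  simp only [map_smul, smul_add, smul_neg, neg_add, smul_smul]
  generalize contr (Q z) (extD (fun z => contr (R z) (extD F z)) z) = x
  generalize contr (R z) (extD (fun z => contr (P z) (extD G z)) z) = y
  have key : ∀ s t s' t' : ℝ, s = s' → t = t' → -(s • x) + -(t • y) + s' • x + t' • y = 0 := by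
    rintro s t _ _ rfl rfl
    abel
  refine key _ _ _ _ ?_ ?_ <;>
  · rcases neg_one_pow_eq_or ℝ a with ha | ha <;> rcases neg_one_pow_eq_or ℝ b with hb | hb <;>
      rcases neg_one_pow_eq_or ℝ c with hc | hc <;>
      simp [pow_add, pow_mul, mul_add, add_mul, ha, hb, hc]

variable {η : M → Covec E} {A B C : M → Multivec E}

/-- The exterior derivative of a co-exterior product, modulo horizontal forms. -/
theorem extD_product_sub_mem (hη : SmoothForm η)
    (hηV : ∀ z, η z ∈ horizontal (V z)) (hdη : ∀ z, extD η z = 0) (hab : a + b ≠ 0)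
    (hA : SmoothMV A) (hAa : ∀ z, A z ∈ ⋀[ℝ]^a E) (hAF : ∀ z, contr (A z) (η z) = F z)
    (hB : SmoothMV B) (hBb : ∀ z, B z ∈ ⋀[ℝ]^b E) (hBG : ∀ z, contr (B z) (η z) = G z) (z : M) :
    (-1 : ℝ) ^ a • contr (A z) (extD G z) + (-1 : ℝ) ^ ((a + 1) * b) • contr (B z) (extD F z) -
      extD (fun z => contr (A z * B z) (η z)) z ∈ horizontal (V z) := by
  have h := contr_schouten hA hB hη hAa hBb z
  simp only [hdη, map_zero, smul_zero, sub_zero, ← contr_mul_apply] at h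
  simp only [hAF, hBG] at h
  have h1 : contr (schouten A B z) (η z) ∈ horizontal (V z) :=
    contr_mem_annBy (schouten_mem_extPow (c := a + b - 1) (by omega) hAa hBb z) (hηV z)
  -- The left side of Cartan's formula is horizontal, as `η` is.
  have h2 := Submodule.smul_mem _ ((-1 : ℝ) ^ a) h1
  rw [h] at h2
  have h3 : (-1 : ℝ) ^ a * (-1) ^ a = 1 := by rw [← mul_pow]; simp
  have h4 : (-1 : ℝ) ^ a * (-1) ^ ((a + 1) * b + a) = (-1) ^ ((a + 1) * b) := by
    rw [pow_add, mul_left_comm, h3, mul_one]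
  rw [smul_add, smul_sub, smul_smul, smul_smul, h3, h4, one_smul] at h2
  have key : ∀ x y u : Covec E, x - y + u = x + u - y := fun x y u => by abel
  rwa [key] at h2

/-- The co-exterior product of Hamiltonian forms is Hamiltonian. -/
theorem product (hη : SmoothForm η)
    (hηV : ∀ z, η z ∈ horizontal (V z)) (hdη : ∀ z, extD η z = 0) (hab : a + b ≠ 0)
    (hP : IsHamiltonianPair V Ω a F P) (hQ : IsHamiltonianPair V Ω b G Q)
    (hA : SmoothMV A) (hAa : ∀ z, A z ∈ ⋀[ℝ]^a E) (hAF : ∀ z, contr (A z) (η z) = F z)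
    (hB : SmoothMV B) (hBb : ∀ z, B z ∈ ⋀[ℝ]^b E) (hBG : ∀ z, contr (B z) (η z) = G z) :
    IsHamiltonianPair V Ω (a + b) (fun z => contr (A z * B z) (η z)) (fun z =>
      (-1 : ℝ) ^ a • (A z * Q z) + (-1 : ℝ) ^ ((a + 1) * b) • (B z * P z)) where
  smooth_form := SmoothForm.contr (hA.mul hB) hη
  form_mem z := contr_mem_annBy (mul_mem_extPow (hAa z) (hBb z)) (hηV z)
  smooth_field := ((hA.mul hQ.smooth_field).const_smul _).add
    ((hB.mul hP.smooth_field).const_smul _)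
  field_mem z := Submodule.add_mem _
    (Submodule.smul_mem _ _ (mul_mem_extPow (hAa z) (hQ.field_mem z)))
    (Submodule.smul_mem _ _ (by
      have h := mul_mem_extPow (hBb z) (hP.field_mem z)
      rwa [add_comm] at h))
  vertical z := (verticals (V z)).add_mem
    ((verticals (V z)).smul_mem _ ((hQ.vertical z).mul_left _))
    ((verticals (V z)).smul_mem _ ((hP.vertical z).mul_left _))
  eq_extD z := by
    have h0 := extD_product_sub_mem hη hηV hdη hab hA hAa hAF hB hBb hBG z
    have h1 := Submodule.smul_mem _ ((-1 : ℝ) ^ a) (contr_mem_annBy (hAa z) (hQ.eq_extD z))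
    have h2 := Submodule.smul_mem _ ((-1 : ℝ) ^ ((a + 1) * b))
      (contr_mem_annBy (hBb z) (hP.eq_extD z))
    have h := Submodule.add_mem _ (Submodule.add_mem _ h1 h2) h0
    rw [map_sub, map_sub, smul_sub, smul_sub] at h
    simp only [map_add, map_smul, LinearMap.add_apply, LinearMap.smul_apply, contr_mul_apply] at h ⊢
    have key : ∀ x y u v t : Covec E, x - y + (u - v) + (y + v - t) = x + u - t :=
      fun x y u v t => by abel
    rw [key] at h
    exact h

/-- The graded Leibniz rule: contract the formula for the exterior derivative of a co-exterior
product with a Hamiltonian field. -/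
theorem leibniz (hη : SmoothForm η)
    (hηV : ∀ z, η z ∈ horizontal (V z)) (hdη : ∀ z, extD η z = 0)
    (hP : IsHamiltonianPair V Ω (a + 1) F P)
    (hB : SmoothMV B) (hBb : ∀ z, B z ∈ ⋀[ℝ]^(b + 1) E) (hBG : ∀ z, contr (B z) (η z) = G z)
    (hC : SmoothMV C) (hCc : ∀ z, C z ∈ ⋀[ℝ]^c E) (hCK : ∀ z, contr (C z) (η z) = K z) {z : M}
    {S T : Multivec E} (hSa : S ∈ ⋀[ℝ]^(a + b + 1) E)
    (hS : contr S (η z) = (-1 : ℝ) ^ (a + 1) • contr (P z) (extD G z))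
    (hT : contr T (η z) = (-1 : ℝ) ^ (a + 1) • contr (P z) (extD K z)) :
    (-1 : ℝ) ^ (a + 1) • contr (P z) (extD (fun z => contr (B z * C z) (η z)) z) =
      contr (S * C z) (η z) + (-1 : ℝ) ^ (a * (b + 1)) • contr (B z * T) (η z) := by
  have h := hP.vertical z _
    (extD_product_sub_mem hη hηV hdη (by omega) hB hBb hBG hC hCc hCK z)
  rw [map_sub, sub_eq_zero] at h
  rw [← h, contr_mul_apply, contr_mul_apply, hT, contr_comm_apply hSa (hCc z), hS, map_add,
    map_smul, map_smul, contr_comm_apply (hP.field_mem z) (hBb z),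
    contr_comm_apply (hP.field_mem z) (hCc z), map_smul, map_smul]
  simp only [smul_add, smul_smul]
  generalize contr (B z) (contr (P z) (extD K z)) = x
  generalize contr (C z) (contr (P z) (extD G z)) = y
  have key : ∀ s t s' t' : ℝ, s = s' → t = t' → s • x + t • y = t' • y + s' • x := by
    rintro s t _ _ rfl rfl
    exact add_comm _ _
  refine key _ _ _ _ ?_ ?_ <;>
  · rcases neg_one_pow_eq_or ℝ a with ha | ha <;> rcases neg_one_pow_eq_or ℝ b with hb | hb <;>
      rcases neg_one_pow_eq_or ℝ c with hc | hc <;>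
      simp [pow_add, pow_mul, mul_add, add_mul, ha, hb, hc]

end IsHamiltonianPair

end HamiltonianPairs

/-! ### The algebra of Hamiltonian forms -/

section HamiltonianForms

variable {EX EY EF : Type*}
  [NormedAddCommGroup EX] [NormedSpace ℝ EX] [FiniteDimensional ℝ EX]
  [NormedAddCommGroup EY] [NormedSpace ℝ EY] [FiniteDimensional ℝ EY]
  [NormedAddCommGroup EF] [NormedSpace ℝ EF] [FiniteDimensional ℝ EF]
  {X : Type*} [TopologicalSpace X] [ChartedSpace EX X] [IsManifold 𝓘(ℝ, EX) ∞ X]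
  {Y : Type*} [TopologicalSpace Y] [ChartedSpace EY Y] [IsManifold 𝓘(ℝ, EY) ∞ Y]
  {π : Y → X} {hπ : IsFibered EX EY EF π}
  {Ω Ω' : PhaseSpace hπ → Covec (PhaseModel EX EF)} {p q r : ℕ}
  {F G K F' G' : PhaseSpace hπ → Covec (PhaseModel EX EF)}
  {P Q P' : PhaseSpace hπ → Multivec (PhaseModel EX EF)}

theorem IsHamiltonianField.isHamiltonianPair (hP : IsHamiltonianField hπ Ω p F P) :
    IsHamiltonianPair (vertZ hπ) Ω (Module.finrank ℝ EX - p) F P :=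
  ⟨hP.smooth_form, fun z => (hP.form_mem z).2, hP.smooth_field, hP.field_mem, hP.vertical,
    hP.eq_extD⟩

theorem IsHamiltonianPair.isHamiltonianField {a : ℕ} (hP : IsHamiltonianPair (vertZ hπ) Ω a F P)
    (hp : p < Module.finrank ℝ EX) (ha : a = Module.finrank ℝ EX - p)
    (hF : ∀ z, F z ∈ ⋀[ℝ]^p (Module.Dual ℝ (PhaseModel EX EF))) :
    IsHamiltonianField hπ Ω p F P :=
  ⟨hp, hP.smooth_form, fun z => ⟨hF z, hP.form_mem z⟩, hP.smooth_field, ha ▸ hP.field_mem,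
    hP.vertical, hP.eq_extD⟩

/-- Two polysymplectic forms differ by an element of `annBy V 2`, and its interior product with a
vertical multivector is horizontal. -/
theorem IsHamiltonianField.of_isPolysymplectic (hΩ : IsPolysymplectic hπ Ω)
    (hΩ' : IsPolysymplectic hπ Ω') (hP : IsHamiltonianField hπ Ω p F P) :
    IsHamiltonianField hπ Ω' p F P where
  lt := hP.lt
  smooth_form := hP.smooth_form
  form_mem := hP.form_mem
  smooth_field := hP.smooth_field
  field_mem := hP.field_mem
  vertical := hP.vertical
  eq_extD z := by
    have h : contr (P z) (Ω' z - Ω z) ∈ annBy (vertZ hπ z) 1 :=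
      (hP.vertical z).contr_mem_annBy (hP.field_mem z) (hΩ'.sub_mem hΩ z)
    have h1 := Submodule.add_mem _ h (hP.eq_extD z)
    rwa [map_sub, sub_add_sub_cancel] at h1

theorem IsHamiltonianField.contr_extD_mem_extPow (hP : IsHamiltonianField hπ Ω p F P)
    (hG : ∀ z, G z ∈ formsAt (vertZ hπ z) q 0) (h : Module.finrank ℝ EX ≤ p + q + 1)
    (z : PhaseSpace hπ) : contr (P z) (extD G z) ∈
      ⋀[ℝ]^(p + q + 1 - Module.finrank ℝ EX) (Module.Dual ℝ (PhaseModel EX EF)) := by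
  have hp := hP.lt
  refine contr_mem_extPow (hP.field_mem z) ?_
  have h1 := extD_mem_extPow (fun z => (hG z).1) z
  rwa [show Module.finrank ℝ EX - p + (p + q + 1 - Module.finrank ℝ EX) = q + 1 by omega]

theorem IsHamiltonianField.contr_extD_eq_zero (hP : IsHamiltonianField hπ Ω p F P)
    (hG : ∀ z, G z ∈ formsAt (vertZ hπ z) q 0) (h : p + q + 1 < Module.finrank ℝ EX)
    (z : PhaseSpace hπ) : contr (P z) (extD G z) = 0 :=
  contr_eq_zero_of_lt (by omega) (hP.field_mem z) (extD_mem_extPow (fun z => (hG z).1) z)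

/-- The Poisson bracket does not depend on the choice of the Hamiltonian field. The degree of `G` is
free, so that `G` may itself be a bracket or product that vanishes for degree reasons. -/
theorem poissonBracket_eq (hP : IsHamiltonianField hπ Ω p F P) {b : ℕ}
    (hQ : IsHamiltonianPair (vertZ hπ) Ω b G Q) :
    poissonBracket hπ Ω p F G =
      fun z => (-1 : ℝ) ^ (Module.finrank ℝ EX - p) • contr (P z) (extD G z) := by
  have h : ∃ P, IsHamiltonianField hπ Ω p F P := ⟨P, hP⟩
  have h1 : poissonBracket hπ Ω p F G =
      fun z => (-1 : ℝ) ^ (Module.finrank ℝ EX - p) • contr (h.choose z) (extD G z) := dif_pos h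
  rw [h1]
  funext z
  rw [h.choose_spec.isHamiltonianPair.contr_extD_comm hQ, hP.isHamiltonianPair.contr_extD_comm hQ]

theorem isHamiltonianPair_poissonBracket (hΩ : IsPolysymplectic hπ Ω)
    (hP : IsHamiltonianField hπ Ω p F P) {b c : ℕ} (hQ : IsHamiltonianPair (vertZ hπ) Ω b G Q)
    (hc : c + 1 = Module.finrank ℝ EX - p + b) :
    IsHamiltonianPair (vertZ hπ) Ω c (poissonBracket hπ Ω p F G) (fun z => -schouten P Q z) := by
  rw [poissonBracket_eq hP hQ]
  exact hP.isHamiltonianPair.bracket isAdapted_vertZ hΩ.smooth hΩ.extD_mem hQ hc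

theorem isHamiltonianField_poissonBracket (hΩ : IsPolysymplectic hπ Ω)
    (hP : IsHamiltonianField hπ Ω p F P) (hQ : IsHamiltonianField hπ Ω q G Q)
    (h : Module.finrank ℝ EX ≤ p + q + 1) :
    IsHamiltonianField hπ Ω (p + q + 1 - Module.finrank ℝ EX) (poissonBracket hπ Ω p F G)
      (fun z => -schouten P Q z) := by
  have hp := hP.lt
  have hq := hQ.lt
  refine (isHamiltonianPair_poissonBracket hΩ hP hQ.isHamiltonianPair
    (c := Module.finrank ℝ EX - (p + q + 1 - Module.finrank ℝ EX)) (by omega)).isHamiltonianField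
    (by omega) rfl fun z => ?_
  rw [poissonBracket_eq hP hQ.isHamiltonianPair]
  exact Submodule.smul_mem _ _ (hP.contr_extD_mem_extPow hQ.form_mem h z)

theorem contr_schouten_sub_mem (hΩ : IsPolysymplectic hπ Ω)
    (hP : IsHamiltonianField hπ Ω p F P) (hQ : IsHamiltonianField hπ Ω q G Q) (z : PhaseSpace hπ) :
    contr (schouten P Q z) (Ω z) - -extD (poissonBracket hπ Ω p F G) z ∈
      horizontal (vertZ hπ z) := by
  have hP' := hP.isHamiltonianPair
  have hQ' := hQ.isHamiltonianPair
  rw [poissonBracket_eq hP hQ', extD_const_smul _ (hP'.smooth_contr_extD hQ'), sub_neg_eq_add]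
  exact hP'.contr_schouten_add_mem isAdapted_vertZ hΩ.smooth hΩ.extD_mem hQ' z

theorem poissonBracket_eq_zero (hP : IsHamiltonianField hπ Ω p F P)
    (hQ : IsHamiltonianField hπ Ω q G Q) (h : p + q + 1 < Module.finrank ℝ EX) :
    poissonBracket hπ Ω p F G = 0 := by
  rw [poissonBracket_eq hP hQ.isHamiltonianPair]
  funext z
  rw [hP.contr_extD_eq_zero hQ.form_mem h, smul_zero]
  rfl

theorem IsHamiltonianField.add (hP : IsHamiltonianField hπ Ω p F P)
    (hP' : IsHamiltonianField hπ Ω p F' P') :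
    IsHamiltonianField hπ Ω p (F + F') (P + P') :=
  (hP.isHamiltonianPair.add hP'.isHamiltonianPair).isHamiltonianField hP.lt rfl
    fun z => Submodule.add_mem _ (hP.form_mem z).1 (hP'.form_mem z).1

theorem IsHamiltonianField.smul (t : ℝ) (hP : IsHamiltonianField hπ Ω p F P) :
    IsHamiltonianField hπ Ω p (t • F) (t • P) :=
  (hP.isHamiltonianPair.const_smul t).isHamiltonianField hP.lt rfl
    fun z => Submodule.smul_mem _ _ (hP.form_mem z).1

theorem isHamiltonianField_zero (hp : p < Module.finrank ℝ EX) :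
    IsHamiltonianField hπ Ω p 0 0 where
  lt := hp
  smooth_form := smoothForm_zero
  form_mem _ := Submodule.zero_mem _
  smooth_field := smoothMV_zero
  field_mem _ := Submodule.zero_mem _
  vertical z := (verticals (vertZ hπ z)).zero_mem
  eq_extD z := by
    have h : extD (0 : PhaseSpace hπ → Covec (PhaseModel EX EF)) z = 0 := extD_zero z
    rw [h, Pi.zero_apply, map_zero, LinearMap.zero_apply, sub_zero]
    exact Submodule.zero_mem _

/-! ### The co-exterior product -/

variable {w : X → Covec EX}

theorem coexterior_eq (hw : IsVolumeForm (Module.finrank ℝ EX) w) {z : PhaseSpace hπ}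
    {A B : Multivec (PhaseModel EX EF)} (hA : contr A (liftX hπ w z) = F z)
    (hB : contr B (liftX hπ w z) = G z) :
    coexterior hπ w F G z = contr (A * B) (liftX hπ w z) :=
  coext_eq (liftX_mem_extPow hw.degree z) hA hB

section

variable [T2Space Y] [SecondCountableTopology Y]

theorem IsHamiltonianField.exists_contr_liftX (hw : IsVolumeForm (Module.finrank ℝ EX) w)
    (hP : IsHamiltonianField hπ Ω p F P) :
    ∃ A : PhaseSpace hπ → Multivec (PhaseModel EX EF), SmoothMV A ∧
      (∀ z, A z ∈ ⋀[ℝ]^(Module.finrank ℝ EX - p) (PhaseModel EX EF)) ∧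
      ∀ z, contr (A z) (liftX hπ w z) = F z :=
  exists_smoothMV_contr_liftX hw hP.smooth_form hP.form_mem

theorem exists_isHamiltonianPair_coexterior (hw : IsVolumeForm (Module.finrank ℝ EX) w)
    (hP : IsHamiltonianField hπ Ω p F P) (hQ : IsHamiltonianField hπ Ω q G Q) :
    ∃ R, IsHamiltonianPair (vertZ hπ) Ω
      (Module.finrank ℝ EX - p + (Module.finrank ℝ EX - q)) (coexterior hπ w F G) R := by
  have hp := hP.lt
  obtain ⟨A, hA, hAa, hAF⟩ := hP.exists_contr_liftX hw
  obtain ⟨B, hB, hBb, hBG⟩ := hQ.exists_contr_liftX hw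
  have h := IsHamiltonianPair.product (smoothForm_liftX hw.smooth) (liftX_mem_horizontal w)
    (extD_liftX hw.smooth hw.degree) (by omega) hP.isHamiltonianPair hQ.isHamiltonianPair
    hA hAa hAF hB hBb hBG
  have h1 : coexterior hπ w F G = fun z => contr (A z * B z) (liftX hπ w z) :=
    funext fun z => coexterior_eq hw (hAF z) (hBG z)
  rw [h1]
  exact ⟨_, h⟩

theorem coexterior_mem_hamForms (hw : IsVolumeForm (Module.finrank ℝ EX) w)
    (hP : IsHamiltonianField hπ Ω p F P) (hQ : IsHamiltonianField hπ Ω q G Q)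
    (h : Module.finrank ℝ EX ≤ p + q) :
    coexterior hπ w F G ∈ hamForms hπ Ω (p + q - Module.finrank ℝ EX) := by
  have hp := hP.lt
  have hq := hQ.lt
  obtain ⟨R, hR⟩ := exists_isHamiltonianPair_coexterior hw hP hQ
  refine ⟨R, hR.isHamiltonianField (by omega) (by omega) fun z => ?_⟩
  obtain ⟨A, -, hAa, hAF⟩ := hP.exists_contr_liftX hw
  obtain ⟨B, -, hBb, hBG⟩ := hQ.exists_contr_liftX hw
  rw [coexterior_eq hw (hAF z) (hBG z)]
  refine contr_mem_extPow (mul_mem_extPow (hAa z) (hBb z)) ?_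
  have h1 := liftX_mem_extPow (hπ := hπ) hw.degree z
  rwa [show Module.finrank ℝ EX - p + (Module.finrank ℝ EX - q) +
    (p + q - Module.finrank ℝ EX) = Module.finrank ℝ EX by omega]

theorem coexterior_eq_zero (hw : IsVolumeForm (Module.finrank ℝ EX) w)
    (hP : IsHamiltonianField hπ Ω p F P) (hQ : IsHamiltonianField hπ Ω q G Q)
    (h : p + q < Module.finrank ℝ EX) : coexterior hπ w F G = 0 := by
  obtain ⟨A, -, hAa, hAF⟩ := hP.exists_contr_liftX hw
  obtain ⟨B, -, hBb, hBG⟩ := hQ.exists_contr_liftX hw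
  funext z
  rw [coexterior_eq hw (hAF z) (hBG z)]
  exact contr_eq_zero_of_lt (by omega) (mul_mem_extPow (hAa z) (hBb z))
    (liftX_mem_extPow hw.degree z)

/-- The Poisson bracket is the interior product of a multivector with the volume form, also
when it vanishes for degree reasons. -/
theorem exists_contr_liftX_poissonBracket (hw : IsVolumeForm (Module.finrank ℝ EX) w)
    (hΩ : IsPolysymplectic hπ Ω) (hP : IsHamiltonianField hπ Ω p F P)
    (hQ : IsHamiltonianField hπ Ω q G Q) (z : PhaseSpace hπ) :
    ∃ S ∈ ⋀[ℝ]^(Module.finrank ℝ EX - p - 1 + (Module.finrank ℝ EX - q - 1) + 1)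
      (PhaseModel EX EF), contr S (liftX hπ w z) = poissonBracket hπ Ω p F G z := by
  have hp := hP.lt
  have hq := hQ.lt
  rcases le_or_gt (Module.finrank ℝ EX) (p + q + 1) with h | h
  · obtain ⟨S, -, hS, hSF⟩ :=
      (isHamiltonianField_poissonBracket hΩ hP hQ h).exists_contr_liftX hw
    refine ⟨S z, ?_, hSF z⟩
    rw [show Module.finrank ℝ EX - p - 1 + (Module.finrank ℝ EX - q - 1) + 1 =
      Module.finrank ℝ EX - (p + q + 1 - Module.finrank ℝ EX) by omega]
    exact hS z
  · refine ⟨0, Submodule.zero_mem _, ?_⟩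
    rw [poissonBracket_eq_zero hP hQ h, map_zero]
    rfl

/-- The graded Leibniz rule. -/
theorem poissonBracket_coexterior (hw : IsVolumeForm (Module.finrank ℝ EX) w)
    (hΩ : IsPolysymplectic hπ Ω) (hF : F ∈ hamForms hπ Ω p) (hG : G ∈ hamForms hπ Ω q)
    (hK : K ∈ hamForms hπ Ω r) :
    poissonBracket hπ Ω p F (coexterior hπ w G K) =
      coexterior hπ w (poissonBracket hπ Ω p F G) K +
        (-1 : ℝ) ^ ((Module.finrank ℝ EX - p - 1) * (Module.finrank ℝ EX - q - 1 + 1)) •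
          coexterior hπ w G (poissonBracket hπ Ω p F K) := by
  obtain ⟨P, hP⟩ := hF
  obtain ⟨Q, hQ⟩ := hG
  obtain ⟨R, hR⟩ := hK
  obtain ⟨B, hB, hBb, hBG⟩ := hQ.exists_contr_liftX hw
  obtain ⟨C, hC, hCc, hCK⟩ := hR.exists_contr_liftX hw
  obtain ⟨T, hT⟩ := exists_isHamiltonianPair_coexterior hw hQ hR
  have hp := hP.lt
  have hq := hQ.lt
  have hP' := hP.isHamiltonianPair
  have h1 : coexterior hπ w G K = fun z => contr (B z * C z) (liftX hπ w z) :=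
    funext fun z => coexterior_eq hw (hBG z) (hCK z)
  rw [poissonBracket_eq hP hT, h1]
  funext z
  obtain ⟨S, hSa, hS⟩ := exists_contr_liftX_poissonBracket hw hΩ hP hQ z
  obtain ⟨D, -, hD⟩ := exists_contr_liftX_poissonBracket hw hΩ hP hR z
  rw [Pi.add_apply, Pi.smul_apply, coexterior_eq hw hS (hCK z), coexterior_eq hw (hBG z) hD]
  rw [poissonBracket_eq hP hQ.isHamiltonianPair] at hS
  rw [poissonBracket_eq hP hR.isHamiltonianPair] at hD
  obtain ⟨a, ha⟩ : ∃ a, Module.finrank ℝ EX - p = a + 1 := ⟨_, (Nat.succ_pred (by omega)).symm⟩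
  obtain ⟨b, hb⟩ : ∃ b, Module.finrank ℝ EX - q = b + 1 := ⟨_, (Nat.succ_pred (by omega)).symm⟩
  simp only [ha, hb, Nat.add_sub_cancel] at hP' hBb hSa hS hD ⊢
  exact hP'.leibniz (smoothForm_liftX hw.smooth) (liftX_mem_horizontal w)
    (extD_liftX hw.smooth hw.degree) hB hBb hBG hC hCc hCK hSa hS hD

/-- The Hamiltonian forms are a Poisson–Gerstenhaber algebra. -/
theorem isPoissonGerstenhaber_hamForms (hw : IsVolumeForm (Module.finrank ℝ EX) w)
    (hΩ : IsPolysymplectic hπ Ω) :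
    IsPoissonGerstenhaber (Module.finrank ℝ EX) (hamForms hπ Ω) (poissonBracket hπ Ω)
      (coexterior hπ w) where
  zero_mem p hp := ⟨0, isHamiltonianField_zero hp⟩
  add_mem := by
    rintro p F ⟨P, hP⟩ F' ⟨P', hP'⟩
    exact ⟨_, hP.add hP'⟩
  smul_mem := by
    rintro p t F ⟨P, hP⟩
    exact ⟨_, hP.smul t⟩
  br_mem := by
    rintro p q h F ⟨P, hP⟩ G ⟨Q, hQ⟩
    exact ⟨_, isHamiltonianField_poissonBracket hΩ hP hQ h⟩
  br_eq_zero := by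
    rintro p q h F ⟨P, hP⟩ G ⟨Q, hQ⟩
    exact poissonBracket_eq_zero hP hQ h
  mul_mem := by
    rintro p q h F ⟨P, hP⟩ G ⟨Q, hQ⟩
    exact coexterior_mem_hamForms hw hP hQ h
  mul_eq_zero := by
    rintro p q h F ⟨P, hP⟩ G ⟨Q, hQ⟩
    exact coexterior_eq_zero hw hP hQ h
  add_br := by
    rintro p q F ⟨P, hP⟩ F' ⟨P', hP'⟩ G ⟨Q, hQ⟩
    have hQ' := hQ.isHamiltonianPair
    rw [poissonBracket_eq (hP.add hP') hQ', poissonBracket_eq hP hQ', poissonBracket_eq hP' hQ']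
    funext z
    simp only [Pi.add_apply, map_add, LinearMap.add_apply, smul_add]
  smul_br := by
    rintro p q t F ⟨P, hP⟩ G ⟨Q, hQ⟩
    have hQ' := hQ.isHamiltonianPair
    rw [poissonBracket_eq (hP.smul t) hQ', poissonBracket_eq hP hQ']
    funext z
    simp only [Pi.smul_apply, map_smul, LinearMap.smul_apply]
    exact smul_comm _ _ _
  br_add := by
    rintro p q F ⟨P, hP⟩ G ⟨Q, hQ⟩ G' ⟨Q', hQ'⟩
    rw [poissonBracket_eq hP (hQ.add hQ').isHamiltonianPair,
      poissonBracket_eq hP hQ.isHamiltonianPair, poissonBracket_eq hP hQ'.isHamiltonianPair]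
    funext z
    have h : extD (G + G') z = extD G z + extD G' z := extD_add hQ.smooth_form hQ'.smooth_form z
    simp only [h, Pi.add_apply, map_add, smul_add]
  br_smul := by
    rintro p q t F ⟨P, hP⟩ G ⟨Q, hQ⟩
    rw [poissonBracket_eq hP (hQ.smul t).isHamiltonianPair,
      poissonBracket_eq hP hQ.isHamiltonianPair]
    funext z
    have h : extD (t • G) z = t • extD G z := extD_const_smul t hQ.smooth_form z
    simp only [h, Pi.smul_apply, map_smul]
    exact smul_comm _ _ _
  add_mul := by
    rintro p q F ⟨P, hP⟩ F' ⟨P', hP'⟩ G ⟨Q, hQ⟩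
    obtain ⟨A, -, -, hA⟩ := hP.exists_contr_liftX hw
    obtain ⟨A', -, -, hA'⟩ := hP'.exists_contr_liftX hw
    obtain ⟨B, -, -, hB⟩ := hQ.exists_contr_liftX hw
    funext z
    have h : contr (A z + A' z) (liftX hπ w z) = (F + F') z := by
      rw [map_add, LinearMap.add_apply, hA, hA', Pi.add_apply]
    rw [Pi.add_apply, coexterior_eq hw h (hB z), coexterior_eq hw (hA z) (hB z),
      coexterior_eq hw (hA' z) (hB z), _root_.add_mul, map_add, LinearMap.add_apply]
  smul_mul := by
    rintro p q t F ⟨P, hP⟩ G ⟨Q, hQ⟩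
    obtain ⟨A, -, -, hA⟩ := hP.exists_contr_liftX hw
    obtain ⟨B, -, -, hB⟩ := hQ.exists_contr_liftX hw
    funext z
    have h : contr (t • A z) (liftX hπ w z) = (t • F) z := by
      rw [map_smul, LinearMap.smul_apply, hA, Pi.smul_apply]
    rw [Pi.smul_apply, coexterior_eq hw h (hB z), coexterior_eq hw (hA z) (hB z),
      smul_mul_assoc, map_smul, LinearMap.smul_apply]
  mul_comm := by
    rintro p q F ⟨P, hP⟩ G ⟨Q, hQ⟩
    obtain ⟨A, -, hAa, hA⟩ := hP.exists_contr_liftX hw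
    obtain ⟨B, -, hBb, hB⟩ := hQ.exists_contr_liftX hw
    funext z
    rw [Pi.smul_apply, coexterior_eq hw (hA z) (hB z), coexterior_eq hw (hB z) (hA z),
      mul_comm_of_mem (hAa z) (hBb z), map_smul, LinearMap.smul_apply]
  mul_assoc := by
    rintro p q r F ⟨P, hP⟩ G ⟨Q, hQ⟩ K ⟨R, hR⟩
    obtain ⟨A, -, -, hA⟩ := hP.exists_contr_liftX hw
    obtain ⟨B, -, -, hB⟩ := hQ.exists_contr_liftX hw
    obtain ⟨C, -, -, hC⟩ := hR.exists_contr_liftX hw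
    funext z
    rw [coexterior_eq hw (coexterior_eq hw (hA z) (hB z)).symm (hC z),
      coexterior_eq hw (hA z) (coexterior_eq hw (hB z) (hC z)).symm, _root_.mul_assoc]
  antisymm := by
    rintro p q F ⟨P, hP⟩ G ⟨Q, hQ⟩
    have hp := hP.lt
    have hq := hQ.lt
    rw [poissonBracket_eq hP hQ.isHamiltonianPair, poissonBracket_eq hQ hP.isHamiltonianPair]
    funext z
    rw [Pi.neg_apply, Pi.smul_apply, hP.isHamiltonianPair.contr_extD_comm hQ.isHamiltonianPair]
    obtain ⟨a, ha⟩ : ∃ a, Module.finrank ℝ EX - p = a + 1 := ⟨_, (Nat.succ_pred (by omega)).symm⟩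
    obtain ⟨b, hb⟩ : ∃ b, Module.finrank ℝ EX - q = b + 1 := ⟨_, (Nat.succ_pred (by omega)).symm⟩
    rw [ha, hb, Nat.add_sub_cancel, Nat.add_sub_cancel, smul_smul, smul_smul, ← neg_smul]
    congr 1
    rcases neg_one_pow_eq_or ℝ a with ha | ha <;> rcases neg_one_pow_eq_or ℝ b with hb | hb <;>
      simp [pow_add, pow_mul, mul_add, add_mul, ha, hb]
  jacobi := by
    rintro p q r F ⟨P, hP⟩ G ⟨Q, hQ⟩ K ⟨R, hR⟩
    have hp := hP.lt
    have hq := hQ.lt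
    have hr := hR.lt
    have hP' := hP.isHamiltonianPair
    have hQ' := hQ.isHamiltonianPair
    have hR' := hR.isHamiltonianPair
    rw [poissonBracket_eq hP (isHamiltonianPair_poissonBracket hΩ hQ hR'
        (c := Module.finrank ℝ EX - q - 1 + (Module.finrank ℝ EX - r)) (by omega)),
      poissonBracket_eq hQ (isHamiltonianPair_poissonBracket hΩ hR hP'
        (c := Module.finrank ℝ EX - r - 1 + (Module.finrank ℝ EX - p)) (by omega)),
      poissonBracket_eq hR (isHamiltonianPair_poissonBracket hΩ hP hQ'
        (c := Module.finrank ℝ EX - p - 1 + (Module.finrank ℝ EX - q)) (by omega)),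
      poissonBracket_eq hP hQ', poissonBracket_eq hQ hR', poissonBracket_eq hR hP']
    funext z
    simp only [Pi.add_apply, Pi.smul_apply, Pi.zero_apply]
    obtain ⟨a, ha⟩ : ∃ a, Module.finrank ℝ EX - p = a + 1 := ⟨_, (Nat.succ_pred (by omega)).symm⟩
    obtain ⟨b, hb⟩ : ∃ b, Module.finrank ℝ EX - q = b + 1 := ⟨_, (Nat.succ_pred (by omega)).symm⟩
    obtain ⟨c, hc⟩ : ∃ c, Module.finrank ℝ EX - r = c + 1 := ⟨_, (Nat.succ_pred (by omega)).symm⟩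
    simp only [ha, hb, hc, Nat.add_sub_cancel] at hP' hQ' hR' ⊢
    exact hP'.jacobi isAdapted_vertZ hΩ.smooth hΩ.extD_mem hQ' hR' z
  leibniz := by
    intro p q r F hF G hG K hK
    exact poissonBracket_coexterior hw hΩ hF hG hK

end

end HamiltonianForms

end Polysymplectic

end

theorem theorem1 {EX EY EF : Type*}
    [NormedAddCommGroup EX] [NormedSpace ℝ EX] [FiniteDimensional ℝ EX]
    [NormedAddCommGroup EY] [NormedSpace ℝ EY] [FiniteDimensional ℝ EY]
    [NormedAddCommGroup EF] [NormedSpace ℝ EF] [FiniteDimensional ℝ EF]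
    {X : Type*} [TopologicalSpace X] [T2Space X] [SecondCountableTopology X]
    [ChartedSpace EX X] [IsManifold 𝓘(ℝ, EX) ∞ X]
    {Y : Type*} [TopologicalSpace Y] [T2Space Y] [SecondCountableTopology Y]
    [ChartedSpace EY Y] [IsManifold 𝓘(ℝ, EY) ∞ Y]
    {n : ℕ} (hn : Module.finrank ℝ EX = n)
    {π : Y → X} (hπ : Polysymplectic.IsFibered EX EY EF π)
    {w : X → Polysymplectic.Covec EX} (hw : Polysymplectic.IsVolumeForm n w)
    {Ω : Polysymplectic.PhaseSpace hπ →
      Polysymplectic.Covec (Polysymplectic.PhaseModel EX EF)}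
    (hΩ : Polysymplectic.IsPolysymplectic hπ Ω) :
    -- Hamiltonian forms and fields do not depend on the representative of the polysymplectic form
    (∀ Ω', Polysymplectic.IsPolysymplectic hπ Ω' → ∀ p F P,
      Polysymplectic.IsHamiltonianField hπ Ω p F P ↔
        Polysymplectic.IsHamiltonianField hπ Ω' p F P) ∧
    -- the bracket is induced by the Schouten–Nijenhuis bracket of the Hamiltonian fields
    (∀ p q F G P Q, Polysymplectic.IsHamiltonianField hπ Ω p F P →
      Polysymplectic.IsHamiltonianField hπ Ω q G Q →
      (∀ z, Polysymplectic.poissonBracket hπ Ω p F G z =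
          (-1 : ℝ) ^ (n - p) • Polysymplectic.contr (P z) (Polysymplectic.extD G z)) ∧
      (∀ z, Polysymplectic.poissonBracket hπ Ω p F G z =
          (-1 : ℝ) ^ (n - p) •
            Polysymplectic.contr (P z) (Polysymplectic.contr (Q z) (Ω z))) ∧
      (∀ z, Polysymplectic.contr (Polysymplectic.schouten P Q z) (Ω z) -
          -Polysymplectic.extD (Polysymplectic.poissonBracket hπ Ω p F G) z ∈
        Polysymplectic.horizontal (Polysymplectic.vertZ hπ z)) ∧
      (n ≤ p + q + 1 → Polysymplectic.IsHamiltonianField hπ Ω (p + q + 1 - n)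
        (Polysymplectic.poissonBracket hπ Ω p F G)
        (fun z => -Polysymplectic.schouten P Q z))) ∧
    -- the co-exterior product is induced by the exterior product of multivectors
    (∀ p q, ∀ F ∈ Polysymplectic.hamForms hπ Ω p, ∀ G ∈ Polysymplectic.hamForms hπ Ω q, ∀ z,
      (∃ A ∈ ⋀[ℝ]^(n - p) (Polysymplectic.PhaseModel EX EF),
        Polysymplectic.contr A (Polysymplectic.liftX hπ w z) = F z) ∧
      ∀ A B, Polysymplectic.contr A (Polysymplectic.liftX hπ w z) = F z →
        Polysymplectic.contr B (Polysymplectic.liftX hπ w z) = G z →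
        Polysymplectic.coexterior hπ w F G z =
          Polysymplectic.contr (A * B) (Polysymplectic.liftX hπ w z)) ∧
    -- the algebra
    Polysymplectic.IsPoissonGerstenhaber n (Polysymplectic.hamForms hπ Ω)
      (Polysymplectic.poissonBracket hπ Ω) (Polysymplectic.coexterior hπ w) := by
  subst hn
  refine ⟨fun Ω' hΩ' p F P => ⟨fun h => h.of_isPolysymplectic hΩ hΩ',
    fun h => h.of_isPolysymplectic hΩ' hΩ⟩, fun p q F G P Q hP hQ => ⟨fun z => ?_, fun z => ?_,
    fun z => Polysymplectic.contr_schouten_sub_mem hΩ hP hQ z,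
    fun h => Polysymplectic.isHamiltonianField_poissonBracket hΩ hP hQ h⟩, ?_,
    Polysymplectic.isPoissonGerstenhaber_hamForms hw hΩ⟩
  · rw [Polysymplectic.poissonBracket_eq hP hQ.isHamiltonianPair]
  · rw [Polysymplectic.poissonBracket_eq hP hQ.isHamiltonianPair,
      hP.isHamiltonianPair.contr_contr hQ.isHamiltonianPair]
  · rintro p q F ⟨P, hP⟩ G - z
    obtain ⟨A, -, hAa, hA⟩ := hP.exists_contr_liftX hw
    exact ⟨⟨A z, hAa z, hA z⟩, fun A B hA hB => Polysymplectic.coexterior_eq hw hA hB⟩
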